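/- Let $d\ge 1$, $\beta>0$ and $a>b>0$. **Model.** Let $q_k=(4\pi\beta)^{-d/2}k^{-1-d/2}$ for $k\in\mathbb N$. For $\alpha<0$ and a centred box $\Lambda\subset\mathbb R^d$, let $\mathsf Q$ be the law of independent cycle counts $N_k$, $k\in\mathbb N$, where $N_k$ is Poisson with parameter $|\Lambda|q_k e^{\beta\alpha k}$, and let $\mathsf E$ be its expectation. Put $\lambda_k=N_k/|\Lambda|$, $\bar q^{(\alpha)}=\sum_k q_ke^{\beta\alpha k}$ and, for $m_\Lambda\in\mathbb N$ and $\mu\in\mathbb R$, $$H_\Lambda=|\Lambda|\Big(-(\mu-\alpha)\sum_k k\lambda_k+\frac a2\Big(\sum_k k\lambda_k\Big)^2-\frac b2\sum_{k\ge m_\Lambda}k^2\lambda_k^2\Big).$$ For $\kappa\in[0,\infty]$ the thermodynamic pressure is $$p^{(\kappa)}(\beta,\alpha,\mu)=\lim \frac1{\beta|\Lambda|}\log\Big(e^{|\Lambda|\bar q^{(\alpha)}}\,\mathsf E\big[e^{-\beta H_\Lambda}\big]\Big),$$ where the limit is along any sequence of centred boxes with $|\Lambda|\to\infty$ and any $m_\Lambda\to\infty$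 with $m_\Lambda/|\Lambda|\to\kappa$. **Ideal gas.** Let $p_0(\beta,s)=\frac1\beta\sum_k q_ke^{\beta sk}$ for $s\le 0$, with $'$ denoting $\partial_s$, and $f_0(\beta,x)=\sup_{s\le0}\{sx-p_0(\beta,s)\}$ for $x\ge0$. Let $\varrho_c=(4\pi\beta)^{-d/2}\sum_k k^{-d/2}$ if $d\ge3$ and $\varrho_c=\infty$ if $d\le2$, and let $\mu_c=a\varrho_c$. For $x>0$ let $s_\beta(x)=0$ if $x\ge\varrho_c$, and otherwise let $s_\beta(x)$ be the unique $s<0$ with $p_0'(\beta,s)=x$. **Rate function.** For $\kappa\in[0,\infty]$ let $\mathbb K(\kappa)=\mathbb R_+\times(\{0\}\cup[\kappa,\infty))$ (so $\mathbb K(\infty)=\mathbb R_+\times\{0\}$) and $$G_\mu(x,y)=\mu(x+y)-\frac a2(x+y)^2+\frac b2y^2-f_0(\beta,x).$$ Let $I^{(\kappa)}_\mu=\sup_{\mathbb K(\kappa)}G_\mu-G_\mu$ on $\mathbb K(\kappa)$ and $I^{(\kappa)}_\mu=+\infty$ elsewhere. Call $\bar\mu\in\mathbb R$ a *transition potential*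 for $\kappa$ if $I^{(\kappa)}_\mu$ has exactly one zero $(x,y)$ for every $\mu\ne\bar\mu$, with $y=0$ if $\mu<\bar\mu$ and $y>0$ if $\mu>\bar\mu$. There is at most one such $\bar\mu$. **Parameters.** Let $\mu_t=\inf_{s<0}\{a\,p_0'(\beta,s)-\frac{a-b}{b}s\}$. For $\mu\ge\mu_t$ let $\tilde x_2(\mu)$ be the smallest $x>0$ with $s_\beta(x)=-\frac b{a-b}(\mu-ax)$. For $\kappa\in(0,\infty)$ let $\mu_r=\mu_r(\kappa)=\inf\{s\ge\mu_t:\tilde x_2(s)\le\frac1a(s-\kappa(a-b))\}$. Let $$p_{\rm sub}(\beta,\mu)=\inf_{s<0}\Big\{\frac{(\mu-s)^2}{2a}+p_0(\beta,s)\Big\},\qquad p_{\rm sup}(\beta,\mu)=\sup_{s<0,\ a\,p_0'(\beta,s)\le\mu}\Big\{\frac{(\mu-s)^2}{2a}-\frac{s^2}{2b}+p_0(\beta,s)\Big\}.$$ **Claim.** In each case below the limit defining $p^{(\kappa)}(\beta,\alpha,\mu)$ exists for all $\alpha<0$ and $\mu\in\mathbb R$, and it has the stated value. 1. ($\kappa=0$)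 There is a transition potential $\mu^*$ for $\kappa=0$. It satisfies $\mu_t\le\mu^*\le\mu_c$, and $$p^{(0)}(\beta,\alpha,\mu)=\begin{cases}p_{\rm sub}(\beta,\mu)&\text{for }\mu\le\mu^*,\\ p_{\rm sup}(\beta,\mu)&\text{for }\mu\ge\mu^*.\end{cases}$$ 2. ($\kappa\in(0,\infty)$) There is a transition potential $\mu^*_\kappa$ for $\kappa$. It satisfies $\mu^*_\kappa=\mu^*$ if $\mu_r\le\mu^*$, and $\mu^*<\mu^*_\kappa<\mu_r$ if $\mu_r>\mu^*$. Moreover $$p^{(\kappa)}(\beta,\alpha,\mu)=\begin{cases}p_{\rm sub}(\beta,\mu)&\text{for }\mu\le\mu^*_\kappa,\\ p_{\rm sub}(\beta,\mu-a\kappa)+\mu\kappa-\frac{a-b}2\kappa^2&\text{for }\mu\in[\mu^*_\kappa,\mu_r],\\ p_{\rm sup}(\beta,\mu)&\text{for }\mu\ge\max\{\mu_r,\mu^*\}.\end{cases}$$ 3. ($\kappa=\infty$) $p^{(\infty)}(\beta,\alpha,\mu)=p_{\rm sub}(\beta,\mu)$ for all $\mu\in\mathbb R$. -/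

import Mathlib

open Filter Topology MeasureTheory
open scoped ENNReal

namespace CycleHYL

noncomputable section

/-! ### The ideal Bose gas and the reference process of cycle counts -/

/-- The cycle weights `q_k = (4πβ)^{-d/2} k^{-(1+d/2)}`. -/
def cycleWeight (d : ℕ) (β : ℝ) (k : ℕ+) : ℝ :=
  1 / ((4 * Real.pi * β) ^ ((d : ℝ) / 2) * (k : ℝ) ^ (1 + (d : ℝ) / 2))

/-- The total intensity `∑_k q_k e^{β α k}`, for `α ≤ 0`. -/
def totalWeight (d : ℕ) (β α : ℝ) : ℝ :=
  ∑' k : ℕ+, cycleWeight d β k * Real.exp (β * α * k)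

/-- The pressure `p₀(β, s)` of the ideal Bose gas. The series converges exactly for `s ≤ 0`; the
pressure is `+∞` for `s > 0`, and this definition is only ever used at `s ≤ 0`. -/
def idealPressure (d : ℕ) (β s : ℝ) : ℝ := (1 / β) * totalWeight d β s

/-- The free energy `f₀(β, x) = sup_s {s x - p₀(β, s)}` for `x ≥ 0`. Only `s ≤ 0` contributes to
the supremum, since `p₀(β, s) = +∞` for `s > 0`. -/
def freeEnergy (d : ℕ) (β x : ℝ) : ℝ :=
  sSup ((fun s : ℝ => s * x - idealPressure d β s) '' Set.Iic 0)

/-- A configuration of cycle counts: `N k` is the number of cycles of length `k` in the box. A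
summable family of natural numbers has finite support. The normalised count is
`λ_k = N k / V` in a box of volume `V`. -/
abbrev CycleCounts : Type := ℕ+ →₀ ℕ

/-- The probability of the cycle counts `N` under the reference process in a box of volume `V`:
the `N k` are independent Poisson variables of parameters `V q_k e^{β α k}`. -/
def refProb (d : ℕ) (β α V : ℝ) (N : CycleCounts) : ℝ :=
  Real.exp (-(V * totalWeight d β α)) *
    N.prod fun k n => (V * cycleWeight d β k * Real.exp (β * α * k)) ^ n / (n.factorial : ℝ)

/-- Expectation with respect to the reference process. -/
def refExpectation (d : ℕ) (β α V : ℝ) (f : CycleCounts → ℝ) : ℝ :=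
  ∑' N : CycleCounts, refProb d β α V N * f N

/-- The Hamiltonian of the spatial cycle HYL model in a box of volume `V`,
`V (-(μ-α) ∑ k λ_k + a/2 (∑ k λ_k)² - b/2 ∑_{k ≥ m} k² λ_k²)`. -/
def hamiltonian (α μ a b V : ℝ) (m : ℕ) (N : CycleCounts) : ℝ :=
  V * (-(μ - α) * (N.sum fun k n => (k : ℝ) * ((n : ℝ) / V))
    + a / 2 * (N.sum fun k n => (k : ℝ) * ((n : ℝ) / V)) ^ 2
    - b / 2 * (N.sum fun k n => if m ≤ (k : ℕ) then (k : ℝ) ^ 2 * ((n : ℝ) / V) ^ 2 else 0))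

/-- The partition function in a box of volume `V`. -/
def partitionFunction (d : ℕ) (β α μ a b V : ℝ) (m : ℕ) : ℝ :=
  Real.exp (V * totalWeight d β α) *
    refExpectation d β α V fun N => Real.exp (-(β * hamiltonian α μ a b V m N))

/-- The pressure in a box of volume `V`. -/
def finitePressure (d : ℕ) (β α μ a b V : ℝ) (m : ℕ) : ℝ :=
  1 / (β * V) * Real.log (partitionFunction d β α μ a b V m)

/-- The centred box in `ℝ^d` with side lengths `L i`. -/
def centredBox {d : ℕ} (L : Fin d → ℝ) : Set (EuclideanSpace ℝ (Fin d)) :=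
  {x | ∀ i, |x i| ≤ L i / 2}

/-- `p` is the thermodynamic pressure of the spatial cycle HYL model with parameter `κ`: along
every sequence of centred boxes `Λ` with `|Λ| → ∞` and every `m → ∞` with `m / |Λ| → κ`, the
finite-volume pressures converge to `p`. -/
def HasPressure (d : ℕ) (β α μ a b : ℝ) (κ : ℝ≥0∞) (p : ℝ) : Prop :=
  ∀ (L : ℕ → Fin d → ℝ) (m : ℕ → ℕ),
    (∀ n i, 0 < L n i) →
    Tendsto (fun n => volume (centredBox (L n))) atTop (𝓝 ∞) →
    Tendsto m atTop atTop →
    Tendsto (fun n => (m n : ℝ≥0∞) / volume (centredBox (L n))) atTop (𝓝 κ) →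
    Tendsto (fun n => finitePressure d β α μ a b (volume (centredBox (L n))).toReal (m n))
      atTop (𝓝 p)

/-! ### The rate function and its zeroes -/

/-- The set `ℝ₊ × ({0} ∪ [κ, ∞))`, for `κ ∈ [0, ∞]`. -/
def admissible (κ : ℝ≥0∞) : Set (ℝ × ℝ) :=
  {z | 0 ≤ z.1 ∧ 0 ≤ z.2 ∧ (z.2 = 0 ∨ κ ≤ ENNReal.ofReal z.2)}

/-- `μ (x+y) - a/2 (x+y)² + b/2 y² - f₀(β, x)`. -/
def pressureFunctional (d : ℕ) (β μ a b : ℝ) (z : ℝ × ℝ) : ℝ :=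
  μ * (z.1 + z.2) - a / 2 * (z.1 + z.2) ^ 2 + b / 2 * z.2 ^ 2 - freeEnergy d β z.1

/-- The rate function of the pair empirical particle density. -/
def rateFunction (d : ℕ) (β μ a b : ℝ) (κ : ℝ≥0∞) (z : ℝ × ℝ) : EReal :=
  open Classical in
  if z ∈ admissible κ then
    ((sSup (pressureFunctional d β μ a b '' admissible κ) - pressureFunctional d β μ a b z : ℝ) :
      EReal)
  else ⊤

/-- The zeroes of the rate function. -/
def zeroes (d : ℕ) (β μ a b : ℝ) (κ : ℝ≥0∞) : Set (ℝ × ℝ) :=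
  {z | rateFunction d β μ a b κ z = 0}

/-- `m` is the transition chemical potential: the rate function has exactly one zero for each
`μ ≠ m`, whose second component (the density in infinitely long cycles) is `0` for `μ < m` and
positive for `μ > m`. -/
def IsTransition (d : ℕ) (β a b : ℝ) (κ : ℝ≥0∞) (m : ℝ) : Prop :=
  (∀ μ < m, ∃ x : ℝ, zeroes d β μ a b κ = {(x, 0)}) ∧
  (∀ μ > m, ∃ x y : ℝ, 0 < y ∧ zeroes d β μ a b κ = {(x, y)})

/-! ### Critical parameters -/

/-- The critical density of the ideal Bose gas; it is infinite in dimensions 1 and 2. -/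
def criticalDensity (d : ℕ) (β : ℝ) : EReal :=
  if 3 ≤ d then
    ((1 / (4 * Real.pi * β) ^ ((d : ℝ) / 2) * ∑' k : ℕ+, 1 / (k : ℝ) ^ ((d : ℝ) / 2) : ℝ) : EReal)
  else ⊤

/-- `s_β(x)`: it is `0` for `x ≥ ϱ_c`, and for `0 < x < ϱ_c` it is the unique `s < 0` with
`p₀'(β, s) = x` (the supremum is over a one-point set). -/
def sBeta (d : ℕ) (β x : ℝ) : ℝ :=
  open Classical in
  if criticalDensity d β ≤ (x : EReal) then 0
  else sSup {s : ℝ | s < 0 ∧ deriv (idealPressure d β) s = x}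

/-- `μ_c = a ϱ_c`. -/
def muC (d : ℕ) (β a : ℝ) : EReal := (a : EReal) * criticalDensity d β

/-- `μ_t = inf_{s<0} {a p₀'(β, s) - ((a-b)/b) s}`. -/
def muT (d : ℕ) (β a b : ℝ) : ℝ :=
  sInf ((fun s : ℝ => a * deriv (idealPressure d β) s - (a - b) / b * s) '' Set.Iio 0)

/-- For `μ ≥ μ_t`, the minimal solution `x > 0` of `s_β(x) = -(b/(a-b)) (μ - a x)`. -/
def xTwo (d : ℕ) (β a b μ : ℝ) : ℝ :=
  sInf {x : ℝ | 0 < x ∧ sBeta d β x = -(b / (a - b)) * (μ - a * x)}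

/-- `μ_r = inf {s ≥ μ_t : x₂(s) ≤ (s - κ (a-b)) / a}`. -/
def muR (d : ℕ) (β a b κ : ℝ) : ℝ :=
  sInf {s : ℝ | muT d β a b ≤ s ∧ xTwo d β a b s ≤ 1 / a * (s - κ * (a - b))}

/-! ### Sub- and supercritical pressure -/

/-- `p_sub(β, μ) = inf_{s<0} {(μ-s)²/(2a) + p₀(β, s)}`. -/
def pSub (d : ℕ) (β a μ : ℝ) : ℝ :=
  sInf ((fun s : ℝ => (μ - s) ^ 2 / (2 * a) + idealPressure d β s) '' Set.Iio 0)

/-- `p_sup(β, μ) = sup {(μ-s)²/(2a) - s²/(2b) + p₀(β, s) : s < 0, a p₀'(β, s) ≤ μ}`. The side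
condition says that the density `y = (μ - a x)/(a-b)`, where `x = p₀'(β, s)`, is nonnegative; it
holds for all `s < 0` when `μ ≥ μ_c`. -/
def pSup (d : ℕ) (β a b μ : ℝ) : ℝ :=
  sSup ((fun s : ℝ => (μ - s) ^ 2 / (2 * a) - s ^ 2 / (2 * b) + idealPressure d β s) ''
    {s : ℝ | s < 0 ∧ a * deriv (idealPressure d β) s ≤ μ})

end

end CycleHYL

namespace CycleHYL

open Set

/-! ### Analysis of the ideal gas pressure -/

/-! The theorem is a Laplace principle followed by a variational problem in one variable. Let `y` be
the density of particles in cycles of length at least `m`, and `x` the density of the rest. For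
fixed `y`, `G_μ(x, y)` is strictly concave in `x`, and Legendre duality gives its supremum over `x`
as `T_μ(y) = p_sub(μ - a y) + μ y - (a-b)/2 y²` (`reducedFunctional`). The pressure is the maximum
of `T_μ` over `{0} ∪ [κ, ∞)` (`hasPressure_of_isMaxOn`), and the zeroes of the rate function
correspond to the maximisers (`mem_zeroes_iff`).

Upper bound on the pressure: the counter term is at most `y²`, and linearising the square in `x` at
its optimum turns the sum over short cycles into a Poisson sum (`sum_boltzmannWeight_le`). Lower
bound: a single configuration suffices, with finitely many short lengths and at most one long cycle
carrying `y` (`eventually_le_finitePressure`).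

A global maximiser `y > 0` of `T_μ` (a peak) is stationary: `s = -b y` solves `φ(s) = μ`, where
`φ(s) = a p₀'(s) - (a-b)/b s` (`stationaryPotential`, `isMinimiser_of_isMaxOn`). As `φ` is strictly
convex there are at most two solutions, and a peak is the smaller one
(`IsPeak.lt_stationaryPotential`); so peaks are unique and grow with `μ`. The potentials at which
some `y > 0` beats `0` form an up-set with infimum `μ*` (`exists_isThreshold`). At a peak, `T_μ`
equals the function maximised in `p_sup`.

For `0 < κ < ∞`, `μ_r` is the minimum of `φ` on `s ≤ -bκ` (`exists_muR_eq`). Below `μ_r` no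
maximiser exceeds `κ`, so only `0` and `κ` compete. The gain `T_μ(κ) - T_μ(0)` is nondecreasing in
`μ`, strictly so while it is nonpositive, and if `μ* < μ_r` it changes sign exactly once, at `μ*_κ`
(`IsThreshold.exists_gain_eq_zero`). Above both `μ_r` and `μ*`, the peak itself is admissible. -/

lemma cycleWeight_pos (d : ℕ) {β : ℝ} (hβ : 0 < β) (k : ℕ+) : 0 < cycleWeight d β k := by
  unfold cycleWeight
  have := Real.pi_pos
  have hk : (0 : ℝ) < k := by exact_mod_cast k.pos
  positivity

lemma one_le_pnat_cast (k : ℕ+) : (1 : ℝ) ≤ k := by exact_mod_cast k.2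

lemma mul_cycleWeight (d : ℕ) {β : ℝ} (hβ : 0 < β) (k : ℕ+) :
    (k : ℝ) * cycleWeight d β k =
      1 / (4 * Real.pi * β) ^ ((d : ℝ) / 2) * (1 / (k : ℝ) ^ ((d : ℝ) / 2)) := by
  unfold cycleWeight
  have hk : (0 : ℝ) < k := by exact_mod_cast k.pos
  have := Real.pi_pos
  rw [Real.rpow_add hk, Real.rpow_one]
  have h1 : (0 : ℝ) < (4 * Real.pi * β) ^ ((d : ℝ) / 2) := by positivity
  have h2 : (0 : ℝ) < (k : ℝ) ^ ((d : ℝ) / 2) := by positivity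
  field_simp

lemma summable_cycleWeight {d : ℕ} (hd : 1 ≤ d) (β : ℝ) : Summable (cycleWeight d β) := by
  unfold cycleWeight
  have h : Summable fun k : ℕ => 1 / (k : ℝ) ^ (1 + (d : ℝ) / 2) := by
    rw [Real.summable_one_div_nat_rpow]
    have : (1 : ℝ) ≤ d := by exact_mod_cast hd
    linarith
  have h' : Summable fun k : ℕ+ => 1 / ((k : ℕ) : ℝ) ^ (1 + (d : ℝ) / 2) :=
    h.comp_injective PNat.coe_injective
  refine (h'.mul_left (1 / (4 * Real.pi * β) ^ ((d : ℝ) / 2))).congr fun k => ?_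
  rw [one_div_mul_one_div]

lemma exp_le_one_of_nonpos {β s : ℝ} (hβ : 0 < β) (hs : s ≤ 0) (k : ℕ+) :
    Real.exp (β * s * k) ≤ 1 := by
  rw [Real.exp_le_one_iff]
  have hk : (0 : ℝ) < k := by exact_mod_cast k.pos
  have : β * s ≤ 0 := mul_nonpos_of_nonneg_of_nonpos hβ.le hs
  exact mul_nonpos_of_nonpos_of_nonneg this hk.le

lemma summable_cycleWeight_exp {d : ℕ} (hd : 1 ≤ d) {β s : ℝ} (hβ : 0 < β) (hs : s ≤ 0) :
    Summable fun k : ℕ+ => cycleWeight d β k * Real.exp (β * s * k) := by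
  refine (summable_cycleWeight hd β).of_nonneg_of_le
    (fun k => mul_nonneg (cycleWeight_pos d hβ k).le (Real.exp_pos _).le) fun k => ?_
  exact mul_le_of_le_one_right (cycleWeight_pos d hβ k).le (exp_le_one_of_nonpos hβ hs k)

/-- The density `∑_k k q_k e^{β s k}` of the ideal gas, the derivative of the pressure. -/
noncomputable def idealDensity (d : ℕ) (β s : ℝ) : ℝ :=
  ∑' k : ℕ+, (k : ℝ) * cycleWeight d β k * Real.exp (β * s * k)

lemma mul_cycleWeight_le (d : ℕ) {β : ℝ} (hβ : 0 < β) (k : ℕ+) :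
    (k : ℝ) * cycleWeight d β k ≤ 1 / (4 * Real.pi * β) ^ ((d : ℝ) / 2) := by
  rw [mul_cycleWeight d hβ]
  have := Real.pi_pos
  have h1 : (0 : ℝ) < (4 * Real.pi * β) ^ ((d : ℝ) / 2) := by positivity
  refine mul_le_of_le_one_right (by positivity) ?_
  have h2 : (1 : ℝ) ≤ (k : ℝ) ^ ((d : ℝ) / 2) :=
    Real.one_le_rpow (one_le_pnat_cast k) (by positivity)
  rw [div_le_one (by linarith)]
  exact h2

/-- The weights `k q_k` are bounded in every dimension but not summable for `d ≤ 2`; strict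
negativity of `s` supplies a geometric factor. -/
lemma summable_density_term (d : ℕ) {β s : ℝ} (hβ : 0 < β) (hs : s < 0) :
    Summable fun k : ℕ+ => (k : ℝ) * cycleWeight d β k * Real.exp (β * s * k) := by
  have hgeo : Summable fun k : ℕ+ => Real.exp (β * s) ^ (k : ℕ) := by
    refine (summable_geometric_of_lt_one (Real.exp_pos _).le ?_).comp_injective PNat.coe_injective
    rw [Real.exp_lt_one_iff]
    exact mul_neg_of_pos_of_neg hβ hs
  refine (hgeo.mul_left (1 / (4 * Real.pi * β) ^ ((d : ℝ) / 2))).of_nonneg_of_le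
    (fun k => ?_) fun k => ?_
  · exact mul_nonneg (mul_nonneg (by positivity) (cycleWeight_pos d hβ k).le) (Real.exp_pos _).le
  · rw [← Real.exp_nat_mul, mul_comm (k : ℝ) (β * s)]
    exact mul_le_mul_of_nonneg_right (mul_cycleWeight_le d hβ k) (Real.exp_pos _).le

lemma idealPressure_nonneg (d : ℕ) {β : ℝ} (hβ : 0 < β) (s : ℝ) : 0 ≤ idealPressure d β s :=
  mul_nonneg (by positivity) (tsum_nonneg fun k =>
    mul_nonneg (cycleWeight_pos d hβ k).le (Real.exp_pos _).le)

lemma continuousOn_idealPressure {d : ℕ} (hd : 1 ≤ d) {β : ℝ} (hβ : 0 < β) :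
    ContinuousOn (idealPressure d β) (Iic 0) := by
  unfold idealPressure totalWeight
  refine continuousOn_const.mul ?_
  refine continuousOn_tsum (u := cycleWeight d β) (fun k => by fun_prop)
    (summable_cycleWeight hd β) fun k s hs => ?_
  rw [Real.norm_of_nonneg (mul_nonneg (cycleWeight_pos d hβ k).le (Real.exp_pos _).le)]
  exact mul_le_of_le_one_right (cycleWeight_pos d hβ k).le (exp_le_one_of_nonpos hβ hs k)

lemma hasDerivAt_idealPressure {d : ℕ} (hd : 1 ≤ d) {β : ℝ} (hβ : 0 < β) {s : ℝ} (hs : s < 0) :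
    HasDerivAt (idealPressure d β) (idealDensity d β s) s := by
  have h2 : s / 2 < 0 := by linarith
  have key : HasDerivAt (fun z => ∑' k : ℕ+, cycleWeight d β k * Real.exp (β * z * k))
      (∑' k : ℕ+, β * ((k : ℝ) * cycleWeight d β k * Real.exp (β * s * k))) s := by
    -- On `Iio (s / 2)` the differentiated series is dominated by its values at `s / 2 < 0`.
    refine hasDerivAt_tsum_of_isPreconnected (t := Iio (s / 2)) (y₀ := s)
      (g' := fun (k : ℕ+) z => β * ((k : ℝ) * cycleWeight d β k * Real.exp (β * z * k)))
      (u := fun k : ℕ+ => β * ((k : ℝ) * cycleWeight d β k * Real.exp (β * (s / 2) * k)))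
      ((summable_density_term d hβ h2).mul_left β) isOpen_Iio isPreconnected_Iio
      (fun k y _ => ?_) (fun k y hy => ?_) (by simp; linarith)
      (summable_cycleWeight_exp hd hβ hs.le) (by simp; linarith)
    · have h1 : HasDerivAt (fun z : ℝ => β * z * k) (β * k) y := by
        simpa using ((hasDerivAt_id y).const_mul β).mul_const (k : ℝ)
      exact (h1.exp.const_mul (cycleWeight d β k)).congr_deriv (by ring)
    · have hw := cycleWeight_pos d hβ k
      have hk : (0 : ℝ) < k := by exact_mod_cast k.pos
      rw [Real.norm_of_nonneg (by positivity)]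
      have hy' : y ≤ s / 2 := le_of_lt hy
      gcongr
  have := key.const_mul (1 / β)
  rw [tsum_mul_left, ← mul_assoc, one_div_mul_cancel hβ.ne', one_mul] at this
  exact this

lemma deriv_idealPressure {d : ℕ} (hd : 1 ≤ d) {β : ℝ} (hβ : 0 < β) {s : ℝ} (hs : s < 0) :
    deriv (idealPressure d β) s = idealDensity d β s :=
  (hasDerivAt_idealPressure hd hβ hs).deriv

lemma idealDensity_pos (d : ℕ) {β : ℝ} (hβ : 0 < β) {s : ℝ} (hs : s < 0) :
    0 < idealDensity d β s := by
  refine (summable_density_term d hβ hs).tsum_pos (fun k => ?_) 1 ?_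
  · have hw := cycleWeight_pos d hβ k
    positivity
  · have hw := cycleWeight_pos d hβ 1
    positivity

lemma strictMonoOn_idealDensity (d : ℕ) {β : ℝ} (hβ : 0 < β) :
    StrictMonoOn (idealDensity d β) (Iio 0) := by
  intro s hs t ht hst
  have hterm : ∀ k : ℕ+, (k : ℝ) * cycleWeight d β k * Real.exp (β * s * k) <
      (k : ℝ) * cycleWeight d β k * Real.exp (β * t * k) := fun k => by
    have hw := cycleWeight_pos d hβ k
    have hk : (0 : ℝ) < k := by exact_mod_cast k.pos
    gcongr
  exact Summable.tsum_lt_tsum (i := 1) (fun k => (hterm k).le) (hterm 1)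
    (summable_density_term d hβ hs) (summable_density_term d hβ ht)

/-- Convexity of `p₀'` itself, inherited termwise from `exp`. It limits the stationary points to
two, and it also yields continuity of the density. -/
lemma strictConvexOn_idealDensity (d : ℕ) {β : ℝ} (hβ : 0 < β) :
    StrictConvexOn ℝ (Iio 0) (idealDensity d β) := by
  refine ⟨convex_Iio 0, fun s hs t ht hst u v hu hv huv => ?_⟩
  have hmem : u • s + v • t ∈ Iio (0 : ℝ) := (convex_Iio 0) hs ht hu.le hv.le huv
  simp only [smul_eq_mul] at hmem ⊢
  have hterm : ∀ k : ℕ+, (k : ℝ) * cycleWeight d β k * Real.exp (β * (u * s + v * t) * k) <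
      u * ((k : ℝ) * cycleWeight d β k * Real.exp (β * s * k)) +
        v * ((k : ℝ) * cycleWeight d β k * Real.exp (β * t * k)) := fun k => by
    have hw := cycleWeight_pos d hβ k
    have hk : (0 : ℝ) < k := by exact_mod_cast k.pos
    have hne : β * s * k ≠ β * t * k := by
      intro h
      exact hst (mul_left_cancel₀ hβ.ne' (mul_right_cancel₀ hk.ne' h))
    have := strictConvexOn_exp.2 (mem_univ (β * s * k)) (mem_univ (β * t * k)) hne hu hv huv
    simp only [smul_eq_mul] at this
    rw [show β * (u * s + v * t) * k = u * (β * s * k) + v * (β * t * k) by ring]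
    have h3 := mul_lt_mul_of_pos_left this (mul_pos hk hw)
    calc _ < _ := h3
      _ = _ := by ring
  have hS := (summable_density_term d hβ hs).mul_left u
  have hT := (summable_density_term d hβ ht).mul_left v
  have := Summable.tsum_lt_tsum (i := 1) (fun k => (hterm k).le) (hterm 1)
    (summable_density_term d hβ hmem) (hS.add hT)
  rw [hS.tsum_add hT, tsum_mul_left, tsum_mul_left] at this
  exact this

lemma continuousOn_idealDensity (d : ℕ) {β : ℝ} (hβ : 0 < β) :
    ContinuousOn (idealDensity d β) (Iio 0) :=
  (strictConvexOn_idealDensity d hβ).convexOn.continuousOn isOpen_Iio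

lemma continuousAt_idealDensity (d : ℕ) {β : ℝ} (hβ : 0 < β) {s : ℝ} (hs : s < 0) :
    ContinuousAt (idealDensity d β) s :=
  (continuousOn_idealDensity d hβ).continuousAt (Iio_mem_nhds hs)

/-- The density decays exponentially as `s → -∞`. -/
lemma idealDensity_sub_le (d : ℕ) {β : ℝ} (hβ : 0 < β) {s t : ℝ} (hs : s < 0) (ht : t ≤ 0) :
    idealDensity d β (s + t) ≤ Real.exp (β * t) * idealDensity d β s := by
  unfold idealDensity
  rw [← tsum_mul_left]
  refine (summable_density_term d hβ (by linarith)).tsum_le_tsum (fun k => ?_)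
    ((summable_density_term d hβ hs).mul_left _)
  have hw := cycleWeight_pos d hβ k
  have hk := one_le_pnat_cast k
  rw [show β * (s + t) * k = β * t * k + β * s * k by ring, Real.exp_add]
  have : Real.exp (β * t * k) ≤ Real.exp (β * t) := by
    rw [Real.exp_le_exp]
    have : β * t ≤ 0 := mul_nonpos_of_nonneg_of_nonpos hβ.le ht
    nlinarith
  calc _ = Real.exp (β * t * k) * ((k : ℝ) * cycleWeight d β k * Real.exp (β * s * k)) := by ring
    _ ≤ _ := mul_le_mul_of_nonneg_right this (by positivity)

lemma exists_idealDensity_lt (d : ℕ) {β : ℝ} (hβ : 0 < β) {x : ℝ} (hx : 0 < x) :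
    ∃ s < 0, idealDensity d β s < x := by
  have h0 : Tendsto (fun t : ℝ => Real.exp (β * t) * idealDensity d β (-1)) atBot (𝓝 0) := by
    have : Tendsto (fun t : ℝ => Real.exp (β * t)) atBot (𝓝 0) :=
      Real.tendsto_exp_atBot.comp (tendsto_id.const_mul_atBot hβ)
    simpa using this.mul_const (idealDensity d β (-1))
  obtain ⟨t, ht, ht'⟩ := ((h0.eventually (gt_mem_nhds hx)).and (eventually_le_atBot 0)).exists
  refine ⟨-1 + t, by linarith, (idealDensity_sub_le d hβ (by norm_num) ht').trans_lt ht⟩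

lemma exists_idealDensity_eq (d : ℕ) {β : ℝ} (hβ : 0 < β) {x s : ℝ} (hx : 0 < x) (hs : s < 0)
    (h : x ≤ idealDensity d β s) : ∃ t < 0, idealDensity d β t = x := by
  obtain ⟨r, hr, hrx⟩ := exists_idealDensity_lt d hβ hx
  obtain ⟨t, ht, hte⟩ := isPreconnected_Iio.intermediate_value (a := r) (b := s) hr hs
    (continuousOn_idealDensity d hβ) ⟨hrx.le, h⟩
  exact ⟨t, ht, hte⟩

lemma sum_mul_cycleWeight_le (d : ℕ) {β : ℝ} (hβ : 0 < β) {x : ℝ}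
    (h : ∀ s < 0, idealDensity d β s ≤ x) (J : Finset ℕ+) :
    ∑ k ∈ J, (k : ℝ) * cycleWeight d β k ≤ x := by
  have hcont : Tendsto (fun s : ℝ => ∑ k ∈ J, (k : ℝ) * cycleWeight d β k *
      Real.exp (β * s * k)) (𝓝[<] 0) (𝓝 (∑ k ∈ J, (k : ℝ) * cycleWeight d β k)) := by
    have : Continuous (fun s : ℝ => ∑ k ∈ J, (k : ℝ) * cycleWeight d β k *
      Real.exp (β * s * k)) := by fun_prop
    have h0 := (this.tendsto 0).mono_left (nhdsWithin_le_nhds (s := Iio 0))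
    simpa using h0
  refine le_of_tendsto hcont ?_
  filter_upwards [self_mem_nhdsWithin] with s hs
  refine le_trans ?_ (h s hs)
  refine (summable_density_term d hβ hs).sum_le_tsum J fun k _ => ?_
  have hw := cycleWeight_pos d hβ k
  positivity

/-- Replaces the case distinction in `d` by a bound on `p₀'`. If `p₀'` is bounded, letting `s ↑ 0`
in partial sums makes `∑ k q_k` converge, which forces `d/2 > 1`. -/
lemma criticalDensity_le_iff (d : ℕ) {β : ℝ} (hβ : 0 < β) (x : ℝ) :
    criticalDensity d β ≤ (x : EReal) ↔ ∀ s < 0, idealDensity d β s ≤ x := by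
  have hsum : ∀ (h3 : 3 ≤ d), Summable fun k : ℕ+ => 1 / (k : ℝ) ^ ((d : ℝ) / 2) := fun h3 => by
    have : Summable fun k : ℕ => 1 / (k : ℝ) ^ ((d : ℝ) / 2) := by
      rw [Real.summable_one_div_nat_rpow]
      have : (3 : ℝ) ≤ d := by exact_mod_cast h3
      linarith
    exact this.comp_injective PNat.coe_injective
  have hc : (0 : ℝ) < (4 * Real.pi * β) ^ ((d : ℝ) / 2) := by
    have := Real.pi_pos
    positivity
  constructor
  · intro h s hs
    unfold criticalDensity at h
    split_ifs at h with h3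
    · rw [EReal.coe_le_coe_iff] at h
      refine le_trans ?_ h
      unfold idealDensity
      rw [← tsum_mul_left]
      refine (summable_density_term d hβ hs).tsum_le_tsum (fun k => ?_) ((hsum h3).mul_left _)
      rw [← mul_cycleWeight d hβ]
      have hw := cycleWeight_pos d hβ k
      exact mul_le_of_le_one_right (by positivity) (exp_le_one_of_nonpos hβ hs.le k)
    · simp at h
  · intro h
    have hfin := sum_mul_cycleWeight_le d hβ h
    have hs : Summable fun k : ℕ+ => (k : ℝ) * cycleWeight d β k :=
      summable_of_sum_le (fun k => by have hw := cycleWeight_pos d hβ k; positivity) hfin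
    simp_rw [mul_cycleWeight d hβ] at hs hfin
    have h3 : 3 ≤ d := by
      have h1 : Summable fun k : ℕ+ => 1 / ((k : ℕ) : ℝ) ^ ((d : ℝ) / 2) :=
        (summable_mul_left_iff (one_div_pos.2 hc).ne').1 hs
      have h2 := (summable_pnat_iff_summable_nat
        (f := fun k : ℕ => 1 / (k : ℝ) ^ ((d : ℝ) / 2))).1 h1
      rw [Real.summable_one_div_nat_rpow] at h2
      have : (2 : ℝ) < d := by linarith
      exact_mod_cast this
    unfold criticalDensity
    rw [if_pos h3, EReal.coe_le_coe_iff, ← tsum_mul_left]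
    exact hs.tsum_le_of_sum_le hfin

/-! ### The free energy and the subcritical pressure -/

/-- The mean value theorem and monotonicity of `p₀'`. At the endpoint `σ = 0` every `x ≥ ϱ_c` is a
subgradient, which covers the condensed regime. -/
lemma idealPressure_tangent {d : ℕ} (hd : 1 ≤ d) {β : ℝ} (hβ : 0 < β) {σ x : ℝ} (hσ : σ ≤ 0)
    (h1 : σ < 0 → idealDensity d β σ = x) (h2 : σ = 0 → ∀ s < 0, idealDensity d β s ≤ x)
    {s : ℝ} (hs : s ≤ 0) : idealPressure d β σ + x * (s - σ) ≤ idealPressure d β s := by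
  have hmvt : ∀ u v : ℝ, u < v → v ≤ 0 → ∃ ξ ∈ Ioo u v,
      idealDensity d β ξ = (idealPressure d β v - idealPressure d β u) / (v - u) :=
    fun u v huv hv => exists_hasDerivAt_eq_slope _ _ huv
      ((continuousOn_idealPressure hd hβ).mono fun z hz => hz.2.trans hv)
      fun z hz => hasDerivAt_idealPressure hd hβ (hz.2.trans_le hv)
  rcases lt_trichotomy s σ with h | h | h
  · obtain ⟨ξ, hξ, he⟩ := hmvt s σ h hσ
    have hle : idealDensity d β ξ ≤ x := by
      rcases hσ.lt_or_eq with h0 | h0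
      · rw [← h1 h0]
        exact (strictMonoOn_idealDensity d hβ).monotoneOn (hξ.2.trans h0) h0 hξ.2.le
      · exact h2 h0 ξ (hξ.2.trans_le hσ)
    rw [he, div_le_iff₀ (by linarith)] at hle
    linarith
  · subst h
    simp
  · obtain ⟨ξ, hξ, he⟩ := hmvt σ s h hs
    have h0 : σ < 0 := h.trans_le hs
    have hle : x ≤ idealDensity d β ξ := by
      rw [← h1 h0]
      exact (strictMonoOn_idealDensity d hβ).monotoneOn h0 (hξ.2.trans_le hs) hξ.1.le
    rw [he, le_div_iff₀ (by linarith)] at hle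
    linarith

lemma le_freeEnergy {d : ℕ} {β : ℝ} (hβ : 0 < β) {x s : ℝ} (hx : 0 ≤ x) (hs : s ≤ 0) :
    s * x - idealPressure d β s ≤ freeEnergy d β x := by
  refine le_csSup ⟨0, ?_⟩ ⟨s, hs, rfl⟩
  rintro _ ⟨t, ht, rfl⟩
  have := idealPressure_nonneg d hβ t
  have := mul_nonpos_of_nonpos_of_nonneg (show t ≤ 0 from ht) hx
  simp only
  linarith

lemma freeEnergy_eq {d : ℕ} (hd : 1 ≤ d) {β : ℝ} (hβ : 0 < β) {σ x : ℝ} (hx : 0 ≤ x) (hσ : σ ≤ 0)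
    (h1 : σ < 0 → idealDensity d β σ = x) (h2 : σ = 0 → ∀ s < 0, idealDensity d β s ≤ x) :
    freeEnergy d β x = σ * x - idealPressure d β σ := by
  refine le_antisymm (csSup_le ⟨_, 0, mem_Iic.2 le_rfl, rfl⟩ ?_) (le_freeEnergy hβ hx hσ)
  rintro _ ⟨s, hs, rfl⟩
  have := idealPressure_tangent hd hβ hσ h1 h2 (s := s) hs
  simp only
  linarith

/-! ### The minimiser in the subcritical pressure -/

/-- `σ ≤ 0` is the minimiser of `(ν - s)² / (2a) + p₀(β, s)` over `s ≤ 0`. -/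
structure IsMinimiser (d : ℕ) (β a ν σ : ℝ) : Prop where
  nonpos : σ ≤ 0
  eq_of_neg : σ < 0 → a * idealDensity d β σ + σ = ν
  le_of_eq : σ = 0 → ∀ s < 0, a * idealDensity d β s ≤ ν

section

variable {d : ℕ} {β a : ℝ}

/-- The increasing function `a p₀'(s) + s` either reaches `ν` at some `s < 0`, or stays below `ν`
and the minimiser is the endpoint `0`. -/
lemma exists_isMinimiser (hβ : 0 < β) (ha : 0 < a) (ν : ℝ) : ∃ σ, IsMinimiser d β a ν σ := by
  by_cases h : ∃ s < 0, ν ≤ a * idealDensity d β s + s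
  · obtain ⟨s, hs, hν⟩ := h
    set r := min (-1) (ν - a * idealDensity d β (-1)) with hr
    have hr1 : r ≤ -1 := min_le_left _ _
    have hr0 : r < 0 := by linarith
    have hrν : a * idealDensity d β r + r ≤ ν := by
      have h1 : idealDensity d β r ≤ idealDensity d β (-1) :=
        (strictMonoOn_idealDensity d hβ).monotoneOn hr0 (by norm_num) hr1
      have h2 : r ≤ ν - a * idealDensity d β (-1) := min_le_right _ _
      have := mul_le_mul_of_nonneg_left h1 ha.le
      linarith
    have hc : ContinuousOn (fun s => a * idealDensity d β s + s) (Iio 0) :=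
      (continuousOn_const.mul (continuousOn_idealDensity d hβ)).add continuousOn_id
    obtain ⟨σ, hσ, he⟩ := isPreconnected_Iio.intermediate_value (a := r) (b := s) hr0 hs hc ⟨hrν, hν⟩
    exact ⟨σ, le_of_lt hσ, fun _ => he, fun h0 => absurd h0 (ne_of_lt hσ)⟩
  · push Not at h
    refine ⟨0, le_rfl, fun h0 => absurd h0 (lt_irrefl _), fun _ s hs => ?_⟩
    refine le_of_forall_pos_le_add fun ε hε => ?_
    -- Moving `s` up to `-ε` does not lower the density, and there the linear term costs at most
    -- `ε`.
    have h0 : max s (-ε) < 0 := max_lt hs (by linarith)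
    have h1 : idealDensity d β s ≤ idealDensity d β (max s (-ε)) :=
      (strictMonoOn_idealDensity d hβ).monotoneOn hs h0 (le_max_left _ _)
    have h2 := h _ h0
    have h3 := le_max_right s (-ε)
    have := mul_le_mul_of_nonneg_left h1 ha.le
    linarith

namespace IsMinimiser

variable {ν σ : ℝ}

lemma density_nonneg (hβ : 0 < β) (ha : 0 < a) (h : IsMinimiser d β a ν σ) :
    0 ≤ (ν - σ) / a := by
  rcases h.nonpos.lt_or_eq with h0 | h0
  · have := h.eq_of_neg h0
    have h2 := idealDensity_pos d hβ h0
    have : ν - σ = a * idealDensity d β σ := by linarith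
    rw [this]
    positivity
  · have h1 := h.le_of_eq h0 (-1) (by norm_num)
    have h2 := idealDensity_pos d hβ (show (-1 : ℝ) < 0 by norm_num)
    have : 0 ≤ ν := le_trans (by positivity) h1
    rw [h0]
    simp only [sub_zero]
    positivity

lemma eq_density (ha : 0 < a) (h : IsMinimiser d β a ν σ) (h0 : σ < 0) :
    idealDensity d β σ = (ν - σ) / a := by
  have := h.eq_of_neg h0
  field_simp
  linarith

lemma le_density (ha : 0 < a) (h : IsMinimiser d β a ν σ) (h0 : σ = 0) (s : ℝ) (hs : s < 0) :
    idealDensity d β s ≤ (ν - σ) / a := by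
  have := h.le_of_eq h0 s hs
  rw [le_div_iff₀ ha, h0]
  linarith

/-- The tangent at `σ` cancels the linear part of the square and leaves `(s - σ)² / (2a)`. -/
lemma le_value (hd : 1 ≤ d) (hβ : 0 < β) (ha : 0 < a) (h : IsMinimiser d β a ν σ) {s : ℝ}
    (hs : s ≤ 0) : (ν - σ) ^ 2 / (2 * a) + idealPressure d β σ ≤
      (ν - s) ^ 2 / (2 * a) + idealPressure d β s := by
  have h1 := idealPressure_tangent hd hβ h.nonpos (h.eq_density ha) (h.le_density ha) hs
  have h2 : (ν - s) ^ 2 / (2 * a) - (ν - σ) ^ 2 / (2 * a) + (ν - σ) / a * (s - σ) =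
      (s - σ) ^ 2 / (2 * a) := by
    field_simp
    ring
  have h3 : 0 ≤ (s - σ) ^ 2 / (2 * a) := by positivity
  linarith

lemma pSub_eq (hd : 1 ≤ d) (hβ : 0 < β) (ha : 0 < a) (h : IsMinimiser d β a ν σ) :
    pSub d β a ν = (ν - σ) ^ 2 / (2 * a) + idealPressure d β σ := by
  unfold pSub
  have hbdd : (ν - σ) ^ 2 / (2 * a) + idealPressure d β σ ∈
      lowerBounds ((fun s : ℝ => (ν - s) ^ 2 / (2 * a) + idealPressure d β s) '' Iio 0) := by
    rintro _ ⟨s, hs, rfl⟩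
    exact h.le_value hd hβ ha (le_of_lt hs)
  refine le_antisymm ?_ (le_csInf ⟨_, -1, by simp, rfl⟩ hbdd)
  rcases h.nonpos.lt_or_eq with h0 | h0
  · exact csInf_le ⟨_, hbdd⟩ ⟨σ, h0, rfl⟩
  -- The infimum runs over `s < 0` only, so the value at `σ = 0` is recovered by continuity from the
  -- left.
  · have hc : ContinuousWithinAt (fun s : ℝ => (ν - s) ^ 2 / (2 * a) + idealPressure d β s)
        (Iic 0) σ :=
      ContinuousWithinAt.add (by fun_prop) (continuousOn_idealPressure hd hβ σ h.nonpos)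
    have ht := hc.tendsto.mono_left (nhdsWithin_mono σ (Iio_subset_Iic_self (a := (0 : ℝ))))
    rw [h0] at ht ⊢
    refine ge_of_tendsto ht ?_
    filter_upwards [self_mem_nhdsWithin] with s hs
    exact csInf_le ⟨_, hbdd⟩ ⟨s, hs, rfl⟩

lemma mono (hβ : 0 < β) (ha : 0 < a) {ν' σ' : ℝ} (h : IsMinimiser d β a ν σ)
    (h' : IsMinimiser d β a ν' σ') (hν : ν ≤ ν') : σ ≤ σ' := by
  by_contra! hlt
  have h0' : σ' < 0 := hlt.trans_le h.nonpos
  have e' := h'.eq_of_neg h0'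
  rcases h.nonpos.lt_or_eq with h0 | h0
  · have e := h.eq_of_neg h0
    have := mul_lt_mul_of_pos_left (strictMonoOn_idealDensity d hβ h0' h0 hlt) ha
    linarith
  · have e := h.le_of_eq h0 σ' h0'
    linarith

lemma lt_of_lt (hβ : 0 < β) (ha : 0 < a) {ν' σ' : ℝ} (h : IsMinimiser d β a ν σ)
    (h' : IsMinimiser d β a ν' σ') (hν : ν < ν') (h0 : σ < 0) : σ < σ' := by
  refine (h.mono hβ ha h' hν.le).lt_of_ne fun he => ?_
  have e := h.eq_of_neg h0
  have e' := h'.eq_of_neg (he ▸ h0)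
  rw [← he] at e'
  linarith

lemma unique (hβ : 0 < β) (ha : 0 < a) {σ' : ℝ} (h : IsMinimiser d β a ν σ)
    (h' : IsMinimiser d β a ν σ') : σ = σ' :=
  le_antisymm (h.mono hβ ha h' le_rfl) (h'.mono hβ ha h le_rfl)

end IsMinimiser

lemma pSub_le (hd : 1 ≤ d) (hβ : 0 < β) (ha : 0 < a) (ν : ℝ) {s : ℝ} (hs : s ≤ 0) :
    pSub d β a ν ≤ (ν - s) ^ 2 / (2 * a) + idealPressure d β s := by
  obtain ⟨σ, h⟩ := exists_isMinimiser (d := d) hβ ha ν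
  rw [h.pSub_eq hd hβ ha]
  exact h.le_value hd hβ ha hs

/-- The minimiser defining the subcritical pressure. -/
noncomputable def minimiser (d : ℕ) (β a ν : ℝ) : ℝ :=
  open Classical in if h : ∃ σ, IsMinimiser d β a ν σ then h.choose else 0

lemma isMinimiser_minimiser (hβ : 0 < β) (ha : 0 < a) (ν : ℝ) :
    IsMinimiser d β a ν (minimiser d β a ν) := by
  have h := exists_isMinimiser (d := d) hβ ha ν
  unfold minimiser
  rw [dif_pos h]
  exact h.choose_spec

/-! ### The reduced functional -/

/-- The supremum over `x` of the pressure functional at fixed density `y` of long cycles. -/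
noncomputable def reducedFunctional (d : ℕ) (β a b μ y : ℝ) : ℝ :=
  pSub d β a (μ - a * y) + μ * y - (a - b) / 2 * y ^ 2

lemma reducedFunctional_zero (b μ : ℝ) : reducedFunctional d β a b μ 0 = pSub d β a μ := by
  simp [reducedFunctional]

/-- The optimal density of short cycles at effective chemical potential `ν`. -/
noncomputable def optimalDensity (d : ℕ) (β a ν : ℝ) : ℝ := (ν - minimiser d β a ν) / a

lemma optimalDensity_nonneg (hβ : 0 < β) (ha : 0 < a) (ν : ℝ) : 0 ≤ optimalDensity d β a ν :=
  (isMinimiser_minimiser hβ ha ν).density_nonneg hβ ha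

/-- Fenchel's inequality with slope `σ`, then completion of the square. The square that remains
makes the optimal `x` unique. -/
lemma pressureFunctional_le (hd : 1 ≤ d) (hβ : 0 < β) (ha : 0 < a) (b μ : ℝ) {x : ℝ} (y : ℝ)
    (hx : 0 ≤ x) : pressureFunctional d β μ a b (x, y) ≤
      reducedFunctional d β a b μ y - a / 2 * (x - optimalDensity d β a (μ - a * y)) ^ 2 := by
  have h := isMinimiser_minimiser (d := d) hβ ha (μ - a * y)
  have h1 := le_freeEnergy (d := d) hβ hx h.nonpos
  unfold reducedFunctional pressureFunctional optimalDensity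
  rw [h.pSub_eq hd hβ ha]
  simp only
  set σ := minimiser d β a (μ - a * y)
  have : μ * (x + y) - a / 2 * (x + y) ^ 2 + b / 2 * y ^ 2 - (σ * x - idealPressure d β σ) =
    (μ - a * y - σ) ^ 2 / (2 * a) + idealPressure d β σ + μ * y - (a - b) / 2 * y ^ 2 -
      a / 2 * (x - (μ - a * y - σ) / a) ^ 2 := by
    field_simp
    ring
  linarith

lemma pressureFunctional_optimalDensity (hd : 1 ≤ d) (hβ : 0 < β) (ha : 0 < a) (b μ y : ℝ) :
    pressureFunctional d β μ a b (optimalDensity d β a (μ - a * y), y) =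
      reducedFunctional d β a b μ y := by
  have h := isMinimiser_minimiser (d := d) hβ ha (μ - a * y)
  unfold reducedFunctional pressureFunctional optimalDensity
  rw [h.pSub_eq hd hβ ha]
  simp only
  rw [freeEnergy_eq hd hβ (h.density_nonneg hβ ha) h.nonpos (h.eq_density ha) (h.le_density ha)]
  set σ := minimiser d β a (μ - a * y)
  field_simp
  ring

/-! ### Suprema of the reduced functional over sets of long-cycle densities -/

/-- `p_sub` is a maximum over `x ≥ 0` of functions affine in `ν`; evaluate them at the maximiser for
the convex combination. Convexity is wanted for continuity. -/
lemma convexOn_pSub (hd : 1 ≤ d) (hβ : 0 < β) (ha : 0 < a) : ConvexOn ℝ univ (pSub d β a) := by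
  refine ⟨convex_univ, fun ν _ ν' _ u v hu hv huv => ?_⟩
  set z := optimalDensity d β a (u * ν + v * ν') with hz
  have hz0 : 0 ≤ z := optimalDensity_nonneg hβ ha _
  have key : ∀ ρ : ℝ, ρ * z - a / 2 * z ^ 2 - freeEnergy d β z ≤ pSub d β a ρ := fun ρ => by
    have := pressureFunctional_le (d := d) hd hβ ha 0 ρ 0 hz0
    rw [reducedFunctional_zero] at this
    have h2 : 0 ≤ a / 2 * (z - optimalDensity d β a (ρ - a * 0)) ^ 2 := by positivity
    simp only [pressureFunctional] at this
    linarith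
  have heq := pressureFunctional_optimalDensity (d := d) hd hβ ha 0 (u * ν + v * ν') 0
  rw [reducedFunctional_zero, mul_zero, sub_zero, ← hz] at heq
  simp only [pressureFunctional] at heq
  simp only [smul_eq_mul]
  rw [← heq]
  have h1 := mul_le_mul_of_nonneg_left (key ν) hu
  have h2 := mul_le_mul_of_nonneg_left (key ν') hv
  have hv' : v = 1 - u := by linarith
  subst hv'
  linarith

lemma continuous_pSub (hd : 1 ≤ d) (hβ : 0 < β) (ha : 0 < a) : Continuous (pSub d β a) :=
  continuousOn_univ.1 ((convexOn_pSub hd hβ ha).continuousOn isOpen_univ)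

lemma continuous_reducedFunctional (hd : 1 ≤ d) (hβ : 0 < β) (ha : 0 < a) (b μ : ℝ) :
    Continuous (reducedFunctional d β a b μ) := by
  have := continuous_pSub (d := d) hd hβ ha
  unfold reducedFunctional
  fun_prop

lemma continuous_reducedFunctional_potential (hd : 1 ≤ d) (hβ : 0 < β) (ha : 0 < a) (b y : ℝ) :
    Continuous fun μ => reducedFunctional d β a b μ y := by
  have := continuous_pSub (d := d) hd hβ ha
  unfold reducedFunctional
  fun_prop

lemma tendsto_reducedFunctional (hd : 1 ≤ d) (hβ : 0 < β) (ha : 0 < a) {b : ℝ} (hab : b < a)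
    (μ : ℝ) : Tendsto (reducedFunctional d β a b μ) atTop atBot := by
  have hbound : ∀ᶠ y in atTop, reducedFunctional d β a b μ y ≤
      idealPressure d β 0 + y * (μ - (a - b) / 2 * y) := by
    filter_upwards [eventually_ge_atTop (μ / a)] with y hy
    rw [div_le_iff₀ ha] at hy
    have hν : μ - a * y ≤ 0 := by linarith
    -- The test point `s = μ - a y ≤ 0` kills the square in `p_sub`, leaving a downward parabola in
    -- `y`.
    have h1 := pSub_le hd hβ ha (μ - a * y) hν
    have h3 : idealPressure d β (μ - a * y) ≤ idealPressure d β 0 := by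
      unfold idealPressure totalWeight
      refine mul_le_mul_of_nonneg_left ?_ (by positivity)
      refine (summable_cycleWeight_exp hd hβ hν).tsum_le_tsum (fun k => ?_)
        (summable_cycleWeight_exp hd hβ le_rfl)
      simp only [mul_zero, zero_mul, Real.exp_zero]
      exact mul_le_mul_of_nonneg_left (exp_le_one_of_nonpos hβ hν k) (cycleWeight_pos d hβ k).le
    simp only [sub_self, ne_eq, OfNat.ofNat_ne_zero, not_false_eq_true, zero_pow, zero_div,
      zero_add] at h1
    unfold reducedFunctional
    nlinarith
  refine tendsto_atBot_mono' _ hbound ?_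
  refine tendsto_atBot_add_const_left _ _ (tendsto_id.atTop_mul_atBot₀ ?_)
  have : Tendsto (fun y : ℝ => (a - b) / 2 * y) atTop atTop :=
    tendsto_id.const_mul_atTop (by linarith)
  exact (tendsto_atBot_add_const_left _ μ (tendsto_neg_atTop_atBot.comp this)).congr
    fun y => by simp [sub_eq_add_neg]

lemma exists_isMaxOn (hd : 1 ≤ d) (hβ : 0 < β) (ha : 0 < a) {b : ℝ} (hab : b < a) {Y : Set ℝ}
    (hc : IsClosed Y) (hne : Y.Nonempty) (h0 : Y ⊆ Ici 0) (μ : ℝ) :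
    ∃ y ∈ Y, IsMaxOn (reducedFunctional d β a b μ) Y y := by
  obtain ⟨y₀, hy₀⟩ := hne
  have hcont := continuous_reducedFunctional (d := d) hd hβ ha b μ
  refine hcont.continuousOn.exists_isMaxOn' hc hy₀ ?_
  obtain ⟨R, hR⟩ := eventually_atTop.1 (tendsto_atBot.1
    (tendsto_reducedFunctional (d := d) hd hβ ha hab μ) (reducedFunctional d β a b μ y₀))
  rw [eventually_inf_principal]
  have : (Icc 0 R)ᶜ ∈ cocompact ℝ := isCompact_Icc.compl_mem_cocompact
  filter_upwards [this] with y hy hyY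
  refine hR y ?_
  by_contra hlt
  exact hy ⟨h0 hyY, (not_le.1 hlt).le⟩

/-- The supremum of the pressure functional over densities of long cycles in `Y`. -/
noncomputable def maxPressure (d : ℕ) (β a b : ℝ) (Y : Set ℝ) (μ : ℝ) : ℝ :=
  sSup (reducedFunctional d β a b μ '' Y)

lemma maxPressure_eq {b : ℝ} {Y : Set ℝ} {μ y : ℝ} (hy : y ∈ Y)
    (h : IsMaxOn (reducedFunctional d β a b μ) Y y) :
    maxPressure d β a b Y μ = reducedFunctional d β a b μ y :=
  le_antisymm (csSup_le ⟨_, y, hy, rfl⟩ (by rintro _ ⟨z, hz, rfl⟩; exact h hz))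
    (le_csSup ⟨_, by rintro _ ⟨z, hz, rfl⟩; exact h hz⟩ ⟨y, hy, rfl⟩)

/-- The pressure functional is affine in the potential, so its supremum is convex, and a finite
convex function on the line is continuous. -/
lemma continuous_maxPressure (hd : 1 ≤ d) (hβ : 0 < β) (ha : 0 < a) {b : ℝ} (hab : b < a)
    {Y : Set ℝ} (hc : IsClosed Y) (hne : Y.Nonempty) (h0 : Y ⊆ Ici 0) :
    Continuous (maxPressure d β a b Y) := by
  suffices h : ConvexOn ℝ univ (maxPressure d β a b Y) from
    continuousOn_univ.1 (h.continuousOn isOpen_univ)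
  refine ⟨convex_univ, fun ν _ ν' _ u v hu hv huv => ?_⟩
  simp only [smul_eq_mul]
  obtain ⟨y, hy, hmax⟩ := exists_isMaxOn (d := d) hd hβ ha hab hc hne h0 (u * ν + v * ν')
  rw [maxPressure_eq hy hmax, ← pressureFunctional_optimalDensity hd hβ ha]
  set z := optimalDensity d β a (u * ν + v * ν' - a * y)
  have hz0 : 0 ≤ z := optimalDensity_nonneg hβ ha _
  have key : ∀ ρ : ℝ, pressureFunctional d β ρ a b (z, y) ≤ maxPressure d β a b Y ρ := fun ρ => by
    obtain ⟨y', hy', hmax'⟩ := exists_isMaxOn (d := d) hd hβ ha hab hc hne h0 ρ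
    rw [maxPressure_eq hy' hmax']
    have h1 := pressureFunctional_le (d := d) hd hβ ha b ρ y hz0
    have h2 : 0 ≤ a / 2 * (z - optimalDensity d β a (ρ - a * y)) ^ 2 := by positivity
    have h3 : reducedFunctional d β a b ρ y ≤ reducedFunctional d β a b ρ y' := hmax' hy
    linarith
  have h1 := mul_le_mul_of_nonneg_left (key ν) hu
  have h2 := mul_le_mul_of_nonneg_left (key ν') hv
  have hv' : v = 1 - u := by linarith
  subst hv'
  simp only [pressureFunctional] at *
  linarith

/-! ### Zeroes of the rate function as maximisers -/

/-- The admissible densities of long cycles. -/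
def longDensities (κ : ℝ≥0∞) : Set ℝ := {y | 0 ≤ y ∧ (y = 0 ∨ κ ≤ ENNReal.ofReal y)}

lemma mem_zeroes_iff (hd : 1 ≤ d) (hβ : 0 < β) (ha : 0 < a) {b : ℝ} (μ : ℝ) (κ : ℝ≥0∞) {y : ℝ}
    (hy : y ∈ longDensities κ) (hmax : IsMaxOn (reducedFunctional d β a b μ) (longDensities κ) y)
    (z : ℝ × ℝ) : z ∈ zeroes d β μ a b κ ↔ z.2 ∈ longDensities κ ∧
      reducedFunctional d β a b μ z.2 = reducedFunctional d β a b μ y ∧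
      z.1 = optimalDensity d β a (μ - a * z.2) := by
  have hle : ∀ w ∈ admissible κ,
      pressureFunctional d β μ a b w ≤ reducedFunctional d β a b μ w.2 -
        a / 2 * (w.1 - optimalDensity d β a (μ - a * w.2)) ^ 2 ∧
      reducedFunctional d β a b μ w.2 ≤ reducedFunctional d β a b μ y := fun w hw =>
    ⟨pressureFunctional_le hd hβ ha b μ w.2 hw.1, hmax hw.2⟩
  have hsup : sSup (pressureFunctional d β μ a b '' admissible κ) =
      reducedFunctional d β a b μ y := by
    have hub : reducedFunctional d β a b μ y ∈
        upperBounds (pressureFunctional d β μ a b '' admissible κ) := by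
      rintro _ ⟨w, hw, rfl⟩
      have := hle w hw
      have h2 : 0 ≤ a / 2 * (w.1 - optimalDensity d β a (μ - a * w.2)) ^ 2 := by positivity
      linarith
    have hmem : (optimalDensity d β a (μ - a * y), y) ∈ admissible κ :=
      ⟨optimalDensity_nonneg hβ ha _, hy⟩
    refine le_antisymm (csSup_le ⟨_, _, hmem, rfl⟩ hub) ?_
    exact le_csSup ⟨_, hub⟩ ⟨_, hmem, pressureFunctional_optimalDensity hd hβ ha b μ y⟩
  simp only [zeroes, rateFunction, mem_ofPred_eq, hsup]
  constructor
  · intro h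
    split_ifs at h with hz
    swap
    · exact absurd h (by simp)
    have h1 : reducedFunctional d β a b μ y - pressureFunctional d β μ a b z = 0 := by
      exact_mod_cast h
    obtain ⟨h2, h3⟩ := hle z hz
    have h4 : 0 ≤ a / 2 * (z.1 - optimalDensity d β a (μ - a * z.2)) ^ 2 := by positivity
    refine ⟨hz.2, by linarith, ?_⟩
    have h5 : a / 2 * (z.1 - optimalDensity d β a (μ - a * z.2)) ^ 2 = 0 := by linarith
    have h6 : a / 2 ≠ 0 := by positivity
    have h7 := (mul_eq_zero.1 h5).resolve_left h6
    linarith [pow_eq_zero_iff (two_ne_zero) |>.1 h7]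
  · rintro ⟨h1, h2, h3⟩
    have hz : z ∈ admissible κ := ⟨by rw [h3]; exact optimalDensity_nonneg hβ ha _, h1⟩
    rw [if_pos hz]
    have h4 : z = (optimalDensity d β a (μ - a * z.2), z.2) := by rw [← h3]
    rw [h4, pressureFunctional_optimalDensity hd hβ ha, h2]
    simp

/-- A unique maximiser of the reduced functional gives a unique zero of the rate function. -/
lemma zeroes_eq_singleton (hd : 1 ≤ d) (hβ : 0 < β) (ha : 0 < a) {b μ : ℝ} {κ : ℝ≥0∞} {y : ℝ}
    (hy : y ∈ longDensities κ) (hmax : IsMaxOn (reducedFunctional d β a b μ) (longDensities κ) y)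
    (huniq : ∀ y' ∈ longDensities κ,
      reducedFunctional d β a b μ y' = reducedFunctional d β a b μ y → y' = y) :
    zeroes d β μ a b κ = {(optimalDensity d β a (μ - a * y), y)} := by
  ext z
  rw [mem_zeroes_iff hd hβ ha μ κ hy hmax, mem_singleton_iff]
  constructor
  · rintro ⟨h1, h2, h3⟩
    have := huniq _ h1 h2
    ext
    · rw [h3, this]
    · exact this
  · rintro rfl
    exact ⟨hy, rfl, rfl⟩

end

section

variable {d : ℕ} {β a b : ℝ}

/-! ### Stationary points with long cycles -/

/-- `a p₀'(β, s) - ((a-b)/b) s`, which equals `μ` at the stationary points with long cycles. -/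
noncomputable def stationaryPotential (d : ℕ) (β a b s : ℝ) : ℝ :=
  a * idealDensity d β s - (a - b) / b * s

/-- The function whose supremum is the supercritical pressure. -/
noncomputable def superFunctional (d : ℕ) (β a b μ s : ℝ) : ℝ :=
  (μ - s) ^ 2 / (2 * a) - s ^ 2 / (2 * b) + idealPressure d β s

lemma strictConvexOn_stationaryPotential (hβ : 0 < β) (ha : 0 < a) :
    StrictConvexOn ℝ (Iio 0) (stationaryPotential d β a b) := by
  refine ⟨convex_Iio 0, fun s hs t ht hst u v hu hv huv => ?_⟩
  have h := mul_lt_mul_of_pos_left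
    ((strictConvexOn_idealDensity d hβ).2 hs ht hst hu hv huv) ha
  simp only [smul_eq_mul, stationaryPotential] at h ⊢
  linarith

lemma continuousOn_stationaryPotential (hβ : 0 < β) :
    ContinuousOn (stationaryPotential d β a b) (Iio 0) :=
  (continuousOn_const.mul (continuousOn_idealDensity d hβ)).sub
    (continuousOn_const.mul continuousOn_id)

lemma stationaryPotential_lt_of_mem_Ioo (hβ : 0 < β) (ha : 0 < a) {μ s t z : ℝ} (ht : t < 0)
    (hs : stationaryPotential d β a b s ≤ μ) (ht' : stationaryPotential d β a b t ≤ μ)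
    (hz : z ∈ Ioo s t) : stationaryPotential d β a b z < μ := by
  have hst := hz.1.trans hz.2
  have := (strictConvexOn_stationaryPotential (d := d) (b := b) hβ ha).lt_on_openSegment
    (x := s) (y := t) (hst.trans ht) ht hst.ne (by rw [openSegment_eq_Ioo hst]; exact hz)
  exact this.trans_le (max_le hs ht')

lemma hasDerivAt_superFunctional (hd : 1 ≤ d) (hβ : 0 < β) (ha : 0 < a) (hb : 0 < b) (μ : ℝ)
    {s : ℝ} (hs : s < 0) : HasDerivAt (superFunctional d β a b μ)
      ((stationaryPotential d β a b s - μ) / a) s := by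
  have h1 : HasDerivAt (fun s : ℝ => μ - s) (-1) s := by
    simpa using (hasDerivAt_id s).const_sub μ
  have h2 := (h1.pow 2).div_const (2 * a)
  have h3 := (hasDerivAt_pow 2 s).div_const (2 * b)
  refine ((h2.sub h3).add (hasDerivAt_idealPressure hd hβ hs)).congr_deriv ?_
  unfold stationaryPotential
  simp
  field_simp
  ring

/-- Evaluate `G_μ` at `x = p₀'(s)` and at the vertex `y = (μ - a x)/(a-b)` of the parabola `G_μ(x,
·)`; the excess over `superFunctional` is a perfect square. -/
lemma superFunctional_le (hd : 1 ≤ d) (hβ : 0 < β) (hb : 0 < b) (hab : b < a) {μ s : ℝ}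
    (hs : s < 0) : superFunctional d β a b μ s ≤
      reducedFunctional d β a b μ ((μ - a * idealDensity d β s) / (a - b)) := by
  have ha : 0 < a := hb.trans hab
  have hg := idealDensity_pos d hβ hs
  have hab' : 0 < a - b := by linarith
  have h1 := pressureFunctional_le hd hβ ha b μ ((μ - a * idealDensity d β s) / (a - b)) hg.le
  have h2 : 0 ≤ a / 2 * (idealDensity d β s - optimalDensity d β a
      (μ - a * ((μ - a * idealDensity d β s) / (a - b)))) ^ 2 := by positivity
  have hf := freeEnergy_eq (d := d) hd hβ hg.le hs.le (fun _ => rfl)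
    (fun h => absurd h hs.ne)
  simp only [pressureFunctional] at h1
  rw [hf] at h1
  set x := idealDensity d β s
  have h3 : μ * (x + (μ - a * x) / (a - b)) - a / 2 * (x + (μ - a * x) / (a - b)) ^ 2 +
      b / 2 * ((μ - a * x) / (a - b)) ^ 2 - (s * x - idealPressure d β s) -
      superFunctional d β a b μ s = (b * (μ - a * x) + (a - b) * s) ^ 2 / (2 * a * b * (a - b)) := by
    unfold superFunctional
    field_simp
    ring
  have h4 : 0 ≤ (b * (μ - a * x) + (a - b) * s) ^ 2 / (2 * a * b * (a - b)) := by positivity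
  linarith

/-- A maximiser of the reduced functional on `[κ, ∞)` which is not `κ` is stationary. -/
lemma isMinimiser_of_isMaxOn (hd : 1 ≤ d) (hβ : 0 < β) (hb : 0 < b) (hab : b < a) {μ κ y : ℝ}
    (hy : κ < y) (hmax : IsMaxOn (reducedFunctional d β a b μ) (Ici κ) y) :
    IsMinimiser d β a (μ - a * y) (-(b * y)) := by
  have ha : 0 < a := hb.trans hab
  have hab' : 0 < a - b := by linarith
  have hmin := isMinimiser_minimiser (d := d) hβ ha (μ - a * y)
  set x := optimalDensity d β a (μ - a * y) with hx
  have hx0 : 0 ≤ x := optimalDensity_nonneg hβ ha _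
  -- Freezing `x` at its optimum for `y` avoids differentiating `p_sub`: `T(y') ≥ G(x, y')` with
  -- equality at `y`, so `y` maximises the concave parabola `G(x, ·)` on `[κ, ∞)`. Since `y > κ`, it
  -- is the vertex.
  have key : ∀ y' ≥ κ, (μ - a * x) * (y' - y) - (a - b) / 2 * (y' ^ 2 - y ^ 2) ≤ 0 := by
    intro y' hy'
    have h1 := pressureFunctional_le hd hβ ha b μ y' hx0
    have h2 : 0 ≤ a / 2 * (x - optimalDensity d β a (μ - a * y')) ^ 2 := by positivity
    have h3 : reducedFunctional d β a b μ y' ≤ reducedFunctional d β a b μ y := hmax hy'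
    have h4 := pressureFunctional_optimalDensity hd hβ ha b μ y
    rw [← hx] at h4
    simp only [pressureFunctional] at h1 h4
    nlinarith
  have hu : (a - b) * y = μ - a * x := by
    rcases le_or_gt κ ((μ - a * x) / (a - b)) with h | h
    · have h1 := key _ h
      set w := (μ - a * x) / (a - b) with hw
      have hw' : μ - a * x = (a - b) * w := by rw [hw]; field_simp
      rw [hw'] at h1 ⊢
      have h2 : (a - b) / 2 * (w - y) ^ 2 ≤ 0 := by nlinarith
      have h3 : (w - y) ^ 2 ≤ 0 := by
        by_contra! hlt
        have : 0 < (a - b) / 2 * (w - y) ^ 2 := by positivity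
        linarith
      have h4 : w - y = 0 := (pow_eq_zero_iff two_ne_zero).1 (le_antisymm h3 (sq_nonneg _))
      rw [show w = y by linarith]
    · exfalso
      rw [div_lt_iff₀ hab'] at h
      have h1 := key κ le_rfl
      nlinarith [mul_pos (sub_pos.2 hy) (sub_pos.2 h), mul_pos (sub_pos.2 hy) (sub_pos.2 hy),
        mul_pos (mul_pos (sub_pos.2 hy) (sub_pos.2 hy)) hab']
  have hσ : minimiser d β a (μ - a * y) = -(b * y) := by
    have : a * x = μ - a * y - minimiser d β a (μ - a * y) := by
      rw [hx, optimalDensity]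
      field_simp
    linarith
  rwa [hσ] at hmin

namespace IsMinimiser

variable {μ y : ℝ}

lemma stationaryPotential_eq (hb : 0 < b) (hy : 0 < y)
    (h : IsMinimiser d β a (μ - a * y) (-(b * y))) :
    stationaryPotential d β a b (-(b * y)) = μ := by
  have := h.eq_of_neg (by nlinarith)
  unfold stationaryPotential
  field_simp
  linarith

lemma reducedFunctional_eq (hd : 1 ≤ d) (hβ : 0 < β) (hb : 0 < b) (hab : b < a)
    (h : IsMinimiser d β a (μ - a * y) (-(b * y))) :
    reducedFunctional d β a b μ y = superFunctional d β a b μ (-(b * y)) := by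
  have ha : 0 < a := hb.trans hab
  unfold reducedFunctional superFunctional
  rw [h.pSub_eq hd hβ ha]
  field_simp
  ring

lemma density_lt (hb : 0 < b) (hab : b < a) (hy : 0 < y)
    (h : IsMinimiser d β a (μ - a * y) (-(b * y))) : a * idealDensity d β (-(b * y)) < μ := by
  have := h.eq_of_neg (by nlinarith)
  nlinarith

end IsMinimiser

/-- A positive global maximiser of the reduced functional. -/
structure IsPeak (d : ℕ) (β a b μ y : ℝ) : Prop where
  pos : 0 < y
  isMaxOn : IsMaxOn (reducedFunctional d β a b μ) (Ici 0) y

namespace IsPeak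

variable {μ y : ℝ}

lemma isMinimiser (hd : 1 ≤ d) (hβ : 0 < β) (hb : 0 < b) (hab : b < a)
    (h : IsPeak d β a b μ y) : IsMinimiser d β a (μ - a * y) (-(b * y)) :=
  isMinimiser_of_isMaxOn hd hβ hb hab h.pos h.isMaxOn

lemma neg (hb : 0 < b) (h : IsPeak d β a b μ y) : -(b * y) < 0 := by
  have := mul_pos hb h.pos
  linarith

lemma stationaryPotential_eq (hd : 1 ≤ d) (hβ : 0 < β) (hb : 0 < b) (hab : b < a)
    (h : IsPeak d β a b μ y) : stationaryPotential d β a b (-(b * y)) = μ :=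
  (h.isMinimiser hd hβ hb hab).stationaryPotential_eq hb h.pos

lemma reducedFunctional_eq (hd : 1 ≤ d) (hβ : 0 < β) (hb : 0 < b) (hab : b < a)
    (h : IsPeak d β a b μ y) :
    reducedFunctional d β a b μ y = superFunctional d β a b μ (-(b * y)) :=
  (h.isMinimiser hd hβ hb hab).reducedFunctional_eq hd hβ hb hab

lemma density_lt (hd : 1 ≤ d) (hβ : 0 < β) (hb : 0 < b) (hab : b < a)
    (h : IsPeak d β a b μ y) : a * idealDensity d β (-(b * y)) < μ :=
  (h.isMinimiser hd hβ hb hab).density_lt hb hab h.pos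

lemma superFunctional_le (hd : 1 ≤ d) (hβ : 0 < β) (hb : 0 < b) (hab : b < a)
    (h : IsPeak d β a b μ y) {s : ℝ} (hs : s < 0) (hs' : a * idealDensity d β s ≤ μ) :
    superFunctional d β a b μ s ≤ superFunctional d β a b μ (-(b * y)) := by
  rw [← h.reducedFunctional_eq hd hβ hb hab]
  exact (CycleHYL.superFunctional_le hd hβ hb hab hs).trans
    (h.isMaxOn (mem_Ici.2 (div_nonneg (sub_nonneg.2 hs') (sub_pos.2 hab).le)))

/-- A peak is the smallest solution of the stationarity equation. -/
lemma lt_stationaryPotential (hd : 1 ≤ d) (hβ : 0 < β) (hb : 0 < b) (hab : b < a)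
    (h : IsPeak d β a b μ y) {s : ℝ} (hs : s < -(b * y)) :
    μ < stationaryPotential d β a b s := by
  have ha : 0 < a := hb.trans hab
  by_contra! hle
  have h0 := h.neg hb
  -- The derivative of `superFunctional` is `(φ - μ)/a`. If `φ(s) ≤ μ`, strict convexity makes it
  -- negative up to the peak, so `s` would beat the peak.
  have hanti : StrictAntiOn (superFunctional d β a b μ) (Icc s (-(b * y))) := by
    refine strictAntiOn_of_deriv_neg (convex_Icc _ _) (fun z hz =>
      (hasDerivAt_superFunctional hd hβ ha hb μ
        (hz.2.trans_lt h0)).continuousAt.continuousWithinAt) fun z hz => ?_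
    rw [interior_Icc] at hz
    rw [(hasDerivAt_superFunctional hd hβ ha hb μ (hz.2.trans h0)).deriv]
    have := stationaryPotential_lt_of_mem_Ioo (d := d) hβ ha h0 hle
      (h.stationaryPotential_eq hd hβ hb hab).le hz
    exact div_neg_of_neg_of_pos (by linarith) ha
  have h1 := hanti (left_mem_Icc.2 hs.le) (right_mem_Icc.2 hs.le) hs
  have h2 : a * idealDensity d β s ≤ μ := by
    refine le_trans ?_ (h.density_lt hd hβ hb hab).le
    exact mul_le_mul_of_nonneg_left
      ((strictMonoOn_idealDensity d hβ).monotoneOn (hs.trans h0) h0 hs.le) ha.le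
  exact absurd (h.superFunctional_le hd hβ hb hab (hs.trans h0) h2) (not_le.2 h1)

/-- The level `μ` is not tangent to `φ` at a peak: otherwise `superFunctional` would increase to the
right of `-by`, where the density condition, strict at the peak, still holds nearby. -/
lemma exists_stationaryPotential_lt (hd : 1 ≤ d) (hβ : 0 < β) (hb : 0 < b) (hab : b < a)
    (h : IsPeak d β a b μ y) : ∃ t < 0, stationaryPotential d β a b t < μ := by
  have ha : 0 < a := hb.trans hab
  by_contra! hle
  have h0 := h.neg hb
  set σ := -(b * y) with hσ
  have hφ := h.stationaryPotential_eq hd hβ hb hab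
  rw [← hσ] at hφ
  have hgt : ∀ z, σ < z → z < 0 → μ < stationaryPotential d β a b z := by
    intro z hz hz0
    refine (hle z hz0).lt_of_ne fun he => ?_
    have := stationaryPotential_lt_of_mem_Ioo (d := d) hβ ha hz0 hφ.le he.ge
      (z := (σ + z) / 2) ⟨by linarith, by linarith⟩
    have := hle ((σ + z) / 2) (by linarith)
    linarith
  have hmono : StrictMonoOn (superFunctional d β a b μ) (Icc σ (σ / 2)) := by
    refine strictMonoOn_of_deriv_pos (convex_Icc _ _) (fun z hz =>
      (hasDerivAt_superFunctional hd hβ ha hb μ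
        (show z < 0 by linarith [hz.2])).continuousAt.continuousWithinAt) fun z hz => ?_
    rw [interior_Icc] at hz
    have hz0 : z < 0 := by linarith [hz.2]
    rw [(hasDerivAt_superFunctional hd hβ ha hb μ hz0).deriv]
    exact div_pos (by linarith [hgt z hz.1 hz0]) ha
  have hcont : ContinuousAt (fun s => a * idealDensity d β s) σ :=
    continuousAt_const.mul (continuousAt_idealDensity d hβ h0)
  have hlt := h.density_lt hd hβ hb hab
  rw [← hσ] at hlt
  have h1 : ∀ᶠ s in 𝓝[>] σ, a * idealDensity d β s < μ :=
    (hcont.tendsto.eventually (gt_mem_nhds hlt)).filter_mono nhdsWithin_le_nhds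
  have h2 : ∀ᶠ s in 𝓝[>] σ, s ∈ Ioo σ (σ / 2) := Ioo_mem_nhdsGT (by linarith)
  obtain ⟨s, hs1, hs2⟩ := (h1.and h2).exists
  have h3 := hmono (left_mem_Icc.2 (by linarith)) ⟨hs2.1.le, hs2.2.le⟩ hs2.1
  exact absurd (h.superFunctional_le hd hβ hb hab (by linarith [hs2.2]) hs1.le) (not_le.2 h3)

lemma le_of_le (hd : 1 ≤ d) (hβ : 0 < β) (hb : 0 < b) (hab : b < a) {μ' y' : ℝ}
    (h : IsPeak d β a b μ y) (h' : IsPeak d β a b μ' y') (hμ : μ ≤ μ') : y ≤ y' := by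
  by_contra! hlt
  have := h'.lt_stationaryPotential hd hβ hb hab (s := -(b * y)) (by nlinarith)
  rw [h.stationaryPotential_eq hd hβ hb hab] at this
  linarith

lemma unique (hd : 1 ≤ d) (hβ : 0 < β) (hb : 0 < b) (hab : b < a) {y' : ℝ}
    (h : IsPeak d β a b μ y) (h' : IsPeak d β a b μ y') : y = y' :=
  le_antisymm (h.le_of_le hd hβ hb hab h' le_rfl) (h'.le_of_le hd hβ hb hab h le_rfl)

/-- Makes the potentials favouring long cycles an up-set. At fixed `s` the term `(μ - s)²/(2a)`
grows at rate `(μ - s)/a`, hence faster at `σ = -by` than at the larger minimiser `τ`. -/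
lemma exists_lt_of_lt (hd : 1 ≤ d) (hβ : 0 < β) (hb : 0 < b) (hab : b < a) {μ' : ℝ}
    (h : IsPeak d β a b μ y) (hμ : μ < μ') :
    ∃ y' > 0, reducedFunctional d β a b μ' 0 < reducedFunctional d β a b μ' y' := by
  have ha : 0 < a := hb.trans hab
  have h0 := h.neg hb
  have hτ := isMinimiser_minimiser (d := d) hβ ha μ
  set τ := minimiser d β a μ
  have hlt : -(b * y) < τ := by
    refine (h.isMinimiser hd hβ hb hab).lt_of_lt hβ ha hτ ?_ h0
    have := mul_pos ha h.pos
    linarith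
  refine ⟨_, ?_, lt_of_lt_of_le ?_ (CycleHYL.superFunctional_le hd hβ hb hab h0)⟩
  · have := h.density_lt hd hβ hb hab
    exact div_pos (by linarith) (by linarith)
  · have h1 := pSub_le (d := d) hd hβ ha μ' hτ.nonpos
    have h2 : reducedFunctional d β a b μ 0 ≤ reducedFunctional d β a b μ y :=
      h.isMaxOn (mem_Ici.2 le_rfl)
    rw [reducedFunctional_zero, hτ.pSub_eq hd hβ ha, h.reducedFunctional_eq hd hβ hb hab] at h2
    rw [reducedFunctional_zero]
    unfold superFunctional at *
    set σ := -(b * y)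
    have h3 : ((μ' - σ) ^ 2 / (2 * a) - (μ - σ) ^ 2 / (2 * a)) -
        ((μ' - τ) ^ 2 / (2 * a) - (μ - τ) ^ 2 / (2 * a)) = (μ' - μ) * (τ - σ) / a := by
      field_simp
      ring
    have h4 : 0 < (μ' - μ) * (τ - σ) / a :=
      div_pos (mul_pos (by linarith) (by linarith)) ha
    linarith

end IsPeak

/-! ### The supercritical pressure -/

/-- The upper bound is automatic from `superFunctional_le`. Attainment is asked only up to `ε`
because at the threshold there may be no peak. -/
lemma pSup_eq_of_forall (hd : 1 ≤ d) (hβ : 0 < β) (hb : 0 < b) (hab : b < a) {μ y : ℝ}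
    (hmax : IsMaxOn (reducedFunctional d β a b μ) (Ici 0) y)
    (happrox : ∀ ε > 0, ∃ s < 0, a * idealDensity d β s ≤ μ ∧
      reducedFunctional d β a b μ y - ε ≤ superFunctional d β a b μ s) :
    pSup d β a b μ = reducedFunctional d β a b μ y := by
  unfold pSup
  have hset : {s : ℝ | s < 0 ∧ a * deriv (idealPressure d β) s ≤ μ} =
      {s : ℝ | s < 0 ∧ a * idealDensity d β s ≤ μ} := by
    ext s
    refine and_congr_right fun hs => ?_
    rw [deriv_idealPressure hd hβ hs]
  rw [hset]
  have hub : reducedFunctional d β a b μ y ∈ upperBounds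
      ((fun s : ℝ => (μ - s) ^ 2 / (2 * a) - s ^ 2 / (2 * b) + idealPressure d β s) ''
        {s : ℝ | s < 0 ∧ a * idealDensity d β s ≤ μ}) := by
    rintro _ ⟨s, hs, rfl⟩
    exact (superFunctional_le hd hβ hb hab hs.1).trans
      (hmax (mem_Ici.2 (div_nonneg (sub_nonneg.2 hs.2) (sub_pos.2 hab).le)))
  obtain ⟨s₁, hs₁, hs₁', -⟩ := happrox 1 one_pos
  refine le_antisymm (csSup_le ⟨_, s₁, ⟨hs₁, hs₁'⟩, rfl⟩ hub) ?_
  refine le_of_forall_pos_le_add fun ε hε => ?_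
  obtain ⟨s, hs, hs', h⟩ := happrox ε hε
  have : superFunctional d β a b μ s ≤ _ := le_csSup ⟨_, hub⟩ ⟨s, ⟨hs, hs'⟩, rfl⟩
  linarith

lemma IsPeak.pSup_eq (hd : 1 ≤ d) (hβ : 0 < β) (hb : 0 < b) (hab : b < a) {μ y : ℝ}
    (h : IsPeak d β a b μ y) : pSup d β a b μ = reducedFunctional d β a b μ y := by
  refine pSup_eq_of_forall hd hβ hb hab h.isMaxOn fun ε hε =>
    ⟨_, h.neg hb, (h.density_lt hd hβ hb hab).le, ?_⟩
  rw [h.reducedFunctional_eq hd hβ hb hab]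
  linarith

/-! ### The transition potential without a restriction on the long cycles -/

lemma image_deriv_eq (hd : 1 ≤ d) (hβ : 0 < β) :
    (fun s : ℝ => a * deriv (idealPressure d β) s - (a - b) / b * s) '' Iio 0 =
      stationaryPotential d β a b '' Iio 0 :=
  image_congr fun s hs => by rw [deriv_idealPressure hd hβ hs, stationaryPotential]

lemma le_stationaryPotential (hβ : 0 < β) (ha : 0 < a) {s : ℝ} (hs : s < 0) :
    -((a - b) / b * s) ≤ stationaryPotential d β a b s := by
  have := mul_pos ha (idealDensity_pos d hβ hs)
  unfold stationaryPotential
  linarith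

lemma bddBelow_stationaryPotential (hβ : 0 < β) (hb : 0 < b) (hab : b < a) :
    BddBelow (stationaryPotential d β a b '' Iio 0) := by
  refine ⟨0, ?_⟩
  rintro _ ⟨s, hs, rfl⟩
  refine le_trans ?_ (le_stationaryPotential hβ (hb.trans hab) hs)
  have h1 : 0 ≤ (a - b) / b := div_nonneg (by linarith) hb.le
  have := mul_nonpos_of_nonneg_of_nonpos h1 (le_of_lt hs)
  linarith

lemma muT_le (hd : 1 ≤ d) (hβ : 0 < β) (hb : 0 < b) (hab : b < a) {s : ℝ} (hs : s < 0) :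
    muT d β a b ≤ stationaryPotential d β a b s := by
  unfold muT
  rw [image_deriv_eq hd hβ]
  exact csInf_le (bddBelow_stationaryPotential hβ hb hab) ⟨s, hs, rfl⟩

/-- Above `a ϱ_c` the excess `y = (μ - μ₀)/a` is put into long cycles. The minimiser is `0` before
and after, so the gain is exactly `b y²/2`. -/
lemma exists_lt_of_density_le (hd : 1 ≤ d) (hβ : 0 < β) (hb : 0 < b) (hab : b < a) {μ μ₀ : ℝ}
    (h : ∀ s < 0, a * idealDensity d β s ≤ μ₀) (hμ : μ₀ < μ) :
    ∃ y > 0, reducedFunctional d β a b μ 0 < reducedFunctional d β a b μ y := by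
  have ha : 0 < a := hb.trans hab
  have hmin : ∀ ν ≥ μ₀, IsMinimiser d β a ν 0 := fun ν hν =>
    ⟨le_rfl, fun h0 => absurd h0 (lt_irrefl _), fun _ s hs => (h s hs).trans hν⟩
  have hy : 0 < (μ - μ₀) / a := div_pos (by linarith) ha
  refine ⟨(μ - μ₀) / a, hy, ?_⟩
  have h1 : μ - a * ((μ - μ₀) / a) = μ₀ := by
    field_simp
    ring
  rw [reducedFunctional_zero, reducedFunctional, h1, (hmin μ hμ.le).pSub_eq hd hβ ha,
    (hmin μ₀ le_rfl).pSub_eq hd hβ ha]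
  have h2 : (μ₀ - 0) ^ 2 / (2 * a) + μ * ((μ - μ₀) / a) - (a - b) / 2 * ((μ - μ₀) / a) ^ 2 -
      (μ - 0) ^ 2 / (2 * a) = b / 2 * ((μ - μ₀) / a) ^ 2 := by
    field_simp
    ring
  have h3 : 0 < b / 2 * ((μ - μ₀) / a) ^ 2 := by positivity
  linarith

lemma exists_isPeak (hd : 1 ≤ d) (hβ : 0 < β) (hb : 0 < b) (hab : b < a) {μ : ℝ}
    (h : ∃ y > 0, reducedFunctional d β a b μ 0 < reducedFunctional d β a b μ y) :
    ∃ y, IsPeak d β a b μ y := by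
  obtain ⟨y, hy, hlt⟩ := h
  obtain ⟨z, hz, hmax⟩ := exists_isMaxOn (d := d) hd hβ (hb.trans hab) hab isClosed_Ici
    (nonempty_Ici (a := (0 : ℝ))) subset_rfl μ
  refine ⟨z, lt_of_le_of_ne hz ?_, hmax⟩
  rintro rfl
  exact absurd (hmax (show y ∈ Ici 0 from hy.le)) (not_le.2 hlt)

lemma exists_potential_lt (hd : 1 ≤ d) (hβ : 0 < β) (hb : 0 < b) (hab : b < a) :
    ∃ μ, ∃ y > 0, reducedFunctional d β a b μ 0 < reducedFunctional d β a b μ y := by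
  have ha : 0 < a := hb.trans hab
  have h1 : (-1 : ℝ) < 0 := by norm_num
  have hg := idealDensity_pos d hβ h1
  have hP := idealPressure_nonneg d hβ 0
  have hP1 := idealPressure_nonneg d hβ (-1)
  -- The advantage of `s = -1` over `s = 0` grows like `μ / a`; this `μ` makes it positive, and also
  -- makes the density of long cycles positive.
  set μ := a * (1 / (2 * b) + idealPressure d β 0 + idealDensity d β (-1)) with hμ
  have hμg : a * idealDensity d β (-1) < μ := by
    have : 0 < a * (1 / (2 * b) + idealPressure d β 0) := by positivity
    rw [hμ]
    linarith
  refine ⟨μ, _, ?_, lt_of_lt_of_le ?_ (superFunctional_le hd hβ hb hab h1)⟩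
  · exact div_pos (by linarith) (by linarith)
  · rw [reducedFunctional_zero]
    refine (pSub_le hd hβ ha μ le_rfl).trans_lt ?_
    unfold superFunctional
    have h2 : (μ - -1) ^ 2 / (2 * a) - (-1) ^ 2 / (2 * b) - (μ - 0) ^ 2 / (2 * a) =
        μ / a - 1 / (2 * b) + 1 / (2 * a) := by
      field_simp
      ring
    have h3 : μ / a = 1 / (2 * b) + idealPressure d β 0 + idealDensity d β (-1) := by
      rw [hμ]
      field_simp
    have h4 : 0 < 1 / (2 * a) := by positivity
    linarith

/-- `m` separates the potentials without and with long cycles. -/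
structure IsThreshold (d : ℕ) (β a b m : ℝ) : Prop where
  isMaxOn_zero : ∀ μ ≤ m, IsMaxOn (reducedFunctional d β a b μ) (Ici 0) 0
  not_isPeak : ∀ μ < m, ∀ y, ¬ IsPeak d β a b μ y
  lt_of_gt : ∀ μ > m, ∃ y > 0, reducedFunctional d β a b μ 0 < reducedFunctional d β a b μ y

lemma exists_isThreshold (hd : 1 ≤ d) (hβ : 0 < β) (hb : 0 < b) (hab : b < a) :
    ∃ m, IsThreshold d β a b m ∧ muT d β a b ≤ m ∧ (m : EReal) ≤ muC d β a := by
  have ha : 0 < a := hb.trans hab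
  set U := {μ | ∃ y > 0, reducedFunctional d β a b μ 0 < reducedFunctional d β a b μ y} with hU
  have hne : U.Nonempty := exists_potential_lt hd hβ hb hab
  have hlow : muT d β a b ∈ lowerBounds U := by
    intro μ hμ
    obtain ⟨y, hy⟩ := exists_isPeak hd hβ hb hab hμ
    rw [← hy.stationaryPotential_eq hd hβ hb hab]
    exact muT_le hd hβ hb hab (hy.neg hb)
  have hbdd : BddBelow U := ⟨_, hlow⟩
  refine ⟨sInf U, ⟨?_, ?_, ?_⟩, le_csInf hne hlow, ?_⟩
  · intro μ hμ y hy
    by_contra hcon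
    have hlt : reducedFunctional d β a b μ 0 < reducedFunctional d β a b μ y := not_le.1 hcon
    have hy0 : 0 < y := lt_of_le_of_ne hy fun h => by rw [← h] at hlt; exact lt_irrefl _ hlt
    -- A strict inequality at `μ` would persist slightly below `μ`, hence below the infimum; this
    -- covers the endpoint as well.
    have hc := continuous_reducedFunctional_potential (d := d) hd hβ ha b
    have hev : ∀ᶠ ν in 𝓝[<] μ,
        reducedFunctional d β a b ν 0 < reducedFunctional d β a b ν y :=
      ((hc 0).continuousAt.eventually_lt (hc y).continuousAt hlt).filter_mono nhdsWithin_le_nhds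
    obtain ⟨ν, hν, hν'⟩ := (hev.and self_mem_nhdsWithin).exists
    have : sInf U ≤ ν := csInf_le hbdd ⟨y, hy0, hν⟩
    have : ν < μ := hν'
    linarith
  · intro μ hμ y hy
    obtain ⟨ν, hν, hν'⟩ := exists_between hμ
    have : sInf U ≤ ν := csInf_le hbdd (hy.exists_lt_of_lt hd hβ hb hab hν)
    linarith
  · intro μ hμ
    obtain ⟨ν, hν, hlt⟩ := exists_lt_of_csInf_lt hne hμ
    obtain ⟨y, hy⟩ := exists_isPeak hd hβ hb hab hν
    exact hy.exists_lt_of_lt hd hβ hb hab hlt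
  · unfold muC
    rcases eq_or_ne (criticalDensity d β) ⊤ with h | h
    · rw [h, EReal.coe_mul_top_of_pos ha]
      exact le_top
    · have hbot : criticalDensity d β ≠ ⊥ := by
        unfold criticalDensity
        split_ifs
        · exact EReal.coe_ne_bot _
        · simp
      obtain ⟨ρ, hρ⟩ : ∃ ρ : ℝ, criticalDensity d β = ρ :=
        ⟨_, (EReal.coe_toReal h hbot).symm⟩
      rw [hρ, ← EReal.coe_mul, EReal.coe_le_coe_iff]
      have hle := (criticalDensity_le_iff d hβ ρ).1 hρ.le
      refine le_of_forall_gt_imp_ge_of_dense fun ν hν => csInf_le hbdd ?_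
      exact exists_lt_of_density_le hd hβ hb hab
        (fun s hs => mul_le_mul_of_nonneg_left (hle s hs) ha.le) hν

namespace IsThreshold

variable {m : ℝ}

lemma exists_isPeak (hd : 1 ≤ d) (hβ : 0 < β) (hb : 0 < b) (hab : b < a)
    (h : IsThreshold d β a b m) {μ : ℝ} (hμ : m < μ) : ∃ y, IsPeak d β a b μ y :=
  CycleHYL.exists_isPeak hd hβ hb hab (h.lt_of_gt μ hμ)

/-- At `m` itself the value is approached by peaks at potentials decreasing to `m`; they stay below
the peak `Y` at `m + 1`, which keeps the error uniform. -/
lemma pSup_eq (hd : 1 ≤ d) (hβ : 0 < β) (hb : 0 < b) (hab : b < a)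
    (h : IsThreshold d β a b m) : pSup d β a b m = reducedFunctional d β a b m 0 := by
  have ha : 0 < a := hb.trans hab
  refine pSup_eq_of_forall hd hβ hb hab (h.isMaxOn_zero m le_rfl) fun ε hε => ?_
  obtain ⟨Y, hY⟩ := h.exists_isPeak hd hβ hb hab (show m < m + 1 by linarith)
  have hc : Continuous fun μ => reducedFunctional d β a b μ 0 -
      (μ - m) * (μ + m + 2 * b * Y) / (2 * a) := by
    have := continuous_reducedFunctional_potential (d := d) hd hβ ha b 0
    fun_prop
  have hev : ∀ᶠ μ in 𝓝[>] m, reducedFunctional d β a b m 0 - ε < reducedFunctional d β a b μ 0 -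
      (μ - m) * (μ + m + 2 * b * Y) / (2 * a) :=
    (hc.tendsto m).mono_left nhdsWithin_le_nhds |>.eventually (lt_mem_nhds (by simp; exact hε))
  obtain ⟨μ, hμ, hμ'⟩ := (hev.and (Ioo_mem_nhdsGT (show m < m + 1 by linarith))).exists
  obtain ⟨y, hy⟩ := h.exists_isPeak hd hβ hb hab hμ'.1
  refine ⟨_, hy.neg hb, ?_, ?_⟩
  -- A peak at a potential still closer to `m` is lower, so its `p₀'` is larger, and yet `a p₀'`
  -- stays below that potential.
  · refine le_of_forall_gt_imp_ge_of_dense fun ν hν => ?_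
    have hm : m < min ν μ := lt_min hν hμ'.1
    obtain ⟨y', hy'⟩ := h.exists_isPeak hd hβ hb hab hm
    have hle := hy'.le_of_le hd hβ hb hab hy (min_le_right _ _)
    have h1 : idealDensity d β (-(b * y)) ≤ idealDensity d β (-(b * y')) :=
      (strictMonoOn_idealDensity d hβ).monotoneOn (hy.neg hb) (hy'.neg hb) (by nlinarith)
    calc _ ≤ a * idealDensity d β (-(b * y')) := mul_le_mul_of_nonneg_left h1 ha.le
      _ ≤ min ν μ := (hy'.density_lt hd hβ hb hab).le
      _ ≤ ν := min_le_left _ _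
  · have h1 : reducedFunctional d β a b μ 0 ≤ reducedFunctional d β a b μ y :=
      hy.isMaxOn (mem_Ici.2 le_rfl)
    rw [hy.reducedFunctional_eq hd hβ hb hab] at h1
    have h2 : superFunctional d β a b μ (-(b * y)) - superFunctional d β a b m (-(b * y)) =
        (μ - m) * (μ + m + 2 * b * y) / (2 * a) := by
      unfold superFunctional
      field_simp
      ring
    have hyY : y ≤ Y := hy.le_of_le hd hβ hb hab hY hμ'.2.le
    have h3 : (μ - m) * (μ + m + 2 * b * y) / (2 * a) ≤
        (μ - m) * (μ + m + 2 * b * Y) / (2 * a) := by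
      have : 0 ≤ μ - m := by linarith [hμ'.1]
      gcongr
    linarith

end IsThreshold

/-! ### The potential `μ_r` -/

lemma exists_isMinOn_stationaryPotential (hβ : 0 < β) (hb : 0 < b) (hab : b < a) {t : ℝ}
    (ht : t < 0) :
    ∃ σ ≤ t, ∀ s ≤ t, stationaryPotential d β a b σ ≤ stationaryPotential d β a b s := by
  have hc : 0 < (a - b) / b := div_pos (by linarith) hb
  have hcont : ContinuousOn (stationaryPotential d β a b) (Iic t) :=
    (continuousOn_stationaryPotential hβ).mono fun s hs => lt_of_le_of_lt hs ht
  obtain ⟨σ, hσ, hmin⟩ := hcont.exists_isMinOn' isClosed_Iic (mem_Iic.2 le_rfl) (by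
    rw [eventually_inf_principal]
    set R := min t (-(stationaryPotential d β a b t / ((a - b) / b)))
    have : (Icc R t)ᶜ ∈ cocompact ℝ := isCompact_Icc.compl_mem_cocompact
    filter_upwards [this] with s hs hst
    have hsR : s < R := by
      by_contra! h
      exact hs ⟨h, hst⟩
    have h1 : s ≤ -(stationaryPotential d β a b t / ((a - b) / b)) :=
      hsR.le.trans (min_le_right _ _)
    refine le_trans ?_ (le_stationaryPotential hβ (hb.trans hab) (lt_of_le_of_lt hst ht))
    have h2 : stationaryPotential d β a b t / ((a - b) / b) ≤ -s := by linarith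
    rw [div_le_iff₀ hc] at h2
    linarith)
  exact ⟨σ, hσ, fun s hs => hmin hs⟩

lemma exists_stationaryPotential_eq (hβ : 0 < β) (hb : 0 < b) (hab : b < a) {μ σ : ℝ}
    (hσ : σ < 0) (h : stationaryPotential d β a b σ ≤ μ) :
    ∃ τ ≤ σ, stationaryPotential d β a b τ = μ := by
  have hc : 0 < (a - b) / b := div_pos (by linarith) hb
  set r := min σ (-(μ / ((a - b) / b))) with hr
  have hr0 : r ≤ σ := min_le_left _ _
  have hr1 : r ≤ -(μ / ((a - b) / b)) := min_le_right _ _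
  have h1 : μ ≤ stationaryPotential d β a b r := by
    refine le_trans ?_ (le_stationaryPotential hβ (hb.trans hab) (by linarith))
    have h2 : μ / ((a - b) / b) ≤ -r := by linarith
    rw [div_le_iff₀ hc] at h2
    linarith
  obtain ⟨τ, hτ, he⟩ := isPreconnected_Iic.intermediate_value (s := Iic σ) (a := σ) (b := r)
    (mem_Iic.2 le_rfl) hr0 ((continuousOn_stationaryPotential hβ).mono
      fun s hs => lt_of_le_of_lt hs hσ) ⟨h, h1⟩
  exact ⟨τ, hτ, he⟩

lemma sBeta_idealDensity (hd : 1 ≤ d) (hβ : 0 < β) {σ : ℝ} (hσ : σ < 0) :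
    sBeta d β (idealDensity d β σ) = σ := by
  unfold sBeta
  have h1 : ¬ criticalDensity d β ≤ (idealDensity d β σ : EReal) := by
    rw [criticalDensity_le_iff d hβ]
    push Not
    exact ⟨σ / 2, by linarith, strictMonoOn_idealDensity d hβ hσ
      (show σ / 2 < 0 by linarith) (by linarith)⟩
  rw [if_neg h1]
  have h2 : {s : ℝ | s < 0 ∧ deriv (idealPressure d β) s = idealDensity d β σ} = {σ} := by
    ext s
    constructor
    · rintro ⟨hs, he⟩
      rw [deriv_idealPressure hd hβ hs] at he
      exact (strictMonoOn_idealDensity d hβ).injOn hs hσ he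
    · rintro rfl
      exact ⟨hσ, deriv_idealPressure hd hβ hσ⟩
  rw [h2, csSup_singleton]

lemma idealDensity_sBeta (hd : 1 ≤ d) (hβ : 0 < β) {x : ℝ} (hx : 0 < x)
    (h : sBeta d β x < 0) : idealDensity d β (sBeta d β x) = x := by
  have h1 : ¬ criticalDensity d β ≤ (x : EReal) := fun hle => by
    rw [sBeta, if_pos hle] at h
    exact lt_irrefl _ h
  rw [criticalDensity_le_iff d hβ] at h1
  push Not at h1
  obtain ⟨s, hs, hxs⟩ := h1
  obtain ⟨t, ht, rfl⟩ := exists_idealDensity_eq d hβ hx hs hxs.le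
  rw [sBeta_idealDensity hd hβ ht]

/-- If `φ` takes a value at most `μ`, a root of `φ = μ` gives a solution with `s_β < 0`. Otherwise
the infimum `μ_t` of `φ` is approached only as `s ↑ 0`; this yields `a p₀' ≤ μ` throughout, and `x =
μ / a` solves the equation with `s_β = 0`. -/
lemma xTwo_set_nonempty (hd : 1 ≤ d) (hβ : 0 < β) (hb : 0 < b) (hab : b < a) {μ : ℝ}
    (hμ : muT d β a b ≤ μ) :
    {x : ℝ | 0 < x ∧ sBeta d β x = -(b / (a - b)) * (μ - a * x)}.Nonempty := by
  have ha : 0 < a := hb.trans hab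
  have hab' : a - b ≠ 0 := (sub_pos.2 hab).ne'
  by_cases h : ∃ σ < 0, stationaryPotential d β a b σ ≤ μ
  · obtain ⟨σ, hσ, hle⟩ := h
    obtain ⟨τ, hτ, rfl⟩ := exists_stationaryPotential_eq hβ hb hab hσ hle
    have hτ0 : τ < 0 := lt_of_le_of_lt hτ hσ
    refine ⟨idealDensity d β τ, idealDensity_pos d hβ hτ0, ?_⟩
    rw [sBeta_idealDensity hd hβ hτ0, stationaryPotential]
    field_simp
    ring
  · push Not at h
    have hle : ∀ t < 0, a * idealDensity d β t ≤ μ := by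
      intro t ht
      refine le_of_forall_pos_le_add fun ε hε => ?_
      obtain ⟨σ, hσ, hmin⟩ := exists_isMinOn_stationaryPotential (d := d) hβ hb hab ht
      have hlt : muT d β a b < min (stationaryPotential d β a b σ) (μ + ε) :=
        lt_min (hμ.trans_lt (h σ (lt_of_le_of_lt hσ ht))) (by linarith)
      rw [muT, image_deriv_eq hd hβ] at hlt
      obtain ⟨_, ⟨τ, hτ, rfl⟩, hlt'⟩ := exists_lt_of_csInf_lt
        ((nonempty_Iio (a := (0 : ℝ))).image (stationaryPotential d β a b)) hlt
      have htτ : t < τ := by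
        by_contra! hcon
        exact absurd (hmin τ hcon) (not_le.2 (hlt'.trans_le (min_le_left _ _)))
      have h1 := mul_le_mul_of_nonneg_left
        ((strictMonoOn_idealDensity d hβ).monotoneOn ht hτ htτ.le) ha.le
      have h2 := hlt'.trans_le (min_le_right _ _)
      have h3 : (a - b) / b * τ ≤ 0 :=
        mul_nonpos_of_nonneg_of_nonpos (div_nonneg (by linarith) hb.le) (le_of_lt hτ)
      unfold stationaryPotential at h2
      linarith
    have hpos : 0 < μ := by
      refine lt_of_lt_of_le ?_ (hle (-1) (by norm_num))
      exact mul_pos ha (idealDensity_pos d hβ (by norm_num))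
    refine ⟨μ / a, by positivity, ?_⟩
    have hc : criticalDensity d β ≤ ((μ / a : ℝ) : EReal) := by
      rw [criticalDensity_le_iff d hβ]
      intro s hs
      rw [le_div_iff₀ ha]
      linarith [hle s hs]
    rw [sBeta, if_pos hc]
    field_simp
    ring

/-- For `σ = s_β(x) < 0` the equation defining `x̃₂` says `φ(σ) = μ` and `a x = μ + (a-b)/b σ`, so
the bound on `x` becomes `σ ≤ -bκ`. -/
lemma mem_muR_set_iff (hd : 1 ≤ d) (hβ : 0 < β) (hb : 0 < b) (hab : b < a) {κ : ℝ} (hκ : 0 < κ)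
    (μ : ℝ) : (muT d β a b ≤ μ ∧ xTwo d β a b μ ≤ 1 / a * (μ - κ * (a - b))) ↔
      ∃ σ ≤ -(b * κ), stationaryPotential d β a b σ ≤ μ := by
  have ha : 0 < a := hb.trans hab
  have hab' : 0 < a - b := sub_pos.2 hab
  have hbκ : 0 < b * κ := mul_pos hb hκ
  constructor
  · rintro ⟨hμ, hx⟩
    by_contra! hcon
    have h0 : -(b * κ) < 0 := by linarith
    have hcont : ContinuousAt (stationaryPotential d β a b) (-(b * κ)) :=
      (continuousOn_stationaryPotential hβ).continuousAt (Iio_mem_nhds h0)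
    obtain ⟨δ, hδ, hδ'⟩ := Metric.eventually_nhds_iff.1
      (hcont.eventually (lt_mem_nhds (hcon _ le_rfl)))
    -- The infimum `xTwo` is not assumed attained: a nearly minimal solution has `σ < -bκ + η`, and
    -- continuity of `φ` at `-bκ` excludes the gap. The bound `η ≤ bκ` keeps `σ` negative.
    set η := min δ (b * κ) with hη
    have hη0 : 0 < η := lt_min hδ hbκ
    have hlt : xTwo d β a b μ < 1 / a * (μ - κ * (a - b)) + (a - b) * η / (a * b) :=
      lt_of_le_of_lt hx (lt_add_of_pos_right _ (by positivity))
    obtain ⟨x, ⟨hx0, hxe⟩, hxlt⟩ := exists_lt_of_csInf_lt (xTwo_set_nonempty hd hβ hb hab hμ) hlt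
    set σ := sBeta d β x with hσ
    have hax : a * x = μ + (a - b) / b * σ := by
      rw [hxe]
      field_simp
      ring
    have hσlt : σ < -(b * κ) + η := by
      have h1 := mul_lt_mul_of_pos_left hxlt ha
      have h2 : a * (1 / a * (μ - κ * (a - b)) + (a - b) * η / (a * b)) =
          μ + (a - b) / b * (-(b * κ) + η) := by
        field_simp
        ring
      rw [h2, hax] at h1
      have hc : 0 < (a - b) / b := by positivity
      exact lt_of_mul_lt_mul_left (by linarith) hc.le
    have hσ0 : σ < 0 := by
      have := min_le_right δ (b * κ)
      linarith
    have hg : idealDensity d β σ = x := idealDensity_sBeta hd hβ hx0 hσ0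
    have hφ : stationaryPotential d β a b σ = μ := by
      rw [stationaryPotential, hg]
      linarith
    rcases le_or_gt σ (-(b * κ)) with h | h
    · exact absurd (hcon σ h) (by rw [hφ]; exact lt_irrefl _)
    · have hdist : dist σ (-(b * κ)) < δ := by
        rw [Real.dist_eq, abs_of_pos (by linarith)]
        have := min_le_left δ (b * κ)
        linarith
      exact absurd (hδ' hdist) (by rw [hφ]; exact lt_irrefl _)
  · rintro ⟨σ, hσ, hle⟩
    have hσ0 : σ < 0 := by linarith
    refine ⟨(muT_le hd hβ hb hab hσ0).trans hle, ?_⟩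
    obtain ⟨τ, hτ, rfl⟩ := exists_stationaryPotential_eq hβ hb hab hσ0 hle
    have hτ0 : τ < 0 := by linarith
    have hmem : idealDensity d β τ ∈ {x : ℝ | 0 < x ∧ sBeta d β x =
        -(b / (a - b)) * (stationaryPotential d β a b τ - a * x)} := by
      refine ⟨idealDensity_pos d hβ hτ0, ?_⟩
      rw [sBeta_idealDensity hd hβ hτ0, stationaryPotential]
      field_simp
      ring
    refine (csInf_le ⟨0, fun x hx => hx.1.le⟩ hmem).trans ?_
    have h1 : 1 / a * (stationaryPotential d β a b τ - κ * (a - b)) - idealDensity d β τ =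
        (a - b) / (a * b) * (-(b * κ) - τ) := by
      unfold stationaryPotential
      field_simp
      ring
    have h2 : 0 ≤ (a - b) / (a * b) * (-(b * κ) - τ) :=
      mul_nonneg (by positivity) (by linarith)
    linarith

/-- `μ_r` is the minimum of the stationary potential over `s ≤ -bκ`. -/
lemma exists_muR_eq (hd : 1 ≤ d) (hβ : 0 < β) (hb : 0 < b) (hab : b < a) {κ : ℝ} (hκ : 0 < κ) :
    ∃ σ ≤ -(b * κ), stationaryPotential d β a b σ = muR d β a b κ ∧
      ∀ s ≤ -(b * κ), muR d β a b κ ≤ stationaryPotential d β a b s := by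
  have hbκ : -(b * κ) < 0 := by linarith [mul_pos hb hκ]
  obtain ⟨σ, hσ, hmin⟩ := exists_isMinOn_stationaryPotential (d := d) hβ hb hab hbκ
  have heq : muR d β a b κ = stationaryPotential d β a b σ := by
    unfold muR
    simp only [mem_muR_set_iff hd hβ hb hab hκ]
    refine IsLeast.csInf_eq ⟨⟨σ, hσ, le_rfl⟩, ?_⟩
    rintro μ ⟨τ, hτ, hle⟩
    exact (hmin τ hτ).trans hle
  exact ⟨σ, hσ, heq.symm, fun s hs => heq ▸ hmin s hs⟩

lemma muR_le_of_isMaxOn (hd : 1 ≤ d) (hβ : 0 < β) (hb : 0 < b) (hab : b < a) {κ μ y : ℝ}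
    (hκ : 0 < κ) (hy : κ < y) (h : IsMaxOn (reducedFunctional d β a b μ) (Ici κ) y) :
    muR d β a b κ ≤ μ := by
  obtain ⟨-, -, -, hmin⟩ := exists_muR_eq (d := d) hd hβ hb hab hκ
  have h1 := isMinimiser_of_isMaxOn hd hβ hb hab hy h
  rw [← h1.stationaryPotential_eq hb (hκ.trans hy)]
  exact hmin _ (by nlinarith)

namespace IsPeak

variable {κ μ y : ℝ}

lemma le_of_muR_le (hd : 1 ≤ d) (hβ : 0 < β) (hb : 0 < b) (hab : b < a) (hκ : 0 < κ)
    (h : IsPeak d β a b μ y) (hμ : muR d β a b κ ≤ μ) : κ ≤ y := by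
  obtain ⟨σ, hσ, he, -⟩ := exists_muR_eq (d := d) hd hβ hb hab hκ
  by_contra! hlt
  have := h.lt_stationaryPotential hd hβ hb hab (s := σ) (by nlinarith)
  linarith

lemma muR_le_of_le (hd : 1 ≤ d) (hβ : 0 < β) (hb : 0 < b) (hab : b < a) (hκ : 0 < κ)
    (h : IsPeak d β a b μ y) (hy : κ ≤ y) : muR d β a b κ ≤ μ := by
  obtain ⟨-, -, -, hmin⟩ := exists_muR_eq (d := d) hd hβ hb hab hκ
  rw [← h.stationaryPotential_eq hd hβ hb hab]
  exact hmin _ (by nlinarith)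

/-- If `y > κ`, then `-bκ` lies strictly between `-by` and a point where `φ < μ_r`, so strict
convexity gives `φ(-bκ) < μ_r`, against minimality. -/
lemma eq_of_muR_eq (hd : 1 ≤ d) (hβ : 0 < β) (hb : 0 < b) (hab : b < a) (hκ : 0 < κ)
    (h : IsPeak d β a b (muR d β a b κ) y) : y = κ := by
  obtain ⟨-, -, -, hmin⟩ := exists_muR_eq (d := d) hd hβ hb hab hκ
  refine le_antisymm ?_ (h.le_of_muR_le hd hβ hb hab hκ le_rfl)
  by_contra! hlt
  obtain ⟨t, ht, htlt⟩ := h.exists_stationaryPotential_lt hd hβ hb hab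
  have htκ : -(b * κ) < t := by
    by_contra! hcon
    exact absurd (hmin t hcon) (not_le.2 htlt)
  have := stationaryPotential_lt_of_mem_Ioo (d := d) hβ (hb.trans hab) ht
    (h.stationaryPotential_eq hd hβ hb hab).le htlt.le (z := -(b * κ)) ⟨by nlinarith, htκ⟩
  exact absurd (hmin _ le_rfl) (not_le.2 this)

end IsPeak

/-! ### Comparison of no long cycles with long cycles at the minimal density `κ` -/

/-- The gain in pressure from a density `κ` of long cycles. -/
noncomputable def longCycleGain (d : ℕ) (β a b κ μ : ℝ) : ℝ :=
  reducedFunctional d β a b μ κ - reducedFunctional d β a b μ 0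

lemma longCycleGain_eq (κ μ : ℝ) : longCycleGain d β a b κ μ =
    pSub d β a (μ - a * κ) + μ * κ - (a - b) / 2 * κ ^ 2 - pSub d β a μ := by
  rw [longCycleGain, reducedFunctional_zero, reducedFunctional]

/-- With `σ(ν)` the minimiser at `ν`, the gain formally has derivative `(σ(μ) - σ(μ - aκ))/a ≥ 0`.
This finite-difference form needs no derivative: the minimisers serve as test points at the other
potentials. -/
lemma longCycleGain_sub_ge (hd : 1 ≤ d) (hβ : 0 < β) (ha : 0 < a) {κ μ μ' σ τ : ℝ}
    (hσ : IsMinimiser d β a μ σ) (hτ : IsMinimiser d β a (μ' - a * κ) τ) :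
    (μ' - μ) * (σ - τ) / a ≤ longCycleGain d β a b κ μ' - longCycleGain d β a b κ μ := by
  have h1 := pSub_le (d := d) hd hβ ha μ' hσ.nonpos
  have h2 := pSub_le (d := d) hd hβ ha (μ - a * κ) hτ.nonpos
  have h3 := hσ.pSub_eq hd hβ ha
  have h4 := hτ.pSub_eq hd hβ ha
  rw [longCycleGain_eq, longCycleGain_eq]
  have h5 : (μ' - a * κ - τ) ^ 2 / (2 * a) + μ' * κ - (μ' - σ) ^ 2 / (2 * a) -
      ((μ - a * κ - τ) ^ 2 / (2 * a) + μ * κ - (μ - σ) ^ 2 / (2 * a)) =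
      (μ' - μ) * (σ - τ) / a := by
    field_simp
    ring
  linarith

/-- The test points are exchanged; this serves steps with `μ ≤ μ' - aκ`, where the previous lower
bound is nonpositive. -/
lemma longCycleGain_sub_ge' (hd : 1 ≤ d) (hβ : 0 < β) (ha : 0 < a) {κ μ μ' σ τ : ℝ}
    (hσ : IsMinimiser d β a μ σ) (hτ : IsMinimiser d β a (μ' - a * κ) τ) :
    κ * (τ - σ) ≤ longCycleGain d β a b κ μ' - longCycleGain d β a b κ μ := by
  have h1 := pSub_le (d := d) hd hβ ha μ' hτ.nonpos
  have h2 := pSub_le (d := d) hd hβ ha (μ - a * κ) hσ.nonpos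
  have h3 := hσ.pSub_eq hd hβ ha
  have h4 := hτ.pSub_eq hd hβ ha
  rw [longCycleGain_eq, longCycleGain_eq]
  have h5 : (μ' - a * κ - τ) ^ 2 / (2 * a) + μ' * κ - (μ' - τ) ^ 2 / (2 * a) -
      ((μ - a * κ - σ) ^ 2 / (2 * a) + μ * κ - (μ - σ) ^ 2 / (2 * a)) =
      κ * (τ - σ) := by
    field_simp
    ring
  linarith

lemma longCycleGain_monotone (hd : 1 ≤ d) (hβ : 0 < β) (ha : 0 < a) {κ : ℝ} (hκ : 0 < κ) :
    Monotone (longCycleGain d β a b κ) := by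
  intro μ μ' hμ
  have hσ := isMinimiser_minimiser (d := d) hβ ha μ
  have hτ := isMinimiser_minimiser (d := d) hβ ha (μ' - a * κ)
  rcases le_total (μ' - a * κ) μ with h | h
  · have h1 := longCycleGain_sub_ge (b := b) hd hβ ha hσ hτ
    have h2 := hτ.mono hβ ha hσ h
    have : 0 ≤ (μ' - μ) * (minimiser d β a μ - minimiser d β a (μ' - a * κ)) / a :=
      div_nonneg (mul_nonneg (by linarith) (by linarith)) ha.le
    linarith
  · have h1 := longCycleGain_sub_ge' (b := b) hd hβ ha hσ hτ
    have h2 := hσ.mono hβ ha hτ h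
    have := mul_nonneg hκ.le (sub_nonneg.2 h2)
    linarith

lemma longCycleGain_lt_of_nonpos (hd : 1 ≤ d) (hβ : 0 < β) (ha : 0 < a) (hb : 0 < b) {κ : ℝ}
    (hκ : 0 < κ) {μ μ' : ℝ} (hμ : μ < μ') (h : longCycleGain d β a b κ μ' ≤ 0) :
    longCycleGain d β a b κ μ < longCycleGain d β a b κ μ' := by
  have haκ := mul_pos ha hκ
  have hτ := isMinimiser_minimiser (d := d) hβ ha (μ' - a * κ)
  set τ := minimiser d β a (μ' - a * κ)
  -- At `τ = 0` the gain would be at least `bκ²/2`. Negativity of `τ` makes the minimiser strictly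
  -- increasing there.
  have hτ0 : τ < 0 := by
    refine hτ.nonpos.lt_of_ne fun h0 => ?_
    have h1 := pSub_le (d := d) hd hβ ha μ' hτ.nonpos
    have h2 := hτ.pSub_eq hd hβ ha
    rw [longCycleGain_eq] at h
    have h3 : (μ' - a * κ - τ) ^ 2 / (2 * a) + μ' * κ - (a - b) / 2 * κ ^ 2 -
        (μ' - τ) ^ 2 / (2 * a) = b / 2 * κ ^ 2 + κ * τ := by
      field_simp
      ring
    have h4 : 0 < b / 2 * κ ^ 2 := by positivity
    have h5 : κ * τ = 0 := by rw [h0, mul_zero]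
    linarith
  -- Staying within `aκ` of `μ'` ensures `μ' - aκ < ν`, so the finite difference from `ν` to `μ'` is
  -- strictly positive.
  set ν := max μ (μ' - a * κ / 2) with hν
  have hνμ' : ν < μ' := max_lt hμ (by linarith)
  have h1 : μ' - a * κ < ν := lt_of_lt_of_le (by linarith) (le_max_right _ _)
  have hσ := isMinimiser_minimiser (d := d) hβ ha ν
  have h2 := hτ.lt_of_lt hβ ha hσ h1 hτ0
  have h3 := longCycleGain_sub_ge (b := b) hd hβ ha hσ hτ
  have h4 : 0 < (μ' - ν) * (minimiser d β a ν - τ) / a :=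
    div_pos (mul_pos (by linarith) (by linarith)) ha
  have h5 := longCycleGain_monotone (d := d) (b := b) hd hβ ha hκ (le_max_left μ (μ' - a * κ / 2))
  rw [← hν] at h5
  linarith

lemma continuous_longCycleGain (hd : 1 ≤ d) (hβ : 0 < β) (ha : 0 < a) (κ : ℝ) :
    Continuous (longCycleGain d β a b κ) :=
  (continuous_reducedFunctional_potential hd hβ ha b κ).sub
    (continuous_reducedFunctional_potential hd hβ ha b 0)

/-! ### Maximisers for given `κ` -/

lemma longDensities_zero : longDensities 0 = Ici 0 := by
  ext y
  simp [longDensities]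

lemma longDensities_top : longDensities ⊤ = {0} := by
  ext y
  simp only [longDensities, top_le_iff, ENNReal.ofReal_ne_top, or_false, mem_ofPred_eq,
    mem_singleton_iff]
  exact ⟨fun h => h.2, fun h => ⟨h.ge, h⟩⟩

lemma longDensities_ofReal {κ : ℝ} (hκ : 0 < κ) :
    longDensities (ENNReal.ofReal κ) = insert 0 (Ici κ) := by
  ext y
  simp only [longDensities, mem_ofPred_eq, mem_insert_iff, mem_Ici]
  constructor
  · rintro ⟨hy, h | h⟩
    · exact Or.inl h
    · exact Or.inr ((ENNReal.ofReal_le_ofReal_iff hy).1 h)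
  · rintro (rfl | h)
    · exact ⟨le_rfl, Or.inl rfl⟩
    · exact ⟨hκ.le.trans h, Or.inr (ENNReal.ofReal_le_ofReal h)⟩

lemma longDensities_subset (κ : ℝ≥0∞) : longDensities κ ⊆ Ici 0 := fun _ hy => hy.1

lemma zero_mem_longDensities (κ : ℝ≥0∞) : (0 : ℝ) ∈ longDensities κ := ⟨le_rfl, Or.inl rfl⟩

lemma isClosed_longDensities (κ : ℝ≥0∞) : IsClosed (longDensities κ) := by
  have : longDensities κ = Ici 0 ∩ ({0} ∪ {y | κ ≤ ENNReal.ofReal y}) := by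
    ext y
    simp [longDensities]
  rw [this]
  exact isClosed_Ici.inter (isClosed_singleton.union
    (isClosed_le continuous_const ENNReal.continuous_ofReal))

lemma exists_isMaxOn_longDensities (hd : 1 ≤ d) (hβ : 0 < β) (ha : 0 < a) (hab : b < a)
    (κ : ℝ≥0∞) (μ : ℝ) :
    ∃ y ∈ longDensities κ, IsMaxOn (reducedFunctional d β a b μ) (longDensities κ) y :=
  exists_isMaxOn hd hβ ha hab (isClosed_longDensities κ) ⟨0, zero_mem_longDensities κ⟩
    (longDensities_subset κ) μ

namespace IsThreshold

variable {m μ : ℝ}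

lemma zeroes_of_lt (hd : 1 ≤ d) (hβ : 0 < β) (ha : 0 < a) (h : IsThreshold d β a b m) (hμ : μ < m)
    (κ : ℝ≥0∞) : ∃ x : ℝ, zeroes d β μ a b κ = {(x, 0)} := by
  have hmax := h.isMaxOn_zero μ hμ.le
  refine ⟨_, zeroes_eq_singleton hd hβ ha (zero_mem_longDensities κ)
    (hmax.on_subset (longDensities_subset κ)) fun y hy he => ?_⟩
  by_contra hne
  refine h.not_isPeak μ hμ y ⟨lt_of_le_of_ne hy.1 (Ne.symm hne), fun z hz => ?_⟩
  have : reducedFunctional d β a b μ z ≤ reducedFunctional d β a b μ 0 := hmax hz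
  simp only [mem_ofPred_eq]
  linarith

lemma zeroes_of_isPeak (hd : 1 ≤ d) (hβ : 0 < β) (hb : 0 < b) (hab : b < a)
    (h : IsThreshold d β a b m) (hμ : m < μ) {κ : ℝ≥0∞} {y : ℝ} (hy : IsPeak d β a b μ y)
    (hyκ : y ∈ longDensities κ) : ∃ x y : ℝ, 0 < y ∧ zeroes d β μ a b κ = {(x, y)} := by
  refine ⟨_, y, hy.pos, zeroes_eq_singleton hd hβ (hb.trans hab) hyκ
    (hy.isMaxOn.on_subset (longDensities_subset κ)) fun y' hy' he => ?_⟩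
  have hmax' : IsMaxOn (reducedFunctional d β a b μ) (Ici 0) y' := fun z hz => by
    have : reducedFunctional d β a b μ z ≤ reducedFunctional d β a b μ y := hy.isMaxOn hz
    simp only [mem_ofPred_eq]
    linarith
  obtain ⟨w, hw, hlt⟩ := h.lt_of_gt μ hμ
  refine (IsPeak.unique hd hβ hb hab ⟨lt_of_le_of_ne hy'.1 ?_, hmax'⟩ hy)
  rintro rfl
  exact absurd (hmax' (show w ∈ Ici 0 from hw.le)) (not_le.2 hlt)

lemma isTransition_zero (hd : 1 ≤ d) (hβ : 0 < β) (hb : 0 < b) (hab : b < a)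
    (h : IsThreshold d β a b m) : IsTransition d β a b 0 m := by
  refine ⟨fun μ hμ => h.zeroes_of_lt hd hβ (hb.trans hab) hμ 0, fun μ hμ => ?_⟩
  obtain ⟨y, hy⟩ := h.exists_isPeak hd hβ hb hab hμ
  exact h.zeroes_of_isPeak hd hβ hb hab hμ hy (by rw [longDensities_zero]; exact hy.pos.le)

lemma exists_isPeak_mem (hd : 1 ≤ d) (hβ : 0 < β) (hb : 0 < b) (hab : b < a)
    (h : IsThreshold d β a b m) (hμ : m < μ) {κ : ℝ} (hκ : 0 < κ) (hr : muR d β a b κ ≤ μ) :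
    ∃ y ∈ longDensities (ENNReal.ofReal κ), IsPeak d β a b μ y := by
  obtain ⟨y, hy⟩ := h.exists_isPeak hd hβ hb hab hμ
  refine ⟨y, ?_, hy⟩
  rw [longDensities_ofReal hκ]
  exact Or.inr (hy.le_of_muR_le hd hβ hb hab hκ hr)

lemma isTransition_of_muR_le (hd : 1 ≤ d) (hβ : 0 < β) (hb : 0 < b) (hab : b < a)
    (h : IsThreshold d β a b m) {κ : ℝ} (hκ : 0 < κ) (hr : muR d β a b κ ≤ m) :
    IsTransition d β a b (ENNReal.ofReal κ) m := by
  refine ⟨fun μ hμ => h.zeroes_of_lt hd hβ (hb.trans hab) hμ _, fun μ hμ => ?_⟩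
  obtain ⟨y, hyκ, hy⟩ := h.exists_isPeak_mem hd hβ hb hab hμ hκ (hr.trans hμ.le)
  exact h.zeroes_of_isPeak hd hβ hb hab hμ hy hyκ

/-- If `μ_r` is the threshold, then long cycles of density `κ` are optimal there. -/
lemma isPeak_of_muR_eq (hd : 1 ≤ d) (hβ : 0 < β) (hb : 0 < b) (hab : b < a)
    (h : IsThreshold d β a b m) {κ : ℝ} (hκ : 0 < κ) (hr : muR d β a b κ = m) :
    IsPeak d β a b m κ := by
  have ha := hb.trans hab
  have hsub : Ici κ ⊆ Ici (0 : ℝ) := Ici_subset_Ici.2 hκ.le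
  have hc := continuous_maxPressure (d := d) hd hβ ha hab isClosed_Ici
    (nonempty_Ici (a := κ)) hsub
  have hc0 := continuous_reducedFunctional_potential (d := d) hd hβ ha b 0
  -- Just above `m` the peaks are at least `κ`, so the maximum over `[κ, ∞)` beats `T(0)`; this
  -- passes to the limit.
  have hle : reducedFunctional d β a b m 0 ≤ maxPressure d β a b (Ici κ) m := by
    refine le_of_tendsto_of_tendsto (b := 𝓝[>] m) ((hc0.tendsto m).mono_left nhdsWithin_le_nhds)
      ((hc.tendsto m).mono_left nhdsWithin_le_nhds) ?_
    filter_upwards [self_mem_nhdsWithin] with μ hμ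
    obtain ⟨y, hy⟩ := h.exists_isPeak hd hβ hb hab (μ := μ) hμ
    have hyκ : y ∈ Ici κ := hy.le_of_muR_le hd hβ hb hab hκ (hr.le.trans (le_of_lt hμ))
    rw [maxPressure_eq hyκ (hy.isMaxOn.on_subset hsub)]
    exact hy.isMaxOn (mem_Ici.2 le_rfl)
  obtain ⟨y, hy, hmax⟩ := exists_isMaxOn (d := d) hd hβ ha hab isClosed_Ici
    (nonempty_Ici (a := κ)) hsub m
  rw [maxPressure_eq hy hmax] at hle
  have hpeak : IsPeak d β a b m y := by
    refine ⟨hκ.trans_le hy, fun z hz => ?_⟩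
    exact le_trans (h.isMaxOn_zero m le_rfl hz) hle
  have : y = κ := IsPeak.eq_of_muR_eq hd hβ hb hab hκ (by rw [hr]; exact hpeak)
  rwa [this] at hpeak

end IsThreshold

/-- Below `μ_r`, the optimal density of long cycles is `0` or `κ`. -/
lemma eq_zero_or_eq_of_lt_muR (hd : 1 ≤ d) (hβ : 0 < β) (hb : 0 < b) (hab : b < a) {κ μ y : ℝ}
    (hκ : 0 < κ) (hμ : μ < muR d β a b κ) (hy : y ∈ longDensities (ENNReal.ofReal κ))
    (h : IsMaxOn (reducedFunctional d β a b μ) (longDensities (ENNReal.ofReal κ)) y) :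
    y = 0 ∨ y = κ := by
  rw [longDensities_ofReal hκ] at hy h
  refine hy.imp_right fun hy' => ?_
  by_contra hne
  have := muR_le_of_isMaxOn hd hβ hb hab hκ (lt_of_le_of_ne hy' (Ne.symm hne))
    (h.on_subset (subset_insert _ _))
  linarith

lemma mem_longDensities_self {κ : ℝ} (hκ : 0 < κ) : κ ∈ longDensities (ENNReal.ofReal κ) := by
  rw [longDensities_ofReal hκ]
  exact Or.inr (mem_Ici.2 le_rfl)

lemma isMaxOn_zero_of_gain_nonpos (hd : 1 ≤ d) (hβ : 0 < β) (hb : 0 < b) (hab : b < a) {κ μ : ℝ}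
    (hκ : 0 < κ) (hμ : μ < muR d β a b κ) (hg : longCycleGain d β a b κ μ ≤ 0) :
    IsMaxOn (reducedFunctional d β a b μ) (longDensities (ENNReal.ofReal κ)) 0 := by
  obtain ⟨y, hy, hmax⟩ := exists_isMaxOn_longDensities (d := d) hd hβ (hb.trans hab) hab
    (ENNReal.ofReal κ) μ
  unfold longCycleGain at hg
  rcases eq_zero_or_eq_of_lt_muR hd hβ hb hab hκ hμ hy hmax with rfl | rfl
  · exact hmax
  · intro z hz
    have : reducedFunctional d β a b μ z ≤ reducedFunctional d β a b μ y := hmax hz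
    simp only [mem_ofPred_eq]
    linarith

lemma isMaxOn_of_gain_nonneg (hd : 1 ≤ d) (hβ : 0 < β) (hb : 0 < b) (hab : b < a) {κ μ : ℝ}
    (hκ : 0 < κ) (hμ : μ < muR d β a b κ) (hg : 0 ≤ longCycleGain d β a b κ μ) :
    IsMaxOn (reducedFunctional d β a b μ) (longDensities (ENNReal.ofReal κ)) κ := by
  obtain ⟨y, hy, hmax⟩ := exists_isMaxOn_longDensities (d := d) hd hβ (hb.trans hab) hab
    (ENNReal.ofReal κ) μ
  unfold longCycleGain at hg
  rcases eq_zero_or_eq_of_lt_muR hd hβ hb hab hκ hμ hy hmax with rfl | rfl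
  · intro z hz
    have : reducedFunctional d β a b μ z ≤ reducedFunctional d β a b μ 0 := hmax hz
    simp only [mem_ofPred_eq]
    linarith
  · exact hmax

/-- The transition potential for `κ`, when `μ_r` exceeds the threshold. -/
lemma IsThreshold.exists_gain_eq_zero (hd : 1 ≤ d) (hβ : 0 < β) (hb : 0 < b) (hab : b < a) {m κ : ℝ}
    (h : IsThreshold d β a b m) (hκ : 0 < κ) (hr : m < muR d β a b κ) :
    ∃ mκ, m < mκ ∧ mκ < muR d β a b κ ∧ (∀ μ < mκ, longCycleGain d β a b κ μ < 0) ∧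
      longCycleGain d β a b κ mκ = 0 ∧ ∀ μ > mκ, 0 < longCycleGain d β a b κ μ := by
  have ha := hb.trans hab
  -- Otherwise `κ` would be a peak at `m`, which forces `μ_r ≤ m`.
  have hlow : longCycleGain d β a b κ m < 0 := by
    by_contra! hcon
    unfold longCycleGain at hcon
    have hpeak : IsPeak d β a b m κ := by
      refine ⟨hκ, fun z hz => ?_⟩
      have : reducedFunctional d β a b m z ≤ reducedFunctional d β a b m 0 :=
        h.isMaxOn_zero m le_rfl hz
      simp only [mem_ofPred_eq]
      linarith
    exact absurd (hpeak.muR_le_of_le hd hβ hb hab hκ le_rfl) (not_le.2 hr)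
  -- At `μ_r` the peak sits exactly at `κ`.
  have hhigh : 0 < longCycleGain d β a b κ (muR d β a b κ) := by
    obtain ⟨y, hy⟩ := h.exists_isPeak hd hβ hb hab hr
    have hyκ := hy.eq_of_muR_eq hd hβ hb hab hκ
    subst hyκ
    obtain ⟨w, hw, hlt⟩ := h.lt_of_gt _ hr
    have : reducedFunctional d β a b (muR d β a b y) w ≤
        reducedFunctional d β a b (muR d β a b y) y := hy.isMaxOn (show w ∈ Ici 0 from hw.le)
    unfold longCycleGain
    linarith
  have hmono := longCycleGain_monotone (d := d) (b := b) hd hβ ha hκ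
  obtain ⟨mκ, ⟨h1, h2⟩, h3⟩ := intermediate_value_Ioo hr.le
    (continuous_longCycleGain (d := d) (b := b) hd hβ ha κ).continuousOn ⟨hlow, hhigh⟩
  refine ⟨mκ, h1, h2, fun μ hμ => ?_, h3, fun μ hμ => ?_⟩
  · have := longCycleGain_lt_of_nonpos hd hβ ha hb hκ hμ h3.le
    linarith
  · by_contra! hcon
    have := longCycleGain_lt_of_nonpos hd hβ ha hb hκ hμ hcon
    linarith

lemma IsThreshold.isTransition_of_lt_muR (hd : 1 ≤ d) (hβ : 0 < β) (hb : 0 < b) (hab : b < a)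
    {m κ mκ : ℝ} (h : IsThreshold d β a b m) (hκ : 0 < κ) (h1 : m < mκ) (h2 : mκ < muR d β a b κ)
    (hlow : ∀ μ < mκ, longCycleGain d β a b κ μ < 0)
    (hhigh : ∀ μ > mκ, 0 < longCycleGain d β a b κ μ) :
    IsTransition d β a b (ENNReal.ofReal κ) mκ := by
  have ha := hb.trans hab
  refine ⟨fun μ hμ => ?_, fun μ hμ => ?_⟩
  · have hg := hlow μ hμ
    have hmax := isMaxOn_zero_of_gain_nonpos hd hβ hb hab hκ (hμ.trans h2) hg.le
    refine ⟨_, zeroes_eq_singleton hd hβ ha (zero_mem_longDensities _) hmax fun y hy he => ?_⟩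
    refine (eq_zero_or_eq_of_lt_muR hd hβ hb hab hκ (hμ.trans h2) hy ?_).resolve_right ?_
    · intro z hz
      exact le_trans (hmax hz) he.ge
    · rintro rfl
      unfold longCycleGain at hg
      linarith
  · rcases lt_or_ge μ (muR d β a b κ) with hr | hr
    · have hg := hhigh μ hμ
      have hmax := isMaxOn_of_gain_nonneg hd hβ hb hab hκ hr hg.le
      refine ⟨_, κ, hκ, zeroes_eq_singleton hd hβ ha (mem_longDensities_self hκ) hmax
        fun y hy he => ?_⟩
      refine (eq_zero_or_eq_of_lt_muR hd hβ hb hab hκ hr hy ?_).resolve_left ?_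
      · intro z hz
        exact le_trans (hmax hz) he.ge
      · rintro rfl
        unfold longCycleGain at hg
        linarith
    · obtain ⟨y, hyκ, hy⟩ := h.exists_isPeak_mem hd hβ hb hab (h1.trans hμ) hκ hr
      exact h.zeroes_of_isPeak hd hβ hb hab (h1.trans hμ) hy hyκ

/-! ### Upper bound on the partition function -/

/-- A finite family of configurations lies in a finite box, where the sum factors into truncated
exponential series. Working with finite sums avoids presupposing summability. -/
lemma sum_finsupp_prod_le_exp {θ : ℕ+ → ℝ} (h0 : ∀ k, 0 ≤ θ k) (hθ : Summable θ)
    (F : Finset CycleCounts) :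
    ∑ N ∈ F, (N.prod fun k n => θ k ^ n / (n.factorial : ℝ)) ≤ Real.exp (∑' k, θ k) := by
  classical
  set J : Finset ℕ+ := F.biUnion fun N => N.support with hJ
  set M : ℕ := F.sup fun N => N.support.sup N with hM
  set t : ℕ+ → Finset ℕ := fun _ => Finset.range (M + 1) with ht
  have hsub : F ⊆ J.finsupp t := by
    intro N hN
    have hNJ : N.support ⊆ J := Finset.subset_biUnion_of_mem (fun N : CycleCounts => N.support) hN
    rw [Finset.mem_finsupp_iff]
    refine ⟨hNJ, fun k _ => ?_⟩
    rw [ht, Finset.mem_range, Nat.lt_succ_iff]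
    by_cases hk : k ∈ N.support
    · exact (Finset.le_sup (f := N) hk).trans
        (Finset.le_sup (f := fun N : CycleCounts => N.support.sup N) hN)
    · rw [Finsupp.notMem_support_iff.1 hk]
      exact Nat.zero_le _
  have hnn : ∀ N : CycleCounts, 0 ≤ N.prod fun k n => θ k ^ n / (n.factorial : ℝ) := fun N =>
    Finset.prod_nonneg fun k _ => div_nonneg (pow_nonneg (h0 k) _) (Nat.cast_nonneg _)
  calc ∑ N ∈ F, (N.prod fun k n => θ k ^ n / (n.factorial : ℝ))
      ≤ ∑ N ∈ J.finsupp t, (N.prod fun k n => θ k ^ n / (n.factorial : ℝ)) :=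
        Finset.sum_le_sum_of_subset_of_nonneg hsub fun N _ _ => hnn N
    _ = ∑ N ∈ J.finsupp t, ∏ k ∈ J, θ k ^ N k / ((N k).factorial : ℝ) := by
        refine Finset.sum_congr rfl fun N hN => ?_
        exact Finsupp.prod_of_support_subset N (Finset.mem_finsupp_iff.1 hN).1 _ (by simp)
    _ = ∏ k ∈ J, ∑ n ∈ t k, θ k ^ n / (n.factorial : ℝ) := by
        rw [Finset.prod_sum, Finset.finsupp, Finset.sum_map]
        refine Finset.sum_congr (by congr!) fun p _ => ?_
        rw [← Finset.prod_attach]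
        refine Finset.prod_congr rfl fun k _ => ?_
        simp
    _ ≤ ∏ k ∈ J, Real.exp (θ k) := by
        refine Finset.prod_le_prod (fun k _ => Finset.sum_nonneg fun n _ =>
          div_nonneg (pow_nonneg (h0 k) _) (Nat.cast_nonneg _)) fun k _ => ?_
        exact Real.sum_le_exp_of_nonneg (h0 k) _
    _ = Real.exp (∑ k ∈ J, θ k) := (Real.exp_sum J θ).symm
    _ ≤ Real.exp (∑' k, θ k) := Real.exp_le_exp.2 (hθ.sum_le_tsum J fun k _ => h0 k)

/-! ### Boltzmann weights split into short and long cycles -/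

/-- The unnormalised reference weight at `α = 0`. -/
noncomputable def refWeight (d : ℕ) (β V : ℝ) (N : CycleCounts) : ℝ :=
  N.prod fun k n => (V * cycleWeight d β k) ^ n / (n.factorial : ℝ)

/-- The density of particles. -/
noncomputable def particleDensity (V : ℝ) (N : CycleCounts) : ℝ :=
  N.sum fun k n => (k : ℝ) * ((n : ℝ) / V)

/-- The counter term of the Hamiltonian. -/
noncomputable def counterTerm (V : ℝ) (m : ℕ) (N : CycleCounts) : ℝ :=
  N.sum fun k n => if m ≤ (k : ℕ) then (k : ℝ) ^ 2 * ((n : ℝ) / V) ^ 2 else 0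

/-- The Boltzmann weight of a configuration of cycle counts. -/
noncomputable def boltzmannWeight (d : ℕ) (β μ a b V : ℝ) (m : ℕ) (N : CycleCounts) : ℝ :=
  refWeight d β V N * Real.exp (β * V * (μ * particleDensity V N -
    a / 2 * particleDensity V N ^ 2 + b / 2 * counterTerm V m N))

/-- The normalisation cancels, and the tilt `e^{βαk}` of the Poisson parameters cancels the `α` in
the Hamiltonian: the pressure does not depend on `α`. -/
lemma partitionFunction_eq {V : ℝ} (hV : 0 < V) (α μ : ℝ) (m : ℕ) :
    partitionFunction d β α μ a b V m = ∑' N, boltzmannWeight d β μ a b V m N := by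
  unfold partitionFunction refExpectation
  rw [← tsum_mul_left]
  refine tsum_congr fun N => ?_
  have h1 : (N.prod fun k n =>
      (V * cycleWeight d β k * Real.exp (β * α * k)) ^ n / (n.factorial : ℝ)) =
      refWeight d β V N * Real.exp (β * α * V * particleDensity V N) := by
    unfold refWeight particleDensity Finsupp.prod Finsupp.sum
    rw [Finset.mul_sum, Real.exp_sum, ← Finset.prod_mul_distrib]
    refine Finset.prod_congr rfl fun k _ => ?_
    dsimp only
    rw [mul_pow (V * cycleWeight d β k), ← Real.exp_nat_mul]
    have : β * α * V * ((k : ℝ) * ((N k : ℝ) / V)) = N k * (β * α * k) := by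
      field_simp
    rw [this]
    ring
  unfold refProb
  rw [h1, boltzmannWeight]
  have h2 : hamiltonian α μ a b V m N = V * (-(μ - α) * particleDensity V N +
    a / 2 * particleDensity V N ^ 2 - b / 2 * counterTerm V m N) := rfl
  dsimp only
  rw [h2, ← mul_assoc, ← mul_assoc, ← Real.exp_add, add_neg_cancel, Real.exp_zero, one_mul,
    mul_assoc, ← Real.exp_add]
  congr 2
  ring

lemma refWeight_pos (hβ : 0 < β) {V : ℝ} (hV : 0 < V) (N : CycleCounts) :
    0 < refWeight d β V N :=
  Finset.prod_pos fun k _ => div_pos (pow_pos (mul_pos hV (cycleWeight_pos d hβ k)) _)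
    (by exact_mod_cast Nat.factorial_pos _)

lemma boltzmannWeight_pos (hβ : 0 < β) {V : ℝ} (hV : 0 < V) (μ : ℝ) (m : ℕ) (N : CycleCounts) :
    0 < boltzmannWeight d β μ a b V m N :=
  mul_pos (refWeight_pos hβ hV N) (Real.exp_pos _)

/-- The number of particles in cycles of length at least `m`. -/
def longMass (m : ℕ) (N : CycleCounts) : ℕ := N.sum fun k n => if m ≤ (k : ℕ) then k * n else 0

/-- The number of particles in cycles of length less than `m`. -/
def shortMass (m : ℕ) (N : CycleCounts) : ℕ := N.sum fun k n => if m ≤ (k : ℕ) then 0 else k * n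

lemma particleDensity_eq (V : ℝ) (m : ℕ) (N : CycleCounts) :
    particleDensity V N = (shortMass m N : ℝ) / V + (longMass m N : ℝ) / V := by
  unfold particleDensity shortMass longMass Finsupp.sum
  rw [← add_div, ← Nat.cast_add, ← Finset.sum_add_distrib, Nat.cast_sum, Finset.sum_div]
  refine Finset.sum_congr rfl fun k _ => ?_
  dsimp only
  split_ifs <;> push_cast <;> ring

/-- A sum of squares is at most the square of the sum; little is lost, since one long cycle attains
equality. -/
lemma counterTerm_le (V : ℝ) (hV : 0 < V) (m : ℕ) (N : CycleCounts) :
    counterTerm V m N ≤ ((longMass m N : ℝ) / V) ^ 2 := by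
  unfold counterTerm longMass Finsupp.sum
  rw [Nat.cast_sum, Finset.sum_div]
  refine le_trans (le_of_eq ?_) (Finset.sum_sq_le_sq_sum_of_nonneg fun k _ => by positivity)
  refine Finset.sum_congr rfl fun k _ => ?_
  dsimp only
  split_ifs <;> push_cast <;> ring

/-- The finite-volume source of the gap in `{0} ∪ [κ, ∞)`. -/
lemma longMass_eq_zero_or_le (m : ℕ) (N : CycleCounts) : longMass m N = 0 ∨ m ≤ longMass m N := by
  by_cases h : ∃ k ∈ N.support, m ≤ (k : ℕ)
  · obtain ⟨k, hk, hm⟩ := h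
    right
    have h1 : (if m ≤ (k : ℕ) then (k : ℕ) * N k else 0) ≤ longMass m N :=
      Finset.single_le_sum (f := fun k : ℕ+ => if m ≤ (k : ℕ) then (k : ℕ) * N k else 0)
        (fun _ _ => Nat.zero_le _) hk
    rw [if_pos hm] at h1
    have h2 : 1 ≤ N k := Nat.one_le_iff_ne_zero.2 (Finsupp.mem_support_iff.1 hk)
    nlinarith
  · left
    push Not at h
    exact Finset.sum_eq_zero fun k hk => if_neg (not_le.2 (h k hk))

/-- The concave square in `x` lies below its tangent at the optimal density, so the energy becomes
linear in the number of short-cycle particles. -/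
lemma energy_le (hd : 1 ≤ d) (hβ : 0 < β) (ha : 0 < a) (b μ x y : ℝ) :
    μ * (x + y) - a / 2 * (x + y) ^ 2 + b / 2 * y ^ 2 ≤ reducedFunctional d β a b μ y +
      minimiser d β a (μ - a * y) * x - idealPressure d β (minimiser d β a (μ - a * y)) := by
  have h := isMinimiser_minimiser (d := d) hβ ha (μ - a * y)
  unfold reducedFunctional
  rw [h.pSub_eq hd hβ ha]
  set σ := minimiser d β a (μ - a * y)
  have h1 : (μ - a * y - σ) ^ 2 / (2 * a) + idealPressure d β σ + μ * y - (a - b) / 2 * y ^ 2 +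
      σ * x - idealPressure d β σ - (μ * (x + y) - a / 2 * (x + y) ^ 2 + b / 2 * y ^ 2) =
      a / 2 * (x - (μ - a * y - σ) / a) ^ 2 := by
    field_simp
    ring
  have h2 : 0 ≤ a / 2 * (x - (μ - a * y - σ) / a) ^ 2 := by positivity
  linarith

/-- The total weight of the cycles of length at least `m`. -/
noncomputable def tailWeight (d : ℕ) (β : ℝ) (m : ℕ) : ℝ :=
  ∑' k : ℕ+, if m ≤ (k : ℕ) then cycleWeight d β k else 0

lemma summable_tailWeight (hd : 1 ≤ d) (hβ : 0 < β) (m : ℕ) :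
    Summable fun k : ℕ+ => if m ≤ (k : ℕ) then cycleWeight d β k else 0 := by
  refine (summable_cycleWeight hd β).of_nonneg_of_le (fun k => ?_) fun k => ?_
  · split_ifs
    exacts [(cycleWeight_pos d hβ k).le, le_rfl]
  · split_ifs
    exacts [le_rfl, (cycleWeight_pos d hβ k).le]

lemma tendsto_tailWeight (hd : 1 ≤ d) (hβ : 0 < β) :
    Tendsto (tailWeight d β) atTop (𝓝 0) := by
  have := tendsto_tsum_of_dominated_convergence (𝓕 := atTop) (bound := cycleWeight d β)
    (f := fun (m : ℕ) (k : ℕ+) => if m ≤ (k : ℕ) then cycleWeight d β k else 0)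
    (g := fun _ => (0 : ℝ)) (summable_cycleWeight hd β) (fun k => ?_) (Eventually.of_forall
      fun m k => ?_)
  · rw [tsum_zero] at this
    exact this
  · refine tendsto_const_nhds.congr' ?_
    filter_upwards [eventually_gt_atTop (k : ℕ)] with m hm
    rw [if_neg (not_le.2 hm)]
  · have := cycleWeight_pos d hβ k
    split_ifs
    · rw [Real.norm_of_nonneg this.le]
    · simpa using this.le

/-- Only short cycles are tilted by `σ`; long ones keep weight `V q_k`, and their total is `o(V)` as
`m → ∞`. -/
lemma sum_short_le (hd : 1 ≤ d) (hβ : 0 < β) {V : ℝ} (hV : 0 < V) (m : ℕ) {σ : ℝ} (hσ : σ ≤ 0)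
    (F : Finset CycleCounts) :
    ∑ N ∈ F, refWeight d β V N * Real.exp (β * σ * shortMass m N) ≤
      Real.exp (β * V * idealPressure d β σ + V * tailWeight d β m) := by
  set θ : ℕ+ → ℝ := fun k => V * cycleWeight d β k *
    (if m ≤ (k : ℕ) then 1 else Real.exp (β * σ * k)) with hθ
  have hq := fun k => cycleWeight_pos d hβ k
  have h0 : ∀ k, 0 ≤ θ k := fun k => by
    refine mul_nonneg (mul_pos hV (hq k)).le ?_
    split_ifs
    exacts [zero_le_one, (Real.exp_pos _).le]
  set u : ℕ+ → ℝ := fun k => V * (cycleWeight d β k * Real.exp (β * σ * k)) +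
    V * (if m ≤ (k : ℕ) then cycleWeight d β k else 0) with hu
  have hle : ∀ k, θ k ≤ u k := fun k => by
    simp only [hθ, hu]
    split_ifs
    · have := mul_pos hV (mul_pos (hq k) (Real.exp_pos (β * σ * k)))
      linarith
    · simp [mul_assoc]
  have hs1 := (summable_cycleWeight_exp hd hβ hσ).mul_left V
  have hs2 := (summable_tailWeight hd hβ m).mul_left V
  have hsu : Summable u := hs1.add hs2
  have hsθ : Summable θ := hsu.of_nonneg_of_le h0 hle
  have hsum : ∑' k, θ k ≤ β * V * idealPressure d β σ + V * tailWeight d β m := by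
    refine (hsθ.tsum_le_tsum hle hsu).trans (le_of_eq ?_)
    rw [hs1.tsum_add hs2, tsum_mul_left, tsum_mul_left]
    unfold idealPressure totalWeight tailWeight
    field_simp
  refine le_trans (le_of_eq ?_) ((sum_finsupp_prod_le_exp h0 hsθ F).trans
    (Real.exp_le_exp.2 hsum))
  refine Finset.sum_congr rfl fun N _ => ?_
  unfold refWeight shortMass Finsupp.prod Finsupp.sum
  rw [Nat.cast_sum, Finset.mul_sum, Real.exp_sum, ← Finset.prod_mul_distrib]
  refine Finset.prod_congr rfl fun k _ => ?_
  simp only [hθ]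
  split_ifs
  · simp
  · rw [mul_pow (V * cycleWeight d β k), ← Real.exp_nat_mul]
    push_cast
    rw [show (N k : ℝ) * (β * σ * k) = β * σ * (k * N k) by ring]
    ring

/-- Group configurations by long mass `B` and use the minimiser belonging to `B`. Passing from `μ`
to `μ + η` releases a factor `e^{-βηB}`, which makes the sum over `B` geometric. -/
lemma sum_boltzmannWeight_le (hd : 1 ≤ d) (hβ : 0 < β) (ha : 0 < a) (hb : 0 < b) {V : ℝ}
    (hV : 0 < V) {μ η S : ℝ} (hη : 0 < η) {m : ℕ}
    (hS : ∀ y : ℝ, 0 ≤ y → (y = 0 ∨ (m : ℝ) / V ≤ y) → reducedFunctional d β a b (μ + η) y ≤ S)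
    (F : Finset CycleCounts) :
    ∑ N ∈ F, boltzmannWeight d β μ a b V m N ≤
      Real.exp (β * V * S + V * tailWeight d β m) * (1 - Real.exp (-(β * η)))⁻¹ := by
  classical
  set r := Real.exp (-(β * η)) with hr
  have hr0 : 0 ≤ r := (Real.exp_pos _).le
  have hr1 : r < 1 := by
    rw [hr, Real.exp_lt_one_iff]
    linarith [mul_pos hβ hη]
  set σ : ℕ → ℝ := fun B => minimiser d β a (μ + η - a * ((B : ℝ) / V)) with hσdef
  have hpoint : ∀ N : CycleCounts, boltzmannWeight d β μ a b V m N ≤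
      Real.exp (β * V * S - β * V * idealPressure d β (σ (longMass m N))) * r ^ longMass m N *
        (refWeight d β V N * Real.exp (β * σ (longMass m N) * shortMass m N)) := by
    intro N
    set B := longMass m N with hB
    set x : ℝ := (shortMass m N : ℝ) / V with hx
    set y : ℝ := (B : ℝ) / V with hy
    have hx0 : 0 ≤ x := by positivity
    have hy0 : 0 ≤ y := by positivity
    have hymem : y = 0 ∨ (m : ℝ) / V ≤ y := by
      rcases longMass_eq_zero_or_le m N with h | h
      · left
        rw [hy, hB, h]
        simp
      · right
        have : (m : ℝ) ≤ B := by exact_mod_cast h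
        rw [hy]
        gcongr
    have hT := hS y hy0 hymem
    have hE := energy_le (d := d) hd hβ ha b (μ + η) x y
    have hQ := counterTerm_le V hV m N
    have hρ := particleDensity_eq V m N
    rw [← hB, ← hx, ← hy] at hρ
    rw [← hB, ← hy] at hQ
    have hσ : σ B = minimiser d β a (μ + η - a * y) := rfl
    rw [← hσ] at hE
    have hexp : μ * particleDensity V N - a / 2 * particleDensity V N ^ 2 +
        b / 2 * counterTerm V m N ≤ S - idealPressure d β (σ B) - η * y + σ B * x := by
      rw [hρ]
      have h1 := mul_le_mul_of_nonneg_left hQ (show 0 ≤ b / 2 by positivity)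
      have h2 := mul_nonneg hη.le hx0
      linarith
    unfold boltzmannWeight
    calc _ ≤ refWeight d β V N *
          Real.exp (β * V * (S - idealPressure d β (σ B) - η * y + σ B * x)) := by
          refine mul_le_mul_of_nonneg_left (Real.exp_le_exp.2 ?_) (refWeight_pos hβ hV N).le
          exact mul_le_mul_of_nonneg_left hexp (mul_pos hβ hV).le
      _ = _ := by
          rw [hr, ← Real.exp_nat_mul]
          have h3 : β * V * (S - idealPressure d β (σ B) - η * y + σ B * x) =
              (β * V * S - β * V * idealPressure d β (σ B)) + (B : ℝ) * (-(β * η)) +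
                β * σ B * shortMass m N := by
            rw [hx, hy]
            field_simp
            ring
          rw [h3, Real.exp_add, Real.exp_add]
          ring
  have hfib : ∀ B : ℕ, ∑ N ∈ F with longMass m N = B, boltzmannWeight d β μ a b V m N ≤
      Real.exp (β * V * S + V * tailWeight d β m) * r ^ B := by
    intro B
    have hσ0 : σ B ≤ 0 := (isMinimiser_minimiser hβ ha _).nonpos
    calc ∑ N ∈ F with longMass m N = B, boltzmannWeight d β μ a b V m N
        ≤ ∑ N ∈ F with longMass m N = B,
          Real.exp (β * V * S - β * V * idealPressure d β (σ B)) * r ^ B *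
            (refWeight d β V N * Real.exp (β * σ B * shortMass m N)) := by
          refine Finset.sum_le_sum fun N hN => ?_
          have := hpoint N
          rwa [(Finset.mem_filter.1 hN).2] at this
      _ ≤ Real.exp (β * V * S - β * V * idealPressure d β (σ B)) * r ^ B *
          Real.exp (β * V * idealPressure d β (σ B) + V * tailWeight d β m) := by
          rw [← Finset.mul_sum]
          exact mul_le_mul_of_nonneg_left (sum_short_le hd hβ hV m hσ0 _) (by positivity)
      _ = _ := by
          rw [mul_right_comm, ← Real.exp_add]
          congr 2
          ring
  rw [← Finset.sum_fiberwise_of_maps_to (t := F.image (longMass m))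
    (fun N hN => Finset.mem_image_of_mem _ hN)]
  refine (Finset.sum_le_sum fun B _ => hfib B).trans ?_
  rw [← Finset.mul_sum]
  refine mul_le_mul_of_nonneg_left ?_ (Real.exp_pos _).le
  rw [← tsum_geometric_of_lt_one hr0 hr1]
  exact (summable_geometric_of_lt_one hr0 hr1).sum_le_tsum _ fun B _ => pow_nonneg hr0 B

lemma summable_boltzmannWeight (hd : 1 ≤ d) (hβ : 0 < β) (hb : 0 < b) (hab : b < a) {V : ℝ}
    (hV : 0 < V) (μ : ℝ) (m : ℕ) : Summable (boltzmannWeight d β μ a b V m) := by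
  have ha := hb.trans hab
  obtain ⟨y, -, hmax⟩ := exists_isMaxOn (d := d) hd hβ ha hab isClosed_Ici
    (nonempty_Ici (a := (0 : ℝ))) subset_rfl (μ + 1)
  exact summable_of_sum_le (fun N => (boltzmannWeight_pos hβ hV μ m N).le)
    (sum_boltzmannWeight_le hd hβ ha hb hV one_pos fun z hz _ => hmax hz)

lemma boltzmannWeight_le_partitionFunction (hd : 1 ≤ d) (hβ : 0 < β) (hb : 0 < b) (hab : b < a)
    {V : ℝ} (hV : 0 < V) (α μ : ℝ) (m : ℕ) (N : CycleCounts) :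
    boltzmannWeight d β μ a b V m N ≤ partitionFunction d β α μ a b V m := by
  rw [partitionFunction_eq hV]
  exact (summable_boltzmannWeight hd hβ hb hab hV μ m).le_tsum N
    fun N _ => (boltzmannWeight_pos hβ hV μ m N).le

lemma finitePressure_le (hd : 1 ≤ d) (hβ : 0 < β) (hb : 0 < b) (hab : b < a) {V : ℝ}
    (hV : 0 < V) (α : ℝ) {μ η S : ℝ} (hη : 0 < η) {m : ℕ}
    (hS : ∀ y : ℝ, 0 ≤ y → (y = 0 ∨ (m : ℝ) / V ≤ y) → reducedFunctional d β a b (μ + η) y ≤ S) :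
    finitePressure d β α μ a b V m ≤ S + tailWeight d β m / β +
      Real.log (1 - Real.exp (-(β * η)))⁻¹ / (β * V) := by
  have ha := hb.trans hab
  have hpos : 0 < partitionFunction d β α μ a b V m :=
    (boltzmannWeight_pos hβ hV μ m 0).trans_le
      (boltzmannWeight_le_partitionFunction hd hβ hb hab hV α μ m 0)
  have hle : partitionFunction d β α μ a b V m ≤
      Real.exp (β * V * S + V * tailWeight d β m) * (1 - Real.exp (-(β * η)))⁻¹ := by
    rw [partitionFunction_eq hV]
    exact (summable_boltzmannWeight hd hβ hb hab hV μ m).tsum_le_of_sum_le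
      (sum_boltzmannWeight_le hd hβ ha hb hV hη hS)
  have hr1 : Real.exp (-(β * η)) < 1 := by
    rw [Real.exp_lt_one_iff]
    linarith [mul_pos hβ hη]
  have hlog := Real.log_le_log hpos hle
  rw [Real.log_mul (Real.exp_pos _).ne' (inv_ne_zero (by linarith)), Real.log_exp] at hlog
  unfold finitePressure
  calc _ ≤ 1 / (β * V) * (β * V * S + V * tailWeight d β m +
        Real.log (1 - Real.exp (-(β * η)))⁻¹) := mul_le_mul_of_nonneg_left hlog (by positivity)
    _ = _ := by
      field_simp

/-! ### Entropy of cycle counts -/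

/-- Stirling's upper bound with logarithmic error; the induction rests on `(n+1) log((n+1)/n) ≥ 1`.
-/
lemma log_factorial_le {n : ℕ} (hn : 1 ≤ n) :
    Real.log n.factorial ≤ (n + 1) * Real.log n - n + 1 := by
  induction n, hn using Nat.le_induction with
  | base => simp
  | succ n hn ih =>
    have hn0 : (0 : ℝ) < n := by exact_mod_cast hn
    rw [Nat.factorial_succ, Nat.cast_mul, Real.log_mul (by positivity) (by positivity)]
    push_cast
    have h1 := Real.one_sub_inv_le_log_of_pos (show (0 : ℝ) < (n + 1) / n by positivity)
    rw [Real.log_div (by positivity) hn0.ne', inv_div] at h1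
    have h2 : (1 : ℝ) ≤ (n + 1) * (Real.log (n + 1) - Real.log n) := by
      calc (1 : ℝ) = (n + 1) * (1 - n / (n + 1)) := by
            field_simp
            ring
        _ ≤ _ := mul_le_mul_of_nonneg_left h1 (by positivity)
    linarith

/-- The entropy of a density `t` of cycles of weight `q`. -/
noncomputable def cycleEntropy (q t : ℝ) : ℝ := t + t * Real.log q - t * Real.log t

lemma tendsto_log_div_atTop : Tendsto (fun x : ℝ => Real.log x / x) atTop (𝓝 0) :=
  Real.isLittleO_log_id_atTop.tendsto_div_nhds_zero

lemma eventually_cycleEntropy_le {q t ε : ℝ} (hq : 0 < q) (ht : 0 ≤ t) (hε : 0 < ε) :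
    ∀ᶠ V : ℝ in atTop, cycleEntropy q t - ε ≤
      Real.log ((V * q) ^ ⌊t * V⌋₊ / (⌊t * V⌋₊.factorial : ℝ)) / V := by
  rcases ht.eq_or_lt with rfl | ht
  · refine Eventually.of_forall fun V => ?_
    simp [cycleEntropy, hε.le]
  have hfl : Tendsto (fun V : ℝ => (⌊t * V⌋₊ : ℝ) / V) atTop (𝓝 t) :=
    tendsto_nat_floor_mul_div_atTop ht.le
  have hflat : Tendsto (fun V : ℝ => (⌊t * V⌋₊ : ℝ)) atTop atTop :=
    tendsto_natCast_atTop_atTop.comp (tendsto_nat_floor_atTop.comp (tendsto_id.const_mul_atTop ht))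
  have hlogfl : Tendsto (fun V : ℝ => Real.log (⌊t * V⌋₊ : ℝ) / V) atTop (𝓝 0) := by
    have := (tendsto_log_div_atTop.comp hflat).mul hfl
    rw [zero_mul] at this
    refine this.congr' ?_
    filter_upwards [hflat.eventually_gt_atTop 0] with V hV
    simp only [Function.comp_apply]
    field_simp
  have hinv : Tendsto (fun V : ℝ => 1 / V) atTop (𝓝 0) := by
    simpa using tendsto_inv_atTop_zero (𝕜 := ℝ)
  have hlim : Tendsto (fun V : ℝ => (⌊t * V⌋₊ : ℝ) / V + (⌊t * V⌋₊ : ℝ) / V * Real.log q -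
      (⌊t * V⌋₊ : ℝ) / V * Real.log ((⌊t * V⌋₊ : ℝ) / V) - Real.log (⌊t * V⌋₊ : ℝ) / V - 1 / V)
      atTop (𝓝 (cycleEntropy q t - 0 - 0)) :=
    (((hfl.add (hfl.mul_const _)).sub (hfl.mul (hfl.log ht.ne'))).sub hlogfl).sub hinv
  rw [sub_zero, sub_zero] at hlim
  filter_upwards [hlim.eventually (lt_mem_nhds (show cycleEntropy q t - ε < cycleEntropy q t by
    linarith)), hflat.eventually_ge_atTop 1, eventually_gt_atTop 0] with V h1 h2 h3
  refine h1.le.trans ?_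
  have hn : 1 ≤ ⌊t * V⌋₊ := by exact_mod_cast h2
  set n := ⌊t * V⌋₊
  have hn0 : (0 : ℝ) < n := by linarith
  rw [Real.log_div (x := (V * q) ^ n) (by positivity) (by positivity), Real.log_pow,
    Real.log_mul h3.ne' hq.ne', Real.log_div hn0.ne' h3.ne', le_div_iff₀ h3]
  have h4 := log_factorial_le hn
  have h5 : ((n : ℝ) / V + n / V * Real.log q - n / V * (Real.log n - Real.log V) -
      Real.log n / V - 1 / V) * V =
      n + n * Real.log q - n * (Real.log n - Real.log V) - Real.log n - 1 := by
    field_simp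
  rw [h5]
  linarith

lemma log_cycleWeight (hβ : 0 < β) (k : ℕ+) : Real.log (cycleWeight d β k) =
    -Real.log ((4 * Real.pi * β) ^ ((d : ℝ) / 2)) - (1 + (d : ℝ) / 2) * Real.log k := by
  unfold cycleWeight
  have := Real.pi_pos
  have hk : (0 : ℝ) < k := by exact_mod_cast k.pos
  rw [one_div, Real.log_inv, Real.log_mul (by positivity) (by positivity), Real.log_rpow hk]
  ring

lemma tendsto_pnat_cast_atTop : Tendsto (fun k : ℕ+ => (k : ℝ)) atTop atTop := by
  refine tendsto_atTop.2 fun x => ?_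
  filter_upwards [eventually_ge_atTop (⌈x⌉₊.succPNat)] with k hk
  have h1 : (⌈x⌉₊ : ℝ) + 1 ≤ k := by
    have : ((⌈x⌉₊.succPNat : ℕ+) : ℕ) ≤ k := by exact_mod_cast hk
    rw [Nat.succPNat_coe] at this
    exact_mod_cast this
  linarith [Nat.le_ceil x]

/-- Finitely many short cycles of total density `x` realise the free energy up to `ε`. -/
lemma exists_cycleEntropy_ge (hd : 1 ≤ d) (hβ : 0 < β) {σ x ε : ℝ} (hσ : σ ≤ 0)
    (h1 : σ < 0 → idealDensity d β σ = x) (h2 : σ = 0 → ∀ s < 0, idealDensity d β s ≤ x)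
    (hε : 0 < ε) : ∃ (J : Finset ℕ+) (t : ℕ+ → ℝ), (∀ k ∈ J, 0 ≤ t k) ∧ ∑ k ∈ J, k * t k = x ∧
      β * (idealPressure d β σ - σ * x) - ε ≤ ∑ k ∈ J, cycleEntropy (cycleWeight d β k) (t k) := by
  set w : ℕ+ → ℝ := fun k => cycleWeight d β k * Real.exp (β * σ * k) with hw
  have hq := fun k => cycleWeight_pos d hβ k
  have hwpos : ∀ k, 0 < w k := fun k => mul_pos (hq k) (Real.exp_pos _)
  have hIio : Tendsto (fun K : ℕ+ => Finset.Iio K) atTop atTop := by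
    refine tendsto_atTop_finset_of_monotone (fun K L h => Finset.Iio_subset_Iio h) fun k => ?_
    exact ⟨k + 1, Finset.mem_Iio.2 (PNat.lt_add_right k 1)⟩
  have hsw : HasSum w (β * idealPressure d β σ) := by
    have h := (summable_cycleWeight_exp hd hβ hσ).hasSum
    have h3 : β * idealPressure d β σ = totalWeight d β σ := by
      unfold idealPressure
      field_simp
    rw [h3]
    exact h
  have hmass : ∀ J : Finset ℕ+, ∑ k ∈ J, (k : ℝ) * w k ≤ x := by
    intro J
    rcases hσ.lt_or_eq with h0 | h0
    · rw [← h1 h0]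
      simp only [hw, ← mul_assoc]
      exact (summable_density_term d hβ h0).sum_le_tsum J fun k _ => by
        have := hq k
        positivity
    · simpa [hw, h0] using sum_mul_cycleWeight_le d hβ (h2 h0) J
  have hσmass : Tendsto (fun K : ℕ+ => -(β * σ) * ∑ k ∈ Finset.Iio K, (k : ℝ) * w k) atTop
      (𝓝 (-(β * σ) * x)) := by
    -- At `σ = 0` the masses need not tend to `x`, but the prefactor vanishes.
    rcases hσ.lt_or_eq with h0 | h0
    · refine Tendsto.const_mul _ ?_
      have h := (summable_density_term d hβ h0).hasSum
      rw [show ∑' k : ℕ+, (k : ℝ) * cycleWeight d β k * Real.exp (β * σ * k) = x from h1 h0] at h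
      have h3 := Tendsto.comp h hIio
      simpa only [Function.comp_def, hw, ← mul_assoc] using h3
    · simp [h0]
  have hlogq : Tendsto (fun K : ℕ+ => Real.log (cycleWeight d β K) / K) atTop (𝓝 0) := by
    have h3 : Tendsto (fun K : ℕ+ => Real.log (K : ℝ) / K) atTop (𝓝 0) :=
      tendsto_log_div_atTop.comp tendsto_pnat_cast_atTop
    have h4 := (tendsto_pnat_cast_atTop.const_div_atTop
      (-Real.log ((4 * Real.pi * β) ^ ((d : ℝ) / 2)))).sub (h3.const_mul (1 + (d : ℝ) / 2))
    rw [mul_zero, sub_zero] at h4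
    refine h4.congr fun K => ?_
    rw [log_cycleWeight hβ]
    ring
  have hlim : Tendsto (fun K : ℕ+ => ∑ k ∈ Finset.Iio K, w k +
      -(β * σ) * ∑ k ∈ Finset.Iio K, (k : ℝ) * w k -
        x * |Real.log (cycleWeight d β K) / K|) atTop
      (𝓝 (β * idealPressure d β σ + -(β * σ) * x - x * |0|)) :=
    ((Tendsto.comp hsw hIio).add hσmass).sub (hlogq.abs.const_mul x)
  rw [abs_zero, mul_zero, sub_zero] at hlim
  obtain ⟨K, hK, hKx⟩ := ((hlim.eventually (lt_mem_nhds (show β * idealPressure d β σ +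
    -(β * σ) * x - ε < _ by linarith))).and (tendsto_pnat_cast_atTop.eventually_ge_atTop x)).exists
  have hK0 : (0 : ℝ) < K := by exact_mod_cast K.pos
  set r := x - ∑ k ∈ Finset.Iio K, (k : ℝ) * w k with hr
  have hr0 : 0 ≤ r := by linarith [hmass (Finset.Iio K)]
  have hrx : r ≤ x := by
    have : 0 ≤ ∑ k ∈ Finset.Iio K, (k : ℝ) * w k :=
      Finset.sum_nonneg fun k _ => mul_nonneg (by positivity) (hwpos k).le
    linarith
  have hnot : K ∉ Finset.Iio K := by simp
  -- The ideal profile `w` is used below `K`, and the missing mass `r`, including any condensate,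
  -- goes into cycles of length `K`. Its entropy cost `r |log q_K| / K` tends to `0`.
  set t : ℕ+ → ℝ := fun k => if k < K then w k else r / K with ht
  have htK : t K = r / K := by simp [ht]
  have htlt : ∀ k ∈ Finset.Iio K, t k = w k := fun k hk => by
    rw [ht]
    exact if_pos (Finset.mem_Iio.1 hk)
  refine ⟨insert K (Finset.Iio K), t, fun k _ => ?_, ?_, ?_⟩
  · simp only [ht]
    split_ifs
    exacts [(hwpos k).le, by positivity]
  · rw [Finset.sum_insert hnot, htK, Finset.sum_congr rfl fun k hk => by rw [htlt k hk], hr]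
    field_simp
    ring
  · rw [Finset.sum_insert hnot, htK]
    have h3 : ∑ k ∈ Finset.Iio K, cycleEntropy (cycleWeight d β k) (t k) =
        ∑ k ∈ Finset.Iio K, w k + -(β * σ) * ∑ k ∈ Finset.Iio K, (k : ℝ) * w k := by
      rw [Finset.mul_sum, ← Finset.sum_add_distrib]
      refine Finset.sum_congr rfl fun k hk => ?_
      rw [htlt k hk]
      unfold cycleEntropy
      have : Real.log (w k) = Real.log (cycleWeight d β k) + β * σ * k := by
        rw [hw]
        simp only
        rw [Real.log_mul (hq k).ne' (Real.exp_pos _).ne', Real.log_exp]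
      rw [this]
      ring
    have h4 : -(x * |Real.log (cycleWeight d β K) / K|) ≤
        cycleEntropy (cycleWeight d β K) (r / K) := by
      unfold cycleEntropy
      have ht0 : 0 ≤ r / K := by positivity
      -- As `K ≥ x`, the term `-t log t` is nonnegative and can be dropped.
      have ht1 : r / K ≤ 1 := by
        rw [div_le_one hK0]
        linarith
      have h5 : r / K * Real.log (r / K) ≤ 0 :=
        mul_nonpos_of_nonneg_of_nonpos ht0 (Real.log_nonpos ht0 ht1)
      have h6 : -(x * |Real.log (cycleWeight d β K) / K|) ≤
          r / K * Real.log (cycleWeight d β K) := by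
        have h7 : r / K * Real.log (cycleWeight d β K) =
            r * (Real.log (cycleWeight d β K) / K) := by ring
        rw [h7]
        have h8 := mul_le_mul_of_nonneg_left
          (neg_abs_le (Real.log (cycleWeight d β K) / K)) hr0
        have h9 := mul_le_mul_of_nonneg_right hrx (abs_nonneg (Real.log (cycleWeight d β K) / K))
        linarith
      linarith
    rw [h3]
    linarith

/-! ### Lower bound on the partition function -/

/-- `⌊V t_k⌋` cycles of each length `k ∈ J`. -/
noncomputable def shortCounts (J : Finset ℕ+) (t : ℕ+ → ℝ) (V : ℝ) : CycleCounts :=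
  Finsupp.indicator J fun k _ => ⌊t k * V⌋₊

lemma disjoint_support_single {J : Finset ℕ+} (t : ℕ+ → ℝ) (V : ℝ) {l : ℕ+} (hl : l ∉ J) (j : ℕ) :
    Disjoint (shortCounts J t V).support (Finsupp.single l j).support := by
  refine Disjoint.mono (Finsupp.support_indicator_subset _ _) Finsupp.support_single_subset ?_
  simpa using hl

lemma log_refWeight (hβ : 0 < β) {J : Finset ℕ+} (t : ℕ+ → ℝ) {V : ℝ} (hV : 0 < V) {l : ℕ+}
    (hl : l ∉ J) {j : ℕ} (hj : j ≤ 1) :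
    Real.log (refWeight d β V (shortCounts J t V + Finsupp.single l j)) =
      ∑ k ∈ J, Real.log ((V * cycleWeight d β k) ^ ⌊t k * V⌋₊ / (⌊t k * V⌋₊.factorial : ℝ)) +
        j * Real.log (V * cycleWeight d β l) := by
  have hq := fun k => mul_pos hV (cycleWeight_pos d hβ k)
  unfold refWeight
  rw [Finsupp.prod_add_index_of_disjoint (disjoint_support_single t V hl j),
    Finsupp.prod_single_index (by simp), shortCounts, Finsupp.prod_indicator_index _ (by simp)]
  have hprod : ∀ k ∈ J, (V * cycleWeight d β k) ^ ⌊t k * V⌋₊ / (⌊t k * V⌋₊.factorial : ℝ) ≠ 0 :=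
    fun k _ => div_ne_zero (pow_ne_zero _ (hq k).ne') (by positivity)
  have hfac : (j.factorial : ℝ) = 1 := by
    interval_cases j <;> simp
  rw [Real.log_mul (Finset.prod_ne_zero_iff.2 hprod) (by have := (hq l).ne'; positivity),
    Real.log_prod hprod, hfac, div_one, Real.log_pow]

lemma particleDensity_shortCounts_add {J : Finset ℕ+} (t : ℕ+ → ℝ) (V : ℝ) {l : ℕ+} (hl : l ∉ J)
    (j : ℕ) : particleDensity V (shortCounts J t V + Finsupp.single l j) =
      ∑ k ∈ J, (k : ℝ) * ((⌊t k * V⌋₊ : ℝ) / V) + l * ((j : ℝ) / V) := by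
  unfold particleDensity
  rw [Finsupp.sum_add_index_of_disjoint (disjoint_support_single t V hl j),
    Finsupp.sum_single_index (by simp), shortCounts, Finsupp.sum_indicator_index _ (by simp)]

lemma le_counterTerm {J : Finset ℕ+} (t : ℕ+ → ℝ) (V : ℝ) {l : ℕ+} (hl : l ∉ J) (j : ℕ) {m : ℕ}
    (hm : m ≤ l) : (l * ((j : ℝ) / V)) ^ 2 ≤
      counterTerm V m (shortCounts J t V + Finsupp.single l j) := by
  unfold counterTerm
  rw [Finsupp.sum_add_index_of_disjoint (disjoint_support_single t V hl j),
    Finsupp.sum_single_index (by simp), if_pos hm, mul_pow]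
  refine le_add_of_nonneg_left (Finset.sum_nonneg fun k _ => ?_)
  dsimp only
  split_ifs <;> positivity

/-- Lower bound on the pressure from one long cycle and finitely many lengths of short cycles. -/
lemma eventually_le_finitePressure (hd : 1 ≤ d) (hβ : 0 < β) (hb : 0 < b) (hab : b < a) (α μ : ℝ)
    {V : ℕ → ℝ} (hV : Tendsto V atTop atTop) {m : ℕ → ℕ} {l : ℕ → ℕ+} (hml : ∀ n, m n ≤ l n)
    (hl : Tendsto (fun n => (l n : ℝ)) atTop atTop) {j : ℕ} (hj : j ≤ 1) {y : ℝ}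
    (hly : Tendsto (fun n => (l n : ℝ) * ((j : ℝ) / V n)) atTop (𝓝 y)) {J : Finset ℕ+}
    {t : ℕ+ → ℝ} (ht : ∀ k ∈ J, 0 ≤ t k) {x : ℝ} (hx : ∑ k ∈ J, k * t k = x) {ε : ℝ}
    (hε : 0 < ε) : ∀ᶠ n in atTop, μ * (x + y) - a / 2 * (x + y) ^ 2 + b / 2 * y ^ 2 +
      (∑ k ∈ J, cycleEntropy (cycleWeight d β k) (t k)) / β - ε ≤
        finitePressure d β α μ a b (V n) (m n) := by
  have hq := fun k => cycleWeight_pos d hβ k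
  have hV0 : ∀ᶠ n in atTop, 0 < V n := hV.eventually_gt_atTop 0
  have hρ : Tendsto (fun n => ∑ k ∈ J, (k : ℝ) * ((⌊t k * V n⌋₊ : ℝ) / V n) +
      l n * ((j : ℝ) / V n)) atTop (𝓝 (x + y)) := by
    rw [← hx]
    refine (tendsto_finsetSum J fun k hk => ?_).add hly
    exact ((tendsto_nat_floor_mul_div_atTop (ht k hk)).comp hV).const_mul _
  have hlog : Tendsto (fun n => (j : ℝ) * Real.log (V n * cycleWeight d β (l n)) / V n) atTop
      (𝓝 0) := by
    have h1 : Tendsto (fun n => Real.log (V n) / V n) atTop (𝓝 0) := tendsto_log_div_atTop.comp hV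
    have h2 : Tendsto (fun n => Real.log (l n) / l n) atTop (𝓝 0) := tendsto_log_div_atTop.comp hl
    -- The long cycle has no entropy on the scale `V`: `j log l / V = (log l / l) (j l / V)` tends
    -- to `0`.
    have h3 := (h1.const_mul (j : ℝ)).add (((hV.const_div_atTop
      (-Real.log ((4 * Real.pi * β) ^ ((d : ℝ) / 2)))).const_mul (j : ℝ)).sub
        ((h2.mul hly).const_mul (1 + (d : ℝ) / 2)))
    simp only [mul_zero, zero_mul, sub_zero, add_zero] at h3
    refine h3.congr' ?_
    filter_upwards [hV0] with n hn
    rw [Real.log_mul hn.ne' (hq _).ne', log_cycleWeight hβ]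
    have hl0 : (l n : ℝ) ≠ 0 := by
      have : (0 : ℝ) < l n := by exact_mod_cast (l n).pos
      exact this.ne'
    field_simp
  have hE : Tendsto (fun n => μ * (∑ k ∈ J, (k : ℝ) * ((⌊t k * V n⌋₊ : ℝ) / V n) +
      l n * ((j : ℝ) / V n)) - a / 2 * (∑ k ∈ J, (k : ℝ) * ((⌊t k * V n⌋₊ : ℝ) / V n) +
      l n * ((j : ℝ) / V n)) ^ 2 + b / 2 * (l n * ((j : ℝ) / V n)) ^ 2 +
      ((j : ℝ) * Real.log (V n * cycleWeight d β (l n)) / V n) / β) atTop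
      (𝓝 (μ * (x + y) - a / 2 * (x + y) ^ 2 + b / 2 * y ^ 2 + 0 / β)) :=
    (((hρ.const_mul μ).sub ((hρ.pow 2).const_mul _)).add ((hly.pow 2).const_mul _)).add
      (hlog.div_const β)
  -- The error is shared among the lengths in `J`; adding `1` keeps the divisor positive when `J` is
  -- empty.
  set c : ℝ := (J.card : ℝ) + 1 with hc
  have hc0 : 0 < c := by positivity
  have hent : ∀ᶠ n in atTop, ∀ k ∈ J, cycleEntropy (cycleWeight d β k) (t k) - β * ε / 2 / c ≤
      Real.log ((V n * cycleWeight d β k) ^ ⌊t k * V n⌋₊ / (⌊t k * V n⌋₊.factorial : ℝ)) / V n := by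
    rw [Filter.eventually_all_finset]
    intro k hk
    exact hV.eventually (eventually_cycleEntropy_le (hq k) (ht k hk) (by positivity))
  have hnotin : ∀ᶠ n in atTop, l n ∉ J := by
    have h1 : ∀ᶠ n in atTop, ∀ k ∈ J, (k : ℝ) < l n := by
      rw [Filter.eventually_all_finset]
      exact fun k _ => hl.eventually_gt_atTop _
    filter_upwards [h1] with n hn hmem
    exact lt_irrefl _ (hn _ hmem)
  filter_upwards [hV0, hent, hnotin, hE.eventually (lt_mem_nhds (show μ * (x + y) -
    a / 2 * (x + y) ^ 2 + b / 2 * y ^ 2 - ε / 2 < _ by rw [zero_div]; linarith))]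
    with n hn hentn hln hEn
  have hpos := boltzmannWeight_pos (d := d) (a := a) (b := b) hβ hn μ (m n)
    (shortCounts J t (V n) + Finsupp.single (l n) j)
  have hle := Real.log_le_log hpos
    (boltzmannWeight_le_partitionFunction hd hβ hb hab hn α μ (m n) _)
  rw [boltzmannWeight, Real.log_mul (refWeight_pos hβ hn _).ne' (Real.exp_pos _).ne', Real.log_exp,
    log_refWeight hβ t hn hln hj, particleDensity_shortCounts_add t (V n) hln j] at hle
  have hQ := le_counterTerm t (V n) hln j (hml n)
  set ρ := ∑ k ∈ J, (k : ℝ) * ((⌊t k * V n⌋₊ : ℝ) / V n) + l n * ((j : ℝ) / V n)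
  set Q := counterTerm (V n) (m n) (shortCounts J t (V n) + Finsupp.single (l n) j)
  have hentsum : (∑ k ∈ J, cycleEntropy (cycleWeight d β k) (t k)) - β * ε / 2 ≤
      (∑ k ∈ J, Real.log ((V n * cycleWeight d β k) ^ ⌊t k * V n⌋₊ /
        (⌊t k * V n⌋₊.factorial : ℝ))) / V n := by
    have h1 := Finset.sum_le_sum hentn
    rw [Finset.sum_sub_distrib, Finset.sum_const, nsmul_eq_mul, ← Finset.sum_div] at h1
    have h2 : (J.card : ℝ) * (β * ε / 2 / c) ≤ β * ε / 2 := by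
      rw [mul_div_assoc', div_le_iff₀ hc0, mul_comm]
      refine mul_le_mul_of_nonneg_left ?_ (by positivity)
      linarith
    linarith
  set L := ∑ k ∈ J, Real.log ((V n * cycleWeight d β k) ^ ⌊t k * V n⌋₊ /
        (⌊t k * V n⌋₊.factorial : ℝ))
  set X := (j : ℝ) * Real.log (V n * cycleWeight d β (l n))
  unfold finitePressure
  have hfin : L / V n / β + X / V n / β + (μ * ρ - a / 2 * ρ ^ 2 + b / 2 * Q) ≤
      1 / (β * V n) * Real.log (partitionFunction d β α μ a b (V n) (m n)) := by
    refine le_trans (le_of_eq ?_) (mul_le_mul_of_nonneg_left hle (by positivity))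
    field_simp
  have h3 := div_le_div_of_nonneg_right hentsum hβ.le
  rw [sub_div, show β * ε / 2 / β = ε / 2 by field_simp] at h3
  have h4 := mul_le_mul_of_nonneg_left hQ (show 0 ≤ b / 2 by positivity)
  linarith

/-! ### The thermodynamic limit -/

/-- An upper bound on the admissible densities for `κ` extends to nearby restrictions. -/
lemma eventually_reducedFunctional_le (hd : 1 ≤ d) (hβ : 0 < β) (ha : 0 < a) (hab : b < a)
    {μ S ε : ℝ} {κ : ℝ≥0∞} (hS : ∀ y ∈ longDensities κ, reducedFunctional d β a b μ y ≤ S)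
    (hε : 0 < ε) {r : ℕ → ℝ} (hr : Tendsto (fun n => ENNReal.ofReal (r n)) atTop (𝓝 κ)) :
    ∀ᶠ n in atTop, ∀ y : ℝ, 0 ≤ y → (y = 0 ∨ r n ≤ y) →
      reducedFunctional d β a b μ y ≤ S + ε := by
  have h0 : reducedFunctional d β a b μ 0 ≤ S := hS 0 (zero_mem_longDensities κ)
  rcases eq_or_ne κ ⊤ with rfl | hκ
  -- For `κ = ∞` the allowed positive densities eventually exceed any `R`, where `T` has fallen
  -- below `S`.
  · obtain ⟨R, hR⟩ := eventually_atTop.1 (tendsto_atBot.1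
      (tendsto_reducedFunctional (d := d) hd hβ ha hab μ) S)
    have hev : ∀ᶠ n in atTop, ENNReal.ofReal (max R 0) < ENNReal.ofReal (r n) :=
      hr.eventually (lt_mem_nhds ENNReal.ofReal_lt_top)
    filter_upwards [hev] with n hn y hy hy'
    rcases hy' with rfl | hy'
    · linarith
    · have h1 : max R 0 < r n := (ENNReal.ofReal_lt_ofReal_iff_of_nonneg (le_max_right _ _)).1 hn
      have := hR y ((le_max_left R 0).trans (h1.le.trans hy'))
      linarith
  · set k := κ.toReal with hk
    have hκk : κ = ENNReal.ofReal k := (ENNReal.ofReal_toReal hκ).symm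
    have hk0 : 0 ≤ k := ENNReal.toReal_nonneg
    have hcont := continuous_reducedFunctional (d := d) hd hβ ha b μ
    have hTk : reducedFunctional d β a b μ k < S + ε := by
      have := hS k ⟨hk0, Or.inr hκk.le⟩
      linarith
    -- Since `m / V` may lie slightly below `κ`, the bound is extended to the left of `κ` by
    -- continuity.
    obtain ⟨δ, hδ, hδ'⟩ := Metric.eventually_nhds_iff.1
      (hcont.continuousAt.eventually (gt_mem_nhds hTk))
    have hTy : ∀ y, k - δ < y → 0 ≤ y → reducedFunctional d β a b μ y ≤ S + ε := by
      intro y hy hy0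
      rcases le_or_gt k y with h | h
      · have := hS y ⟨hy0, Or.inr (hκk ▸ ENNReal.ofReal_le_ofReal h)⟩
        linarith
      · refine (hδ' ?_).le
        rw [Real.dist_eq, abs_sub_comm, abs_of_pos (by linarith)]
        linarith
    rcases lt_or_ge (k - δ) 0 with hneg | hpos
    · exact Eventually.of_forall fun n y hy _ => hTy y (by linarith) hy
    · have hlt : ENNReal.ofReal (k - δ) < κ := by
        rw [hκk, ENNReal.ofReal_lt_ofReal_iff_of_nonneg hpos]
        linarith
      filter_upwards [hr.eventually (lt_mem_nhds hlt)] with n hn y hy hy'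
      rcases hy' with rfl | hy'
      · linarith
      · have h1 : k - δ < r n := (ENNReal.ofReal_lt_ofReal_iff_of_nonneg hpos).1 hn
        exact hTy y (by linarith) hy

/-- The pressures converge to the maximum of the reduced functional. -/
lemma tendsto_finitePressure (hd : 1 ≤ d) (hβ : 0 < β) (hb : 0 < b) (hab : b < a) (α : ℝ) {μ : ℝ}
    {κ : ℝ≥0∞} {y : ℝ} (hy : y ∈ longDensities κ)
    (hmax : IsMaxOn (reducedFunctional d β a b μ) (longDensities κ) y) {V : ℕ → ℝ}
    (hV : Tendsto V atTop atTop) {m : ℕ → ℕ} (hm : Tendsto m atTop atTop)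
    (hr : Tendsto (fun n => ENNReal.ofReal ((m n : ℝ) / V n)) atTop (𝓝 κ)) :
    Tendsto (fun n => finitePressure d β α μ a b (V n) (m n)) atTop
      (𝓝 (reducedFunctional d β a b μ y)) := by
  have ha := hb.trans hab
  have hV0 : ∀ᶠ n in atTop, 0 < V n := hV.eventually_gt_atTop 0
  rw [tendsto_order]
  constructor
  · intro p hp
    set ε := (reducedFunctional d β a b μ y - p) / 3 with hε
    have hε0 : 0 < ε := by
      rw [hε]
      linarith
    have hmin := isMinimiser_minimiser (d := d) hβ ha (μ - a * y)
    set x := optimalDensity d β a (μ - a * y) with hx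
    have hx0 : 0 ≤ x := optimalDensity_nonneg hβ ha _
    obtain ⟨J, t, ht, hJx, hent⟩ := exists_cycleEntropy_ge (x := x) hd hβ hmin.nonpos
      (hmin.eq_density ha) (hmin.le_density ha) (mul_pos hβ hε0)
    have hG := pressureFunctional_optimalDensity hd hβ ha b μ y
    rw [← hx] at hG
    simp only [pressureFunctional] at hG
    rw [freeEnergy_eq hd hβ hx0 hmin.nonpos (hmin.eq_density ha) (hmin.le_density ha)] at hG
    set σ := minimiser d β a (μ - a * y)
    have hent' : idealPressure d β σ - σ * x - ε ≤
        (∑ k ∈ J, cycleEntropy (cycleWeight d β k) (t k)) / β := by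
      rw [le_div_iff₀ hβ]
      linarith
    obtain ⟨l, j, hj, hml, hl, hly⟩ : ∃ (l : ℕ → ℕ+) (j : ℕ), j ≤ 1 ∧ (∀ n, m n ≤ l n) ∧
        Tendsto (fun n => (l n : ℝ)) atTop atTop ∧
        Tendsto (fun n => (l n : ℝ) * ((j : ℝ) / V n)) atTop (𝓝 y) := by
      -- The long cycle must have length at least `m` and density near `y`. For `y > 0`,
      -- admissibility gives `κ ≤ y`, so the maximum still yields `l / V → y`; for `y = 0` no long
      -- cycle is used (`j = 0`).
      set l : ℕ → ℕ+ := fun n => (max (m n) ⌈y * V n⌉₊).succPNat with hldef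
      have hlcoe : ∀ n, (l n : ℝ) = max (m n : ℝ) ⌈y * V n⌉₊ + 1 := fun n => by
        simp [hldef]
      have hml : ∀ n, m n ≤ l n := fun n => by
        rw [hldef]
        simp only [Nat.succPNat_coe]
        exact (le_max_left _ _).trans (Nat.le_succ _)
      have hl : Tendsto (fun n => (l n : ℝ)) atTop atTop :=
        tendsto_atTop_mono (fun n => (by exact_mod_cast hml n : (m n : ℝ) ≤ l n))
          (tendsto_natCast_atTop_atTop.comp hm)
      rcases hy.1.eq_or_lt with h0 | h0
      · exact ⟨l, 0, zero_le_one, hml, hl, by simp [← h0]⟩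
      · refine ⟨l, 1, le_rfl, hml, hl, ?_⟩
        have hκy : κ ≤ ENNReal.ofReal y := hy.2.resolve_left h0.ne'
        have hκtop : κ ≠ ⊤ := ne_top_of_le_ne_top ENNReal.ofReal_ne_top hκy
        have hk : κ.toReal ≤ y := by
          rw [← ENNReal.toReal_ofReal hy.1]
          exact ENNReal.toReal_mono ENNReal.ofReal_ne_top hκy
        have h1 : Tendsto (fun n => (m n : ℝ) / V n) atTop (𝓝 κ.toReal) := by
          refine ((ENNReal.tendsto_toReal hκtop).comp hr).congr' ?_
          filter_upwards [hV0] with n hn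
          simp only [Function.comp_apply]
          rw [ENNReal.toReal_ofReal (by positivity)]
        have h2 : Tendsto (fun n => (⌈y * V n⌉₊ : ℝ) / V n) atTop (𝓝 y) :=
          (tendsto_nat_ceil_mul_div_atTop hy.1).comp hV
        have h3 : Tendsto (fun n => 1 / V n) atTop (𝓝 0) := hV.const_div_atTop 1
        have h4 := (h1.max h2).add h3
        rw [max_eq_right hk, add_zero] at h4
        refine h4.congr' ?_
        filter_upwards [hV0] with n hn
        rw [hlcoe, max_div_div_right hn.le, Nat.cast_one]
        ring
    filter_upwards [eventually_le_finitePressure hd hβ hb hab α μ hV hml hl hj hly ht hJx hε0]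
      with n hn
    linarith
  · intro p hp
    set ε := (p - reducedFunctional d β a b μ y) / 4 with hε
    have hε0 : 0 < ε := by
      rw [hε]
      linarith
    have hc := continuous_maxPressure (d := d) hd hβ ha hab (isClosed_longDensities κ)
      ⟨0, zero_mem_longDensities κ⟩ (longDensities_subset κ)
    have hmp := maxPressure_eq hy hmax
    -- The shift `η` needed in the upper bound is made harmless by continuity of the maximal
    -- pressure in the potential.
    have hev : ∀ᶠ ν in 𝓝[>] μ, maxPressure d β a b (longDensities κ) ν <
        reducedFunctional d β a b μ y + ε :=
      (hc.continuousAt.eventually (gt_mem_nhds (by rw [hmp]; linarith))).filter_mono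
        nhdsWithin_le_nhds
    obtain ⟨ν, hν, hνμ⟩ := (hev.and self_mem_nhdsWithin).exists
    set η := ν - μ with hη
    have hη0 : 0 < η := sub_pos.2 hνμ
    have hμη : μ + η = ν := by
      rw [hη]
      ring
    have hS : ∀ z ∈ longDensities κ, reducedFunctional d β a b (μ + η) z ≤
        reducedFunctional d β a b μ y + ε := by
      intro z hz
      obtain ⟨y', hy', hmax'⟩ := exists_isMaxOn_longDensities (d := d) hd hβ ha hab κ ν
      rw [maxPressure_eq hy' hmax'] at hν
      rw [hμη]
      exact le_trans (hmax' hz) hν.le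
    have hτ : Tendsto (fun n => tailWeight d β (m n) / β +
        Real.log (1 - Real.exp (-(β * η)))⁻¹ / (β * V n)) atTop (𝓝 (0 / β + 0)) :=
      (((tendsto_tailWeight hd hβ).comp hm).div_const β).add
        ((hV.const_mul_atTop hβ).const_div_atTop _)
    rw [zero_div, add_zero] at hτ
    filter_upwards [hV0, eventually_reducedFunctional_le hd hβ ha hab hS hε0 hr,
      hτ.eventually (gt_mem_nhds hε0)] with n hn hSn hτn
    have := finitePressure_le hd hβ hb hab hn α hη0 hSn
    linarith

lemma volume_centredBox_lt_top (L : Fin d → ℝ) : volume (centredBox L) < ⊤ := by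
  refine Bornology.IsBounded.measure_lt_top ?_
  refine (Metric.isBounded_closedBall (x := (0 : EuclideanSpace ℝ (Fin d)))
    (r := Real.sqrt (∑ i, (L i / 2) ^ 2))).subset fun x hx => ?_
  rw [mem_closedBall_zero_iff, EuclideanSpace.norm_eq]
  refine Real.sqrt_le_sqrt (Finset.sum_le_sum fun i _ => ?_)
  rw [Real.norm_eq_abs]
  exact pow_le_pow_left₀ (abs_nonneg _) (hx i) 2

/-- The thermodynamic pressure is the maximum of the reduced functional. -/
theorem hasPressure_of_isMaxOn (hd : 1 ≤ d) (hβ : 0 < β) (hb : 0 < b) (hab : b < a) (α : ℝ) {μ : ℝ}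
    {κ : ℝ≥0∞} {y : ℝ} (hy : y ∈ longDensities κ)
    (hmax : IsMaxOn (reducedFunctional d β a b μ) (longDensities κ) y) :
    HasPressure d β α μ a b κ (reducedFunctional d β a b μ y) := by
  intro L m _ hvol hm hr
  have hfin := fun n => (volume_centredBox_lt_top (L n)).ne
  have hV : Tendsto (fun n => (volume (centredBox (L n))).toReal) atTop atTop := by
    refine tendsto_atTop.2 fun R => ?_
    filter_upwards [hvol.eventually (lt_mem_nhds (ENNReal.ofReal_lt_top (r := R)))] with n hn
    exact (ENNReal.ofReal_le_iff_le_toReal (hfin n)).1 hn.le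
  refine tendsto_finitePressure hd hβ hb hab α hy hmax hV hm (hr.congr' ?_)
  filter_upwards [hV.eventually_gt_atTop 0] with n hn
  rw [ENNReal.ofReal_div_of_pos hn, ENNReal.ofReal_toReal (hfin n), ENNReal.ofReal_natCast]

end

end CycleHYL

open CycleHYL

/-! ### Assembly of the three cases -/

theorem mainTheorem4 (d : ℕ) (hd : 1 ≤ d) (β a b : ℝ) (hβ : 0 < β) (hb : 0 < b) (hab : b < a) :
    ∃ μstar : ℝ,
      (CycleHYL.IsTransition d β a b 0 μstar ∧
        CycleHYL.muT d β a b ≤ μstar ∧ (μstar : EReal) ≤ CycleHYL.muC d β a) ∧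
      (∀ α < 0, ∀ μ : ℝ,
        (μ ≤ μstar → CycleHYL.HasPressure d β α μ a b 0 (CycleHYL.pSub d β a μ)) ∧
        (μstar ≤ μ → CycleHYL.HasPressure d β α μ a b 0 (CycleHYL.pSup d β a b μ))) ∧
      (∀ κ : ℝ, 0 < κ →
        ∃ μstarκ : ℝ,
          (CycleHYL.IsTransition d β a b (ENNReal.ofReal κ) μstarκ ∧
            (CycleHYL.muR d β a b κ ≤ μstar → μstarκ = μstar) ∧
            (μstar < CycleHYL.muR d β a b κ →
              μstar < μstarκ ∧ μstarκ < CycleHYL.muR d β a b κ)) ∧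
          (∀ α < 0, ∀ μ : ℝ,
            (μ ≤ μstarκ →
              CycleHYL.HasPressure d β α μ a b (ENNReal.ofReal κ) (CycleHYL.pSub d β a μ)) ∧
            (μstarκ ≤ μ → μ ≤ CycleHYL.muR d β a b κ →
              CycleHYL.HasPressure d β α μ a b (ENNReal.ofReal κ)
                (CycleHYL.pSub d β a (μ - a * κ) + μ * κ - (a - b) / 2 * κ ^ 2)) ∧
            (max (CycleHYL.muR d β a b κ) μstar ≤ μ →
              CycleHYL.HasPressure d β α μ a b (ENNReal.ofReal κ)
                (CycleHYL.pSup d β a b μ)))) ∧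
      (∀ α < 0, ∀ μ : ℝ,
        CycleHYL.HasPressure d β α μ a b ⊤ (CycleHYL.pSub d β a μ)) := by
  have ha := hb.trans hab
  obtain ⟨m, h, hmT, hmC⟩ := exists_isThreshold hd hβ hb hab
  have hsub : ∀ (κ : ENNReal) (α μ : ℝ), IsMaxOn (reducedFunctional d β a b μ) (longDensities κ) 0 →
      HasPressure d β α μ a b κ (pSub d β a μ) := fun κ α μ hmax => by
    have := hasPressure_of_isMaxOn hd hβ hb hab α (zero_mem_longDensities κ) hmax
    rwa [reducedFunctional_zero] at this
  have hsub' : ∀ (κ : ENNReal) (α : ℝ), ∀ μ ≤ m, HasPressure d β α μ a b κ (pSub d β a μ) :=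
    fun κ α μ hμ => hsub κ α μ ((h.isMaxOn_zero μ hμ).on_subset (longDensities_subset κ))
  have hpeak : ∀ (κ : ENNReal) (α μ y : ℝ), y ∈ longDensities κ → IsPeak d β a b μ y →
      HasPressure d β α μ a b κ (pSup d β a b μ) := fun κ α μ y hyκ hy => by
    rw [hy.pSup_eq hd hβ hb hab]
    exact hasPressure_of_isMaxOn hd hβ hb hab α hyκ
      (hy.isMaxOn.on_subset (longDensities_subset κ))
  have hsup : ∀ (κ : ENNReal) (α : ℝ), HasPressure d β α m a b κ (pSup d β a b m) := fun κ α => by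
    rw [h.pSup_eq hd hβ hb hab, reducedFunctional_zero]
    exact hsub' κ α m le_rfl
  refine ⟨m, ⟨h.isTransition_zero hd hβ hb hab, hmT, hmC⟩, fun α _ μ => ⟨hsub' 0 α μ, fun hμ => ?_⟩,
    fun κ hκ => ?_, fun α _ μ => hsub ⊤ α μ ?_⟩
  · rcases hμ.eq_or_lt with rfl | hμ
    · exact hsup 0 α
    · obtain ⟨y, hy⟩ := h.exists_isPeak hd hβ hb hab hμ
      exact hpeak 0 α μ y (by rw [longDensities_zero]; exact hy.pos.le) hy
  · have hhigh : ∀ α μ : ℝ, max (muR d β a b κ) m ≤ μ →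
        HasPressure d β α μ a b (ENNReal.ofReal κ) (pSup d β a b μ) := by
      intro α μ hμ
      rcases ((le_max_right _ _).trans hμ).eq_or_lt with rfl | hμm
      · exact hsup _ α
      · obtain ⟨y, hyκ, hy⟩ := h.exists_isPeak_mem hd hβ hb hab hμm hκ ((le_max_left _ _).trans hμ)
        exact hpeak _ α μ y hyκ hy
    have hmid : ∀ α μ : ℝ,
        IsMaxOn (reducedFunctional d β a b μ) (longDensities (ENNReal.ofReal κ)) κ →
        HasPressure d β α μ a b (ENNReal.ofReal κ)
          (pSub d β a (μ - a * κ) + μ * κ - (a - b) / 2 * κ ^ 2) := fun α μ hmax =>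
      hasPressure_of_isMaxOn hd hβ hb hab α (mem_longDensities_self hκ) hmax
    rcases le_or_gt (muR d β a b κ) m with hr | hr
    · refine ⟨m, ⟨h.isTransition_of_muR_le hd hβ hb hab hκ hr, fun _ => rfl,
        fun hlt => absurd hlt (not_lt.2 hr)⟩, fun α _ μ => ⟨hsub' _ α μ, fun h1 h2 => ?_, hhigh α μ⟩⟩
      -- When `μ_r ≤ μ*`, the middle interval is empty or the single point `μ_r = μ*`, where `κ` is
      -- a peak.
      have hμ : μ = m := le_antisymm (h2.trans hr) h1
      subst hμ
      have hreq : muR d β a b κ = μ := le_antisymm hr h2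
      exact hmid α μ ((h.isPeak_of_muR_eq hd hβ hb hab hκ hreq).isMaxOn.on_subset
        (longDensities_subset _))
    · obtain ⟨mκ, h1, h2, hlow, hzero, hpos⟩ := h.exists_gain_eq_zero hd hβ hb hab hκ hr
      refine ⟨mκ, ⟨h.isTransition_of_lt_muR hd hβ hb hab hκ h1 h2 hlow hpos,
        fun hle => absurd hr (not_lt.2 hle), fun _ => ⟨h1, h2⟩⟩,
        fun α _ μ => ⟨fun hμ => hsub _ α μ ?_, fun hμ hμr => hmid α μ ?_, hhigh α μ⟩⟩
      · refine isMaxOn_zero_of_gain_nonpos hd hβ hb hab hκ (hμ.trans_lt h2) ?_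
        rcases hμ.eq_or_lt with rfl | hlt
        exacts [hzero.le, (hlow μ hlt).le]
      · rcases hμr.lt_or_eq with hlt | rfl
        · refine isMaxOn_of_gain_nonneg hd hβ hb hab hκ hlt ?_
          rcases hμ.eq_or_lt with rfl | hlt'
          exacts [hzero.ge, (hpos μ hlt').le]
        -- The endpoint `μ = μ_r` needs the peak itself, since the comparison of `0` with `κ` alone
        -- is available only strictly below `μ_r`.
        · obtain ⟨y, hy⟩ := h.exists_isPeak hd hβ hb hab hr
          have hyκ := hy.eq_of_muR_eq hd hβ hb hab hκ
          rw [hyκ] at hy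
          exact hy.isMaxOn.on_subset (longDensities_subset _)
  · rw [longDensities_top]
    intro y hy
    rw [Set.mem_singleton_iff.1 hy]
    exact le_refl (reducedFunctional d β a b μ 0)
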